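/- **Setting.** $K\ge 1$ agents solve $\min_{x\in\mathbb R^{d_1}}\max_{y\in\mathbb R^{d_2}} J(x,y)=\frac1K\sum_{k=1}^K J_k(x,y)$ with $J_k(x,y)=\mathbb E_{\zeta_k}[Q_k(x,y;\zeta_k)]$ (online setting), where the $Q_k(\cdot,\cdot;\zeta)$ and the $J_k$ are differentiable. Assume: 1. for every $x$ the maximum $P(x)=\max_y J(x,y)$ is attained; $\|\nabla_y J(x,y)\|^2\ge 2\nu\,(P(x)-J(x,y))$ for all $x,y$ (the $\nu$-PL condition, $\nu>0$); and $P^\star=\inf_x P(x)>-\infty$; 2. for $w\in\{x,y\}$ and all $k$, $\mathbb E\|\nabla_wQ_k(x_1,y_1;\zeta_k)-\nabla_wQ_k(x_2,y_2;\zeta_k)\|^2\le L_f^2(\|x_1-x_2\|^2+\|y_1-y_2\|^2)$, with $L_f\ge\nu$; put $\kappa=L_f/\nu\ge1$ and $L=L_f(1+\kappa/2)$; 3. for $w\in\{x,y\}$ and all $k$, $x$, $y$, $\mathbb E\,\nabla_wQ_k(x,y;\zeta_k)=\nabla_wJ_k(x,y)$ and $\mathbb E\|\nabla_wQ_k(x,y;\zeta_k)-\nabla_wJ_k(x,y)\|^2\le\sigma^2$;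 the samples are independent over agents, iterations and within batches, those of agent $k$ being distributed as $\zeta_k$; 4. $W\in\mathbb R^{K\times K}$ is symmetric, doubly stochastic, primitive and positive semidefinite, with eigenvalues $1=\lambda_1\ge\lambda_2\ge\dots\ge\lambda_K$; put $\lambda=\max_{i\ge2}\lambda_i$ ($\lambda=0$ if $K=1$). **Algorithm** (DAMA with exact diffusion and STORM, $p=0$). Let $\mathcal A=W\otimes I$, $\mathcal B=(I-W\otimes I)^{1/2}$, $\mathcal C=I$ (with the identity factor of size $d_1$ for $x$ and $d_2$ for $y$). Start from $\mathcal X_0=\mathbf 1\otimes x_0$, $\mathcal Y_0=\mathbf 1\otimes y_0$, $\mathcal D_{x,0}=\mathbf 1\otimes d_{x,0}$, $\mathcal D_{y,0}=\mathbf 1\otimes d_{y,0}$, with $\mathcal M_{x,0},\mathcal M_{y,0}$ the block vectors of averages of $b_0$ sample gradients per agent. For $i\ge0$, $$\mathcal X_{i+1}=\mathcal A(\mathcal C\mathcal X_i-\mu_x\mathcal M_{x,i})-\mathcal B\mathcal D_{x,i},\quad \mathcal Y_{i+1}=\mathcal A(\mathcal C\mathcal Y_i+\mu_y\mathcal M_{y,i})-\mathcal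 B\mathcal D_{y,i},$$ $$\mathcal D_{x,i+1}=\mathcal D_{x,i}+\mathcal B\mathcal X_{i+1},\quad \mathcal D_{y,i+1}=\mathcal D_{y,i}+\mathcal B\mathcal Y_{i+1},$$ and for $w\in\{x,y\}$, with a fresh batch of $b$ samples per agent (the same for $x$ and $y$), $$\mathcal M_{w,i+1}=(1-\beta)\big(\mathcal M_{w,i}-\widehat\nabla_{w,i+1}(\mathcal X_i,\mathcal Y_i)\big)+\widehat\nabla_{w,i+1}(\mathcal X_{i+1},\mathcal Y_{i+1}),$$ where $\widehat\nabla_{w,i+1}$ denotes the block vector of minibatch gradients in $w$ computed with that batch. Let $x_{c,i},y_{c,i}$ be the averages of the agents' variables and put $$\mathcal E_T=\frac1T\sum_{i=0}^{T-1}\big(\mathbb E\|\nabla_xJ(x_{c,i},y_{c,i})\|^2+\mathbb E\|\nabla_yJ(x_{c,i},y_{c,i})\|^2\big),\quad G_{p,0}=P(x_0)-P^\star,\quad \Delta_{c,0}=P(x_0)-J(x_0,y_0),$$ $$\zeta_0^2=\frac1K\sum_{w\in\{x,y\}}\mathbb E\big\|\big((W-\tfrac1K\mathbf 1\mathbf 1^\top)\otimes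 I\big)\mathcal M_{w,0}\big\|^2.$$ **Hyperparameters.** $\mu_x=c_x\frac{K^{2/3}}{T^{1/3}\kappa^2}$, $\mu_y=c_y\frac{K^{2/3}}{T^{1/3}}$, $\beta_x=\beta_y=\beta=c_\beta\frac{K^{1/3}}{T^{2/3}}$, $p=0$, $b\ge1$ fixed, and $b_0\in\mathbb N$ with $c_0\frac{T^{1/3}}{K^{2/3}}\le b_0\le c_1\frac{T^{1/3}}{K^{2/3}}$. For $\delta>0$ call them *$\delta$-admissible* if $$\mu_x\le\delta\min\Big\{\frac1L,\frac{\mu_y}{\kappa^2},\frac{\sqrt{Kb\beta}}{\kappa L_f}\Big\},\qquad \beta\le\min\Big\{\frac{\nu\mu_y}2,\frac1{bK},1\Big\},$$ $$\mu_y\le\delta\min\Big\{\frac1\nu,\frac1{L_f},\frac{\sqrt{Kb\beta}}{L_f},\frac{(1-\sqrt\lambda)\sqrt{1-\lambda}}{L_f\lambda},\frac{(1-\sqrt\lambda)\sqrt{1-\lambda}}{L_f\lambda}\sqrt{\frac b\beta},\frac{(1-\sqrt\lambda)^{2/3}(1-\lambda)^{1/3}(Kb\beta)^{1/3}}{L_f\kappa^{1/3}\lambda^{2/3}}\Big\}$$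 (bounds with $\lambda$ in the denominator are void if $\lambda=0$). **Claim.** There is a numerical constant $\delta\in(0,1]$ such that the following holds for all $L_f,c_x,c_y,c_\beta,c_0>0$, $c_1>c_0$ and $b\ge1$ with $c_x\le\delta c_y$ and $c_y\le\delta\sqrt{bc_\beta}/L_f$. (a) For all $\nu\in(0,L_f]$, $\lambda\in[0,1)$, $K\ge1$ there is $T_0$ such that for all $T\ge T_0$ an integer $b_0$ as above exists and the hyperparameters are $\delta$-admissible. (b) There is $C$, depending only on $L_f,c_x,c_y,c_\beta,c_0,c_1,b$, such that for every problem, network, starting point, $T\ge1$ and $b_0$ as above for which the hyperparameters are $\delta$-admissible, the expectations in $\mathcal E_T$ are finite and $$\mathcal E_T\le C\Big(\frac{\kappa^2G_{p,0}}{(KT)^{2/3}}+\frac{\kappa^2\Delta_{c,0}}{(KT)^{2/3}}+\frac{\kappa^2\sigma^2}{(KT)^{2/3}}+\frac{\kappa^2\zeta_0^2}{T(1-\lambda)^2}+\frac{\kappa^2\lambda^2K^{2/3}\sigma^2}{T^{4/3}(1-\lambda)^3}+\frac{\kappa^2\lambda^2K\sigma^2}{T^2(1-\lambda)^3}+\frac{\kappa^2\lambda^2K^{5/3}\zeta_0^2}{T^{7/3}(1-\lambda)^4}\Big);$$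 this is dominated by its first four terms: $\mathcal E_T\le C\big(\frac{\kappa^2(G_{p,0}+\Delta_{c,0}+\sigma^2)}{(KT)^{2/3}}+\frac{\kappa^2\zeta_0^2}{T(1-\lambda)^2}\big)$. (c) (Transient time.) For $\kappa>0$, $\lambda\in[0,1)$, $K,T\ge1$, each of $\frac{\kappa^2}{T(1-\lambda)^2}$, $\frac{\lambda^2\kappa^2K^{2/3}}{T^{4/3}(1-\lambda)^3}$, $\frac{\lambda^2\kappa^2K}{T^2(1-\lambda)^3}$, $\frac{\lambda^2\kappa^2K^{5/3}}{T^{7/3}(1-\lambda)^4}$ is at most $\frac{\kappa^2}{(KT)^{2/3}}$ if and only if $$T\ge\max\Big\{\frac{\lambda^{6/5}K^{7/5}}{(1-\lambda)^{2.4}},\frac{\lambda^{3/2}K^{5/4}}{(1-\lambda)^{9/4}},\frac{\lambda^3K^2}{(1-\lambda)^{4.5}},\frac{K^2}{(1-\lambda)^6}\Big\}.$$ For such $T$, in the situation of (b), linear speedup holds: $\mathcal E_T\le C\kappa^2(G_{p,0}+\Delta_{c,0}+\sigma^2+\zeta_0^2)/(KT)^{2/3}$. (d) (Sample complexity.) Let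 $S(\varepsilon)=\frac{\kappa^3\varepsilon^{-3}}K+\frac{\kappa^2\varepsilon^{-2}}{(1-\lambda)^2}+\frac{\kappa^{1.5}\lambda^{1.5}K^{0.5}\varepsilon^{-1.5}}{(1-\lambda)^{9/4}}$. For each $D>0$ there are $C_D,M_D>0$, depending only on $D,L_f,c_x,c_y,c_\beta,c_0,c_1,b$, such that: in the situation of (b), if $G_{p,0}+\Delta_{c,0}+\sigma^2+\zeta_0^2\le D$ and $T\ge C_DS(\varepsilon)$, $\varepsilon>0$, then $\mathcal E_T\le\varepsilon^2$; and for all $\nu\in(0,L_f]$, $\lambda\in[0,1)$, $K\ge1$ there is $\varepsilon_0>0$ such that for $0<\varepsilon\le\varepsilon_0$ and $T=\lceil C_DS(\varepsilon)\rceil$ we have $T\ge1$, an integer $b_0$ as above exists, and for every such $b_0$ the hyperparameters are $\delta$-admissible and the number $b_0+bT$ of samples per agent is at most $M_DS(\varepsilon)$. -/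

import Mathlib

open MeasureTheory ProbabilityTheory
open scoped Matrix

namespace DAMA

noncomputable section

/-- `ℝᵈ` with its Euclidean norm. -/
abbrev Vec (d : ℕ) : Type := EuclideanSpace ℝ (Fin d)

/-- A block vector `col{X₁, …, X_K} ∈ ℝ^{Kd}`, one block per agent. -/
abbrev Block (K d : ℕ) : Type := Fin K → Vec d

/-! ## The stochastic minimax problem (online setting) -/

/-- Data of the online problem: agent `k` has the loss `Q_k(x, y; ζ)` and observes samples `ζ`
with distribution `law k`. -/
structure Problem (K d₁ d₂ : ℕ) (Ξ : Type*) [MeasurableSpace Ξ] where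
  law : Fin K → Measure Ξ
  loss : Fin K → Vec d₁ → Vec d₂ → Ξ → ℝ

namespace Problem

variable {K d₁ d₂ : ℕ} {Ξ : Type*} [MeasurableSpace Ξ] (Q : Problem K d₁ d₂ Ξ)

/-- Local risk `J_k(x, y) = 𝔼 Q_k(x, y; ζ_k)`. -/
def localCost (k : Fin K) (x : Vec d₁) (y : Vec d₂) : ℝ := ∫ ζ, Q.loss k x y ζ ∂Q.law k

/-- Global risk `J(x, y) = (1/K) ∑ₖ J_k(x, y)`. -/
def cost (x : Vec d₁) (y : Vec d₂) : ℝ := (1 / (K : ℝ)) * ∑ k, Q.localCost k x y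

/-- `P(x) = max_y J(x, y)` (the maximum is attained under `Regular`). -/
def primal (x : Vec d₁) : ℝ := ⨆ y, Q.cost x y

/-- `P⋆ = inf_x P(x)`. -/
def primalInf : ℝ := ⨅ x, Q.primal x

/-- Sample gradient `∇ₓ Q_k(x, y; ζ)`. -/
def lossGradX (k : Fin K) (x : Vec d₁) (y : Vec d₂) (ζ : Ξ) : Vec d₁ :=
  gradient (fun u => Q.loss k u y ζ) x

/-- Sample gradient `∇_y Q_k(x, y; ζ)`. -/
def lossGradY (k : Fin K) (x : Vec d₁) (y : Vec d₂) (ζ : Ξ) : Vec d₂ :=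
  gradient (fun u => Q.loss k x u ζ) y

/-- `∇ₓ J_k(x, y)`. -/
def localGradX (k : Fin K) (x : Vec d₁) (y : Vec d₂) : Vec d₁ :=
  gradient (fun u => Q.localCost k u y) x

/-- `∇_y J_k(x, y)`. -/
def localGradY (k : Fin K) (x : Vec d₁) (y : Vec d₂) : Vec d₂ :=
  gradient (fun u => Q.localCost k x u) y

/-- `∇ₓ J(x, y)`. -/
def costGradX (x : Vec d₁) (y : Vec d₂) : Vec d₁ := gradient (fun u => Q.cost u y) x

/-- `∇_y J(x, y)`. -/
def costGradY (x : Vec d₁) (y : Vec d₂) : Vec d₂ := gradient (fun u => Q.cost x u) y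

/-- The problem is well posed: the sample distributions are probability measures, the losses are
differentiable in `(x, y)` and integrable in the sample, the sample gradients are measurable, the
local risks are differentiable, and for each `x` the maximum of `J(x, ·)` is attained. -/
structure Regular : Prop where
  law_prob : ∀ k, IsProbabilityMeasure (Q.law k)
  loss_diff : ∀ k ζ, Differentiable ℝ fun p : Vec d₁ × Vec d₂ => Q.loss k p.1 p.2 ζ
  loss_integrable : ∀ k x y, Integrable (Q.loss k x y) (Q.law k)
  lossGradX_meas : ∀ k,
    Measurable fun p : (Vec d₁ × Vec d₂) × Ξ => Q.lossGradX k p.1.1 p.1.2 p.2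
  lossGradY_meas : ∀ k,
    Measurable fun p : (Vec d₁ × Vec d₂) × Ξ => Q.lossGradY k p.1.1 p.1.2 p.2
  localCost_diff : ∀ k, Differentiable ℝ fun p : Vec d₁ × Vec d₂ => Q.localCost k p.1 p.2
  max_attained : ∀ x, ∃ yo, ∀ y, Q.cost x y ≤ Q.cost x yo

/-- `J(x, ·)` satisfies the `ν`-Polyak–Łojasiewicz condition for every `x`, and `P` is bounded
below. -/
structure PLCondition (ν : ℝ) : Prop where
  pl : ∀ x y, 2 * ν * (Q.primal x - Q.cost x y) ≤ ‖Q.costGradY x y‖ ^ 2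
  primal_bddBelow : BddBelow (Set.range Q.primal)

/-- Expected `L_f`-smoothness of the sample gradients. -/
structure ExpectedSmooth (Lf : ℝ) : Prop where
  gradX : ∀ k x y x' y',
    ∫⁻ ζ, ‖Q.lossGradX k x y ζ - Q.lossGradX k x' y' ζ‖ₑ ^ 2 ∂Q.law k
      ≤ ENNReal.ofReal (Lf ^ 2 * (‖x - x'‖ ^ 2 + ‖y - y'‖ ^ 2))
  gradY : ∀ k x y x' y',
    ∫⁻ ζ, ‖Q.lossGradY k x y ζ - Q.lossGradY k x' y' ζ‖ₑ ^ 2 ∂Q.law k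
      ≤ ENNReal.ofReal (Lf ^ 2 * (‖x - x'‖ ^ 2 + ‖y - y'‖ ^ 2))

/-- The sample gradients are unbiased with variance at most `σ²`. -/
structure GradientNoise (σ : ℝ) : Prop where
  unbiasedX : ∀ k x y, ∫ ζ, Q.lossGradX k x y ζ ∂Q.law k = Q.localGradX k x y
  unbiasedY : ∀ k x y, ∫ ζ, Q.lossGradY k x y ζ ∂Q.law k = Q.localGradY k x y
  varianceX : ∀ k x y,
    ∫⁻ ζ, ‖Q.lossGradX k x y ζ - Q.localGradX k x y‖ₑ ^ 2 ∂Q.law k ≤ ENNReal.ofReal (σ ^ 2)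
  varianceY : ∀ k x y,
    ∫⁻ ζ, ‖Q.lossGradY k x y ζ - Q.localGradY k x y‖ₑ ^ 2 ∂Q.law k ≤ ENNReal.ofReal (σ ^ 2)

/-- `ξ i j k` is the `j`-th sample drawn by agent `k` at iteration `i`; all samples are independent
and those of agent `k` have distribution `law k`. -/
structure IsSampling {Ω : Type*} [MeasurableSpace Ω] (Pr : Measure Ω)
    (ξ : ℕ → ℕ → Fin K → Ω → Ξ) : Prop where
  meas : ∀ i j k, Measurable (ξ i j k)
  law_eq : ∀ i j k, Pr.map (ξ i j k) = Q.law k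
  indep : iIndepFun (fun t : ℕ × ℕ × Fin K => ξ t.1 t.2.1 t.2.2) Pr

end Problem

/-! ## The network -/

/-- `(A ⊗ I_d) X`. -/
def blockMul {K d : ℕ} (A : Matrix (Fin K) (Fin K) ℝ) (X : Block K d) : Block K d :=
  fun k => ∑ l, A k l • X l

/-- Network average `(1/K) ∑ₖ X_k`. -/
def centroid {K d : ℕ} (X : Block K d) : Vec d := (1 / (K : ℝ)) • ∑ k, X k

/-- `‖X‖²` for a block vector. -/
def blockNormSq {K d : ℕ} (X : Block K d) : ℝ := ∑ k, ‖X k‖ ^ 2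

/-- The averaging matrix `(1/K) 𝟙𝟙ᵀ`. -/
def avgMatrix (K : ℕ) : Matrix (Fin K) (Fin K) ℝ := fun _ _ => 1 / (K : ℝ)

/-- Combination matrix: symmetric, doubly stochastic, primitive. -/
structure IsCombination {K : ℕ} (W : Matrix (Fin K) (Fin K) ℝ) : Prop where
  symm : W.IsSymm
  stochastic : W ∈ doublyStochastic ℝ (Fin K)
  primitive : W.IsPrimitive

/-- `λ = max_{i = 2, …, K} λ_i(W)`: for a symmetric doubly stochastic `W` the eigenvalues
`λ₂, …, λ_K` are those with an eigenvector orthogonal to `𝟙`. (It is `0` if `K = 1`.) -/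
def mixing {K : ℕ} (W : Matrix (Fin K) (Fin K) ℝ) : ℝ :=
  sSup {w : ℝ | ∃ v : Fin K → ℝ, v ≠ 0 ∧ ∑ k, v k = 0 ∧ W *ᵥ v = w • v}

/-- The `K × K` factors of the design matrices `𝒜 = A ⊗ I`, `ℬ = B ⊗ I`, `𝒞 = C ⊗ I`, which are
used for the `x`- and for the `y`-variables. -/
structure Design (K : ℕ) where
  A : Matrix (Fin K) (Fin K) ℝ
  B : Matrix (Fin K) (Fin K) ℝ
  C : Matrix (Fin K) (Fin K) ℝ

open scoped MatrixOrder in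
/-- Exact diffusion: `𝒜 = W ⊗ I`, `ℬ = (I - W ⊗ I)^{1/2} = (I - W)^{1/2} ⊗ I`, `𝒞 = I`. -/
def Design.ED {K : ℕ} (W : Matrix (Fin K) (Fin K) ℝ) : Design K where
  A := W
  B := CFC.sqrt (1 - W)
  C := 1

/-! ## DAMA with the STORM gradient estimator -/

/-- Step sizes, smoothing factor `β = β_x = β_y`, initial batch size and batch size. -/
structure Hyper where
  μx : ℝ
  μy : ℝ
  β : ℝ
  b₀ : ℕ
  b : ℕ

/-- Primal variables, dual variables and gradient estimates of all agents at one iteration. -/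
structure State (K d₁ d₂ : ℕ) where
  X : Block K d₁
  Y : Block K d₂
  Dx : Block K d₁
  Dy : Block K d₂
  Mx : Block K d₁
  My : Block K d₂

section Algorithm

variable {K d₁ d₂ : ℕ} {Ξ : Type*} [MeasurableSpace Ξ] (Q : Problem K d₁ d₂ Ξ)

/-- Minibatch gradients `(1/n) ∑_{j < n} ∇ₓ Q_k(X_k, Y_k; s_{j,k})`. -/
def batchX (n : ℕ) (s : ℕ → Fin K → Ξ) (X : Block K d₁) (Y : Block K d₂) : Block K d₁ :=
  fun k => (1 / (n : ℝ)) • ∑ j ∈ Finset.range n, Q.lossGradX k (X k) (Y k) (s j k)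

/-- Minibatch gradients `(1/n) ∑_{j < n} ∇_y Q_k(X_k, Y_k; s_{j,k})`. -/
def batchY (n : ℕ) (s : ℕ → Fin K → Ξ) (X : Block K d₁) (Y : Block K d₂) : Block K d₂ :=
  fun k => (1 / (n : ℝ)) • ∑ j ∈ Finset.range n, Q.lossGradY k (X k) (Y k) (s j k)

/-- Initial state: consensual primal and dual variables, gradient estimates from `b₀` samples per
agent. -/
def initState (h : Hyper) (x₀ dx₀ : Vec d₁) (y₀ dy₀ : Vec d₂) (s : ℕ → Fin K → Ξ) :
    State K d₁ d₂ where
  X := fun _ => x₀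
  Y := fun _ => y₀
  Dx := fun _ => dx₀
  Dy := fun _ => dy₀
  Mx := batchX Q h.b₀ s (fun _ => x₀) (fun _ => y₀)
  My := batchY Q h.b₀ s (fun _ => x₀) (fun _ => y₀)

/-- One iteration: primal descent in `x` and ascent in `y`, dual update, and the STORM update
`M⁺ = (1 - β) (M - ∇Q(X, Y; s)) + ∇Q(X⁺, Y⁺; s)` with one fresh batch `s` of size `b`. -/
def stepState (S : Design K) (h : Hyper) (s : ℕ → Fin K → Ξ) (z : State K d₁ d₂) :
    State K d₁ d₂ :=
  let X := blockMul S.A (blockMul S.C z.X - h.μx • z.Mx) - blockMul S.B z.Dx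
  let Y := blockMul S.A (blockMul S.C z.Y + h.μy • z.My) - blockMul S.B z.Dy
  { X := X
    Y := Y
    Dx := z.Dx + blockMul S.B X
    Dy := z.Dy + blockMul S.B Y
    Mx := (1 - h.β) • (z.Mx - batchX Q h.b s z.X z.Y) + batchX Q h.b s X Y
    My := (1 - h.β) • (z.My - batchY Q h.b s z.X z.Y) + batchY Q h.b s X Y }

/-- State after `i` iterations, driven by the samples `s i j k`. -/
def iterate (S : Design K) (h : Hyper) (x₀ dx₀ : Vec d₁) (y₀ dy₀ : Vec d₂)
    (s : ℕ → ℕ → Fin K → Ξ) : ℕ → State K d₁ d₂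
  | 0 => initState Q h x₀ dx₀ y₀ dy₀ (s 0)
  | i + 1 => stepState Q S h (s (i + 1)) (iterate S h x₀ dx₀ y₀ dy₀ s i)

/-- `‖∇ₓ J(x_c, y_c)‖² + ‖∇_y J(x_c, y_c)‖²` at the network centroid of a state. -/
def gradNormSq (z : State K d₁ d₂) : ℝ :=
  ‖Q.costGradX (centroid z.X) (centroid z.Y)‖ ^ 2 +
    ‖Q.costGradY (centroid z.X) (centroid z.Y)‖ ^ 2

/-- `(1/T) ∑_{i < T} 𝔼 (‖∇ₓ J(x_{c,i}, y_{c,i})‖² + ‖∇_y J(x_{c,i}, y_{c,i})‖²)` for a random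
trajectory `z`. -/
def avgGradNormSq {Ω : Type*} [MeasurableSpace Ω] (Pr : Measure Ω) (T : ℕ)
    (z : ℕ → Ω → State K d₁ d₂) : ℝ :=
  (1 / (T : ℝ)) * ∑ i ∈ Finset.range T, ∫ ω, gradNormSq Q (z i ω) ∂Pr

/-- Initial discrepancy
`ζ₀² = (1/K) 𝔼‖(𝒜 - (1/K)𝟙𝟙ᵀ ⊗ I) ℳ_{x,0}‖² + (1/K) 𝔼‖(𝒜 - (1/K)𝟙𝟙ᵀ ⊗ I) ℳ_{y,0}‖²`. -/
def initDiscrepancy {Ω : Type*} [MeasurableSpace Ω] (Pr : Measure Ω) (S : Design K)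
    (z : ℕ → Ω → State K d₁ d₂) : ℝ :=
  (1 / (K : ℝ)) * ∫ ω, blockNormSq (blockMul (S.A - avgMatrix K) (z 0 ω).Mx) ∂Pr +
    (1 / (K : ℝ)) * ∫ ω, blockNormSq (blockMul (S.A - avgMatrix K) (z 0 ω).My) ∂Pr

end Algorithm

/-! ## Hyperparameters and rates -/

/-- `μ_x = c_x K^{2/3} / (T^{1/3} κ²)`, `μ_y = c_y K^{2/3} / T^{1/3}`,
`β = c_β K^{1/3} / T^{2/3}`. -/
def stormHyper (cx cy cβ κ : ℝ) (K T b₀ b : ℕ) : Hyper where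
  μx := cx * (K : ℝ) ^ (2 / 3 : ℝ) / ((T : ℝ) ^ (1 / 3 : ℝ) * κ ^ 2)
  μy := cy * (K : ℝ) ^ (2 / 3 : ℝ) / (T : ℝ) ^ (1 / 3 : ℝ)
  β := cβ * (K : ℝ) ^ (1 / 3 : ℝ) / (T : ℝ) ^ (2 / 3 : ℝ)
  b₀ := b₀
  b := b

/-- `b₀` is of the order `T^{1/3} / K^{2/3}`. -/
def InitBatch (c₀ c₁ : ℝ) (K T b₀ : ℕ) : Prop :=
  c₀ * ((T : ℝ) ^ (1 / 3 : ℝ) / (K : ℝ) ^ (2 / 3 : ℝ)) ≤ b₀ ∧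
    (b₀ : ℝ) ≤ c₁ * ((T : ℝ) ^ (1 / 3 : ℝ) / (K : ℝ) ^ (2 / 3 : ℝ))

/-- The hyperparameter conditions for exact diffusion with STORM, with `κ = L_f / ν`,
`L = L_f (1 + κ / 2)` and numerical constant `δ`; a bound `μ ≤ δ u / v` is written `v μ ≤ δ u`. -/
structure Admissible (δ Lf ν lam : ℝ) (K : ℕ) (h : Hyper) : Prop where
  μx_smooth : Lf * (1 + Lf / ν / 2) * h.μx ≤ δ
  μx_ratio : (Lf / ν) ^ 2 * h.μx ≤ δ * h.μy
  μx_batch : Lf / ν * Lf * h.μx ≤ δ * √(K * h.b * h.β)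
  μy_pl : ν * h.μy ≤ δ
  μy_smooth : Lf * h.μy ≤ δ
  μy_batch : Lf * h.μy ≤ δ * √(K * h.b * h.β)
  μy_network : Lf * lam * h.μy ≤ δ * ((1 - √lam) * √(1 - lam))
  μy_network_batch : Lf * lam * h.μy ≤ δ * ((1 - √lam) * √(1 - lam) * √(h.b / h.β))
  μy_cubic : Lf * (Lf / ν) ^ (1 / 3 : ℝ) * lam ^ (2 / 3 : ℝ) * h.μy ≤
    δ * ((1 - √lam) ^ (2 / 3 : ℝ) * (1 - lam) ^ (1 / 3 : ℝ) * (K * h.b * h.β) ^ (1 / 3 : ℝ))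
  β_pl : h.β ≤ ν * h.μy / 2
  β_batch : h.b * h.β ≤ 1 / K
  β_le_one : h.β ≤ 1

/-- The rate, with `G = G_{p,0}`, `Δ = Δ_{c,0}`, `V = σ²` and `Z = ζ₀²`. -/
def rate (κ lam K T G Δ V Z : ℝ) : ℝ :=
  κ ^ 2 * G / (K * T) ^ (2 / 3 : ℝ) + κ ^ 2 * Δ / (K * T) ^ (2 / 3 : ℝ)
    + κ ^ 2 * V / (K * T) ^ (2 / 3 : ℝ)
    + κ ^ 2 * Z / (T * (1 - lam) ^ 2)
    + κ ^ 2 * lam ^ 2 * K ^ (2 / 3 : ℝ) * V / (T ^ (4 / 3 : ℝ) * (1 - lam) ^ 3)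
    + κ ^ 2 * lam ^ 2 * K * V / (T ^ 2 * (1 - lam) ^ 3)
    + κ ^ 2 * lam ^ 2 * K ^ (5 / 3 : ℝ) * Z / (T ^ (7 / 3 : ℝ) * (1 - lam) ^ 4)

/-- The linear-speedup term of the rate dominates each of its network-dependent terms. -/
def LinearSpeedup (κ lam K T : ℝ) : Prop :=
  κ ^ 2 / (T * (1 - lam) ^ 2) ≤ κ ^ 2 / (K * T) ^ (2 / 3 : ℝ) ∧
  lam ^ 2 * κ ^ 2 * K ^ (2 / 3 : ℝ) / (T ^ (4 / 3 : ℝ) * (1 - lam) ^ 3)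
    ≤ κ ^ 2 / (K * T) ^ (2 / 3 : ℝ) ∧
  lam ^ 2 * κ ^ 2 * K / (T ^ 2 * (1 - lam) ^ 3) ≤ κ ^ 2 / (K * T) ^ (2 / 3 : ℝ) ∧
  lam ^ 2 * κ ^ 2 * K ^ (5 / 3 : ℝ) / (T ^ (7 / 3 : ℝ) * (1 - lam) ^ 4)
    ≤ κ ^ 2 / (K * T) ^ (2 / 3 : ℝ)

/-- The transient time. -/
def transientTime (lam K : ℝ) : ℝ :=
  max (max (lam ^ (6 / 5 : ℝ) * K ^ (7 / 5 : ℝ) / (1 - lam) ^ (12 / 5 : ℝ))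
      (lam ^ (3 / 2 : ℝ) * K ^ (5 / 4 : ℝ) / (1 - lam) ^ (9 / 4 : ℝ)))
    (max (lam ^ 3 * K ^ 2 / (1 - lam) ^ (9 / 2 : ℝ)) (K ^ 2 / (1 - lam) ^ 6))

/-- `κ³ε⁻³/K + κ²ε⁻²/(1-λ)² + κ^{3/2} λ^{3/2} K^{1/2} ε^{-3/2} / (1-λ)^{9/4}`. -/
def complexity (κ lam K ε : ℝ) : ℝ :=
  κ ^ 3 * ε⁻¹ ^ 3 / K + κ ^ 2 * ε⁻¹ ^ 2 / (1 - lam) ^ 2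
    + κ ^ (3 / 2 : ℝ) * lam ^ (3 / 2 : ℝ) * K ^ (1 / 2 : ℝ) * ε⁻¹ ^ (3 / 2 : ℝ)
        / (1 - lam) ^ (9 / 4 : ℝ)

end

end DAMA

/-!
The averages of the agents' variables follow inexact gradient descent-ascent:
`x_c⁺ = x_c - μ_x m_x`, `y_c⁺ = y_c + μ_y m_y`, where `m_x`, `m_y` are the averages of the gradient
estimates. The proof controls coupled error quantities along a trajectory.

* *Descent.* Gradient ascent in `y` has finite length under the Polyak–Łojasiewicz condition, so the
  squared distance of `y` to some maximiser is at most a multiple of `(P(x) - J(x, y)) / ν`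
  (`SmoothPL.exists_max_near`). The condition at the new point and this maximiser bounds the increase
  of `P` in one step without differentiating `P`. With `μ_x` of the order `μ_y / κ²`, the potential
  `P(x_c) + (P(x_c) - J(x_c, y_c)) / 16` then decreases by a multiple of
  `μ_x ‖m_x‖² + μ_y (‖∇_y J‖² + ‖m_y‖²)` up to the squared errors of `m_x` and `m_y`
  (`SmoothPL.sum_descent`).
* *Variance reduction.* The noise of the STORM update is, conditionally on the past, centred and
  independent over agents and samples, so the mean-square error of the estimates contracts by
  `1 - β` up to the squared increments of the iterates and `β² σ²`. Averaging over the agents gains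
  a factor `1 / K` (`minibatch_second_moment`, `storm_step`, `traj_recursion`).
* *Consensus.* In an eigenbasis of `W` exact diffusion decouples into scalar second-order recursions
  with characteristic polynomial `z² - 2 w z + w` for the eigenvalues `w` of `W`; its roots have
  modulus `√w`, and since the dual variable cancels a constant input, the accumulated consensus error
  is governed by the increments of the gradient estimates and by their initial discrepancy
  (`sum_norm_sq_le_of_second_order`, `IsExactDiffusion.sum_deviation_le`).
* *Closing the loop.* Summed over time, the estimates form a cycle of linear inequalities in which
  every return carries a small factor under the step size conditions
  (`ErrorRecursion.sum_grad_le`).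

Inserting the step sizes gives the dominating part of the rate (`avgGradNormSq_le`); the remaining
terms of the rate are nonnegative. The statements on the transient time and the sample complexity
are then comparisons of powers of `K`, `T`, `κ` and `1 - λ`.
-/

namespace DAMA

open Filter Topology

/-! ### Minimax optimisation under the Polyak–Łojasiewicz condition -/

/-- `J` is differentiable with partial gradients `gx`, `gy` that are jointly `L`-Lipschitz, `P x` is
an upper bound of `J x ·`, and `J x ·` is `ν`-PL relative to `P x`. That `P x` is attained follows
(`SmoothPL.exists_max_near`). -/
structure SmoothPL {E F : Type*} [NormedAddCommGroup E] [InnerProductSpace ℝ E]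
    [NormedAddCommGroup F] [InnerProductSpace ℝ F]
    (J : E → F → ℝ) (gx : E → F → E) (gy : E → F → F) (P : E → ℝ) (L ν : ℝ) : Prop where
  ν_pos : 0 < ν
  ν_le : ν ≤ L
  hasFDerivAt : ∀ x y, HasFDerivAt (fun p : E × F => J p.1 p.2)
    ((innerSL ℝ (gx x y)).coprod (innerSL ℝ (gy x y))) (x, y)
  lipX : ∀ x y x' y', ‖gx x y - gx x' y'‖ ^ 2 ≤ L ^ 2 * (‖x - x'‖ ^ 2 + ‖y - y'‖ ^ 2)
  lipY : ∀ x y x' y', ‖gy x y - gy x' y'‖ ^ 2 ≤ L ^ 2 * (‖x - x'‖ ^ 2 + ‖y - y'‖ ^ 2)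
  le_max : ∀ x y, J x y ≤ P x
  pl : ∀ x y, 2 * ν * (P x - J x y) ≤ ‖gy x y‖ ^ 2

namespace SmoothPL

variable {E F : Type*} [NormedAddCommGroup E] [InnerProductSpace ℝ E]
    [NormedAddCommGroup F] [InnerProductSpace ℝ F]
    {J : E → F → ℝ} {gx : E → F → E} {gy : E → F → F} {P : E → ℝ} {L ν : ℝ}

theorem L_pos (h : SmoothPL J gx gy P L ν) : 0 < L := h.ν_pos.trans_le h.ν_le

/-- First-order expansion with quadratic remainder. -/
theorem abs_sub_le (h : SmoothPL J gx gy P L ν) (x u : E) (y v : F) :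
    |J (x + u) (y + v) - J x y - (inner ℝ (gx x y) u + inner ℝ (gy x y) v)|
      ≤ 2 * L * (‖u‖ ^ 2 + ‖v‖ ^ 2) := by
  have hL := h.L_pos
  have hd : ∀ t : ℝ, HasDerivAt (fun t : ℝ => J (x + t • u) (y + t • v))
      (inner ℝ (gx (x + t • u) (y + t • v)) u + inner ℝ (gy (x + t • u) (y + t • v)) v) t := by
    intro t
    have h1 : HasDerivAt (fun t : ℝ => (x + t • u, y + t • v)) (u, v) t := by
      refine HasDerivAt.prodMk ?_ ?_
      · simpa using ((hasDerivAt_id t).smul_const u).const_add x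
      · simpa using ((hasDerivAt_id t).smul_const v).const_add y
    have := (h.hasFDerivAt (x + t • u) (y + t • v)).comp_hasDerivAt t h1
    simpa [Function.comp_def] using this
  obtain ⟨t, ht, hs⟩ := exists_hasDerivAt_eq_slope (fun t : ℝ => J (x + t • u) (y + t • v)) _
    zero_lt_one (fun t _ => (hd t).continuousAt.continuousWithinAt) (fun t _ => hd t)
  simp only [one_smul, zero_smul, add_zero, sub_zero, div_one] at hs
  rw [← hs]
  have e : inner ℝ (gx (x + t • u) (y + t • v)) u + inner ℝ (gy (x + t • u) (y + t • v)) v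
      - (inner ℝ (gx x y) u + inner ℝ (gy x y) v)
      = inner ℝ (gx (x + t • u) (y + t • v) - gx x y) u
        + inner ℝ (gy (x + t • u) (y + t • v) - gy x y) v := by
    rw [inner_sub_left, inner_sub_left]; ring
  rw [e]
  have ht2 : t ^ 2 ≤ 1 := by have := ht.1; have := ht.2; nlinarith
  have hn : ‖t • u‖ ^ 2 + ‖t • v‖ ^ 2 ≤ ‖u‖ ^ 2 + ‖v‖ ^ 2 := by
    rw [norm_smul, norm_smul, mul_pow, mul_pow, Real.norm_eq_abs, sq_abs]
    nlinarith [sq_nonneg ‖u‖, sq_nonneg ‖v‖]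
  have key : ∀ a b : ℝ, 0 ≤ a → 0 ≤ b → a ^ 2 ≤ L ^ 2 * (‖u‖ ^ 2 + ‖v‖ ^ 2) →
      a * b ≤ L / 2 * (‖u‖ ^ 2 + ‖v‖ ^ 2) + L / 2 * b ^ 2 := by
    intro a b _ _ hab
    have h3 : 0 ≤ (a - L * b) ^ 2 := sq_nonneg _
    have h4 : L * (a * b) ≤ L * (L / 2 * (‖u‖ ^ 2 + ‖v‖ ^ 2) + L / 2 * b ^ 2) := by nlinarith
    exact le_of_mul_le_mul_left h4 hL
  have hx := h.lipX (x + t • u) (y + t • v) x y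
  have hy := h.lipY (x + t • u) (y + t • v) x y
  simp only [add_sub_cancel_left] at hx hy
  have hx' := key _ ‖u‖ (norm_nonneg _) (norm_nonneg _)
    (hx.trans (mul_le_mul_of_nonneg_left hn (sq_nonneg L)))
  have hy' := key _ ‖v‖ (norm_nonneg _) (norm_nonneg _)
    (hy.trans (mul_le_mul_of_nonneg_left hn (sq_nonneg L)))
  refine (abs_add_le _ _).trans ?_
  have i1 := abs_real_inner_le_norm (gx (x + t • u) (y + t • v) - gx x y) u
  have i2 := abs_real_inner_le_norm (gy (x + t • u) (y + t • v) - gy x y) v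
  nlinarith [mul_nonneg hL.le (sq_nonneg ‖u‖), mul_nonneg hL.le (sq_nonneg ‖v‖)]

theorem continuous_snd (h : SmoothPL J gx gy P L ν) (x : E) : Continuous (J x) := by
  have h1 : Continuous (fun p : E × F => J p.1 p.2) :=
    continuous_iff_continuousAt.2 fun p => (h.hasFDerivAt p.1 p.2).continuousAt
  exact h1.comp (Continuous.prodMk_right x)

/-- The partial gradient in `y` vanishes at maximisers. -/
theorem gradY_eq_zero (h : SmoothPL J gx gy P L ν) {x : E} {y : F} (hy : J x y = P x) :
    gy x y = 0 := by
  have hL := h.L_pos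
  have h1 := (abs_le.1 (h.abs_sub_le x 0 y ((1 / (4 * L)) • gy x y))).1
  have h2 := h.le_max x (y + (1 / (4 * L)) • gy x y)
  simp only [add_zero, inner_zero_right, zero_add, norm_zero, inner_smul_right,
    real_inner_self_eq_norm_sq, norm_smul, mul_pow] at h1
  rw [Real.norm_eq_abs, sq_abs] at h1
  have e : 2 * L * (0 ^ 2 + (1 / (4 * L)) ^ 2 * ‖gy x y‖ ^ 2)
      = 1 / 2 * (1 / (4 * L) * ‖gy x y‖ ^ 2) := by field_simp; ring
  rw [e] at h1
  have h3 : 1 / (4 * L) * ‖gy x y‖ ^ 2 ≤ 0 := by linarith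
  have h4 : ‖gy x y‖ ^ 2 ≤ 0 := by
    by_contra hc
    have : 0 < 1 / (4 * L) * ‖gy x y‖ ^ 2 := mul_pos (by positivity) (not_le.1 hc)
    linarith
  simpa using le_antisymm h4 (sq_nonneg _)

/-- Error bound: some maximiser lies within a distance controlled by the optimality gap. It is the
limit of gradient ascent, whose path length telescopes in the square root of the gap. -/
theorem exists_max_near [CompleteSpace F] (h : SmoothPL J gx gy P L ν) (x : E) (y : F) :
    ∃ yo, J x yo = P x ∧ ‖yo - y‖ ^ 2 ≤ 8 / ν * (P x - J x y) := by
  have hL := h.L_pos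
  have hν := h.ν_pos
  set η : ℝ := 1 / (4 * L) with hη
  have hηpos : 0 < η := by positivity
  let s : ℕ → F := fun n => (fun z => z + η • gy x z)^[n] y
  have hs : ∀ n, s (n + 1) = s n + η • gy x (s n) := fun n => by
    simp only [s, Function.iterate_succ_apply']
  have hasc : ∀ n, J x (s n) + η / 2 * ‖gy x (s n)‖ ^ 2 ≤ J x (s (n + 1)) := by
    intro n
    have h1 := (abs_le.1 (h.abs_sub_le x 0 (s n) (η • gy x (s n)))).1
    simp only [add_zero, inner_zero_right, zero_add, norm_zero, inner_smul_right,
      real_inner_self_eq_norm_sq, norm_smul, mul_pow] at h1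
    rw [Real.norm_eq_abs, sq_abs, ← hs] at h1
    have e : 2 * L * (0 ^ 2 + η ^ 2 * ‖gy x (s n)‖ ^ 2) = η / 2 * ‖gy x (s n)‖ ^ 2 := by
      rw [hη]; field_simp; ring
    rw [e] at h1
    linarith
  let r : ℕ → ℝ := fun n => √(P x - J x (s n))
  have hgap : ∀ n, 0 ≤ P x - J x (s n) := fun n => sub_nonneg.2 (h.le_max x _)
  have hr2 : ∀ n, r n ^ 2 = P x - J x (s n) := fun n => Real.sq_sqrt (hgap n)
  have hr0 : ∀ n, 0 ≤ r n := fun n => Real.sqrt_nonneg _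
  set c : ℝ := √(8 / ν) with hc
  have hc2 : c ^ 2 = 8 / ν := Real.sq_sqrt (by positivity)
  have hc0 : 0 ≤ c := Real.sqrt_nonneg _
  have hstep : ∀ n, dist (s n) (s (n + 1)) ≤ c * (r n - r (n + 1)) := by
    intro n
    have hd : dist (s n) (s (n + 1)) = η * ‖gy x (s n)‖ := by
      rw [dist_comm, dist_eq_norm, hs, add_sub_cancel_left, norm_smul, Real.norm_eq_abs,
        abs_of_pos hηpos]
    rw [hd]
    have hpl := h.pl x (s n)
    have hA := hasc n
    have e1 := hr2 n
    have e2 := hr2 (n + 1)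
    rw [← e1] at hpl
    have hdec : η / 2 * ‖gy x (s n)‖ ^ 2 ≤ r n ^ 2 - r (n + 1) ^ 2 := by linarith
    have hle : r (n + 1) ≤ r n := by
      have : 0 ≤ η / 2 * ‖gy x (s n)‖ ^ 2 := by positivity
      exact abs_le_of_sq_le_sq' (by linarith) (hr0 n) |>.2
    rcases (norm_nonneg (gy x (s n))).eq_or_lt with h0 | hpos
    · rw [← h0, mul_zero]; exact mul_nonneg hc0 (sub_nonneg.2 hle)
    · have hg : 4 / c * r n ≤ ‖gy x (s n)‖ := by
        have hcpos : 0 < c := Real.sqrt_pos.2 (by positivity)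
        refine abs_le_of_sq_le_sq' ?_ hpos.le |>.2
        have : (4 / c * r n) ^ 2 = 2 * ν * r n ^ 2 := by
          rw [mul_pow, div_pow, hc2]; field_simp; ring
        linarith
      have hcpos : 0 < c := Real.sqrt_pos.2 (by positivity)
      have hrpos : 0 < r n := by
        by_contra hneg
        have : r n = 0 := le_antisymm (not_lt.1 hneg) (hr0 n)
        have h5 : 0 < η / 2 * ‖gy x (s n)‖ ^ 2 := by positivity
        rw [this] at hdec
        nlinarith [sq_nonneg (r (n + 1))]
      have h6 : r n ^ 2 - r (n + 1) ^ 2 ≤ 2 * r n * (r n - r (n + 1)) := by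
        nlinarith [sq_nonneg (r n - r (n + 1))]
      have h7 : η / 2 * (4 / c * r n * ‖gy x (s n)‖) ≤ η / 2 * ‖gy x (s n)‖ ^ 2 := by
        rw [sq]; gcongr
      have h8 : r n * (η * ‖gy x (s n)‖) ≤ r n * (c * (r n - r (n + 1))) := by
        have e3 : η / 2 * (4 / c * r n * ‖gy x (s n)‖) = 2 / c * (r n * (η * ‖gy x (s n)‖)) := by
          field_simp; ring
        have h9 : 2 / c * (r n * (η * ‖gy x (s n)‖)) ≤ 2 * r n * (r n - r (n + 1)) := by linarith
        have h10 := mul_le_mul_of_nonneg_left h9 (show 0 ≤ c / 2 by positivity)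
        have e4 : c / 2 * (2 / c * (r n * (η * ‖gy x (s n)‖))) = r n * (η * ‖gy x (s n)‖) := by
          field_simp
        rw [e4] at h10
        linarith
      exact le_of_mul_le_mul_left h8 hrpos
  have hanti : Antitone r := antitone_nat_of_succ_le fun n => by
    have h1 := hstep n
    have h2 : 0 ≤ dist (s n) (s (n + 1)) := dist_nonneg
    have hcpos : 0 < c := Real.sqrt_pos.2 (by positivity)
    nlinarith
  have hsum : ∀ n m, dist (s n) (s (n + m)) ≤ c * (r n - r (n + m)) := by
    intro n m
    induction m with
    | zero => simp
    | succ m ih =>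
      have h1 := dist_triangle (s n) (s (n + m)) (s (n + m + 1))
      have h2 := hstep (n + m)
      rw [← add_assoc]; linarith
  have hrlim : Tendsto r atTop (𝓝 (⨅ n, r n)) :=
    tendsto_atTop_ciInf hanti ⟨0, by rintro _ ⟨n, rfl⟩; exact hr0 n⟩
  have hcau : CauchySeq s := by
    refine cauchySeq_of_le_tendsto_0 (fun n => 2 * (c * (r n - ⨅ n, r n))) ?_ ?_
    · have hb : ∀ n, ⨅ n, r n ≤ r n := fun n =>
        ciInf_le ⟨0, by rintro _ ⟨n, rfl⟩; exact hr0 n⟩ n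
      have h1 : ∀ N n, N ≤ n → dist (s N) (s n) ≤ c * (r N - ⨅ n, r n) := by
        intro N n hn
        obtain ⟨m, rfl⟩ := Nat.exists_eq_add_of_le hn
        refine (hsum N m).trans ?_
        have := hb (N + m)
        gcongr
      intro n m N hn hm
      have := dist_triangle_left (s n) (s m) (s N)
      have := h1 N n hn
      have := h1 N m hm
      linarith
    · have : Tendsto (fun n => 2 * (c * (r n - ⨅ n, r n))) atTop
          (𝓝 (2 * (c * ((⨅ n, r n) - ⨅ n, r n)))) :=
        ((hrlim.sub_const _).const_mul c).const_mul 2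
      simpa [Function.comp_def] using this
  obtain ⟨yo, hyo⟩ := cauchySeq_tendsto_of_complete hcau
  have hJ : Tendsto (fun n => J x (s n)) atTop (𝓝 (J x yo)) :=
    ((h.continuous_snd x).tendsto yo).comp hyo
  refine ⟨yo, le_antisymm (h.le_max _ _) ?_, ?_⟩
  · -- the ascent gains at least `η ν` times the gap in each step
    have h1 : ∀ n, J x (s n) + η * ν * (P x - J x (s n)) ≤ J x (s (n + 1)) := by
      intro n
      have h2 := mul_le_mul_of_nonneg_left (h.pl x (s n)) (show 0 ≤ η / 2 by positivity)
      have := hasc n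
      nlinarith
    have h3 := le_of_tendsto_of_tendsto' (hJ.add ((hJ.const_sub (P x)).const_mul (η * ν)))
      ((tendsto_add_atTop_iff_nat 1).2 hJ) h1
    have : η * ν * (P x - J x yo) ≤ 0 := by linarith
    by_contra hc
    have : 0 < η * ν * (P x - J x yo) := mul_pos (by positivity) (by linarith)
    linarith
  · have h1 : ∀ n, ‖s n - y‖ ≤ c * r 0 := by
      intro n
      have h2 := hsum 0 n
      rw [dist_comm, dist_eq_norm, zero_add] at h2
      have h3 : s 0 = y := rfl
      rw [h3] at h2
      have := hr0 n
      nlinarith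
    have h2 : ‖yo - y‖ ≤ c * r 0 := le_of_tendsto' (hyo.sub_const y).norm h1
    have h3 : ‖yo - y‖ ^ 2 ≤ (c * r 0) ^ 2 := pow_le_pow_left₀ (norm_nonneg _) h2 2
    rwa [mul_pow, hc2, hr2] at h3

/-- Descent of the primal function along `x⁺ = x - μx mx`. -/
theorem primal_descent [CompleteSpace F] (h : SmoothPL J gx gy P L ν) {μx : ℝ} (hμx : 0 ≤ μx)
    (hs : L * (1 + L / ν / 2) * μx ≤ 1 / 8) (x mx : E) (y : F) :
    P (x - μx • mx) ≤ P x - μx / 4 * ‖mx‖ ^ 2 + μx * ‖mx - gx x y‖ ^ 2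
      + 8 * μx * L * (L / ν) * (P x - J x y) := by
  have hL := h.L_pos
  have hν := h.ν_pos
  obtain ⟨yo, hyo, hdist⟩ := h.exists_max_near x y
  have h1 := h.pl (x - μx • mx) yo
  have h2 := h.lipY (x - μx • mx) yo x yo
  rw [h.gradY_eq_zero hyo] at h2
  have e1 : x - μx • mx - x = -(μx • mx) := by abel
  have e2 : x - μx • mx = x + -(μx • mx) := by abel
  have e3 : ‖μx • mx‖ ^ 2 = μx ^ 2 * ‖mx‖ ^ 2 := by
    rw [norm_smul, mul_pow, Real.norm_eq_abs, sq_abs]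
  simp only [sub_zero, e1, norm_neg, sub_self, norm_zero, e3] at h2
  have h3 := (abs_le.1 (h.abs_sub_le x (-(μx • mx)) yo 0)).2
  simp only [add_zero, inner_zero_right, norm_zero, norm_neg, inner_neg_right, inner_smul_right,
    ← e2, e3, hyo] at h3
  have h4 := h.lipX x yo x y
  simp only [sub_self, norm_zero] at h4
  set g := gx x yo
  have h5 : ‖mx - g‖ ^ 2 ≤ 2 * ‖mx - gx x y‖ ^ 2 + 2 * ‖g - gx x y‖ ^ 2 := by
    have e : mx - g = (mx - gx x y) - (g - gx x y) := by abel
    have := norm_sub_le (mx - gx x y) (g - gx x y)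
    rw [e]
    nlinarith [norm_nonneg ((mx - gx x y) - (g - gx x y)),
      sq_nonneg (‖mx - gx x y‖ - ‖g - gx x y‖)]
  have h6 : inner ℝ g mx = 1 / 2 * ‖g‖ ^ 2 + 1 / 2 * ‖mx‖ ^ 2 - 1 / 2 * ‖mx - g‖ ^ 2 := by
    rw [norm_sub_sq_real, real_inner_comm]; ring
  rw [h6] at h3
  have h7 : P (x - μx • mx) - J (x - μx • mx) yo ≤ L * (L / ν) / 2 * (μx ^ 2 * ‖mx‖ ^ 2) := by
    have h8 : P (x - μx • mx) - J (x - μx • mx) yo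
        = 1 / (2 * ν) * (2 * ν * (P (x - μx • mx) - J (x - μx • mx) yo)) := by field_simp
    rw [h8]
    calc _ ≤ 1 / (2 * ν) * (L ^ 2 * (μx ^ 2 * ‖mx‖ ^ 2 + 0 ^ 2)) :=
          mul_le_mul_of_nonneg_left (h1.trans h2) (by positivity)
      _ = _ := by field_simp; ring
  have h9 : (L * (1 + L / ν / 2) * μx) * (μx * ‖mx‖ ^ 2) ≤ 1 / 8 * (μx * ‖mx‖ ^ 2) :=
    mul_le_mul_of_nonneg_right hs (by positivity)
  have h10 : ‖g - gx x y‖ ^ 2 ≤ 8 * L * (L / ν) * (P x - J x y) := by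
    refine h4.trans ?_
    calc L ^ 2 * (0 ^ 2 + ‖yo - y‖ ^ 2) ≤ L ^ 2 * (0 ^ 2 + 8 / ν * (P x - J x y)) := by gcongr
      _ = _ := by field_simp; ring
  have h11 : μx * ‖mx - g‖ ^ 2
      ≤ μx * (2 * ‖mx - gx x y‖ ^ 2 + 2 * (8 * L * (L / ν) * (P x - J x y))) :=
    mul_le_mul_of_nonneg_left (by linarith) hμx
  have h12 : 0 ≤ μx * ‖g‖ ^ 2 := by positivity
  have h13 : 0 ≤ L * (L / ν) * (μx ^ 2 * ‖mx‖ ^ 2) := by positivity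
  nlinarith

/-- Ascent of `J` along `x⁺ = x - μx mx`, `y⁺ = y + μy my`. -/
theorem cost_ascent (h : SmoothPL J gx gy P L ν) {μx μy : ℝ} (hμx : 0 ≤ μx) (hμy : 0 ≤ μy)
    (hsx : L * μx ≤ 1 / 8) (hsy : L * μy ≤ 1 / 8) (x mx : E) (y my : F) :
    J x y + μy / 2 * ‖gy x y‖ ^ 2 + μy / 4 * ‖my‖ ^ 2 - μy / 2 * ‖my - gy x y‖ ^ 2
      - μx / 2 * ‖mx - gx x y‖ ^ 2 - 2 * μx * ‖mx‖ ^ 2 ≤ J (x - μx • mx) (y + μy • my) := by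
  have hL := h.L_pos
  have h3 := (abs_le.1 (h.abs_sub_le x (-(μx • mx)) y (μy • my))).1
  have e2 : x - μx • mx = x + -(μx • mx) := by abel
  simp only [norm_neg, inner_neg_right, inner_smul_right, ← e2, norm_smul, mul_pow,
    Real.norm_eq_abs, sq_abs] at h3
  have h5 : inner ℝ (gx x y) mx ≤ 3 / 2 * ‖mx‖ ^ 2 + 1 / 2 * ‖mx - gx x y‖ ^ 2 := by
    have : ‖mx - gx x y‖ ^ 2 = ‖mx‖ ^ 2 - 2 * inner ℝ (gx x y) mx + ‖gx x y‖ ^ 2 := by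
      rw [norm_sub_sq_real, real_inner_comm]
    have h0 : 0 ≤ ‖mx - gx x y + mx‖ ^ 2 := by positivity
    rw [norm_add_sq_real, inner_sub_left, real_inner_self_eq_norm_sq] at h0
    linarith
  have h6 : inner ℝ (gy x y) my
      = 1 / 2 * ‖gy x y‖ ^ 2 + 1 / 2 * ‖my‖ ^ 2 - 1 / 2 * ‖my - gy x y‖ ^ 2 := by
    rw [norm_sub_sq_real, real_inner_comm]; ring
  rw [h6] at h3
  have h7 := mul_le_mul_of_nonneg_left h5 hμx
  have h8 : L * μx * (μx * ‖mx‖ ^ 2) ≤ 1 / 8 * (μx * ‖mx‖ ^ 2) :=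
    mul_le_mul_of_nonneg_right hsx (by positivity)
  have h9 : L * μy * (μy * ‖my‖ ^ 2) ≤ 1 / 8 * (μy * ‖my‖ ^ 2) :=
    mul_le_mul_of_nonneg_right hsy (by positivity)
  have h10 : 0 ≤ μx * ‖mx‖ ^ 2 := by positivity
  nlinarith

/-- One step decreases the potential `P(x) + (P(x) - J(x, y)) / 16` up to the errors of the
gradient estimates `mx`, `my`. -/
theorem potential_descent [CompleteSpace F] (h : SmoothPL J gx gy P L ν) {μx μy : ℝ}
    (hμx : 0 ≤ μx) (hsx : L * (1 + L / ν / 2) * μx ≤ 1 / 1024)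
    (hsy : L * μy ≤ 1 / 1024) (hr : (L / ν) ^ 2 * μx ≤ 1 / 1024 * μy)
    (x mx : E) (y my : F) :
    P (x - μx • mx) + 1 / 16 * (P (x - μx • mx) - J (x - μx • mx) (y + μy • my))
      + (μx / 8 * ‖mx‖ ^ 2 + μy / 64 * (‖gy x y‖ ^ 2 + ‖my‖ ^ 2))
    ≤ P x + 1 / 16 * (P x - J x y)
      + (2 * μx * ‖mx - gx x y‖ ^ 2 + μy * ‖my - gy x y‖ ^ 2) := by
  have hL := h.L_pos
  have hν := h.ν_pos
  have hκ : 1 ≤ L / ν := (one_le_div hν).2 h.ν_le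
  have hμy : 0 ≤ μy := by
    have : 0 ≤ (L / ν) ^ 2 * μx := by positivity
    linarith
  have hsx' : L * μx ≤ 1 / 8 := by
    have : 0 ≤ L * (L / ν / 2) * μx := by positivity
    nlinarith
  have h1 := h.primal_descent hμx (by linarith) x mx y
  have h2 := h.cost_ascent hμx hμy hsx' (by linarith) x mx y my
  have h3 := h.pl x y
  have h4 := h.le_max x y
  -- the gap terms are absorbed through the PL inequality
  have h5 : 8 * μx * L * (L / ν) * (P x - J x y) ≤ 1 / 128 * (μy * ν) * (P x - J x y) := by
    have e : 8 * μx * L * (L / ν) = 8 * ν * ((L / ν) ^ 2 * μx) := by field_simp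
    rw [e]
    refine mul_le_mul_of_nonneg_right ?_ (by linarith)
    nlinarith [mul_le_mul_of_nonneg_left hr hν.le]
  have h6 : μy * (2 * ν * (P x - J x y)) ≤ μy * ‖gy x y‖ ^ 2 := mul_le_mul_of_nonneg_left h3 hμy
  have h7 : 0 ≤ μx * ‖mx - gx x y‖ ^ 2 := by positivity
  have h8 : 0 ≤ μy * ‖my - gy x y‖ ^ 2 := by positivity
  have h9 : 0 ≤ μx * ‖mx‖ ^ 2 := by positivity
  have h10 : 0 ≤ μy * ‖my‖ ^ 2 := by positivity
  have h11 : 0 ≤ μy * ‖gy x y‖ ^ 2 := by positivity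
  have h12 : 1 / 128 * (μy * ν) * (P x - J x y) ≤ 1 / 256 * (μy * ‖gy x y‖ ^ 2) := by
    linarith
  linarith

/-- Telescoped potential descent along a trajectory of inexact descent-ascent steps. -/
theorem sum_descent [CompleteSpace F] (h : SmoothPL J gx gy P L ν) {μx μy Pinf : ℝ}
    (hμx : 0 ≤ μx) (hsx : L * (1 + L / ν / 2) * μx ≤ 1 / 1024)
    (hsy : L * μy ≤ 1 / 1024) (hr : (L / ν) ^ 2 * μx ≤ 1 / 1024 * μy)
    (hP : ∀ x, Pinf ≤ P x) (x mx : ℕ → E) (y my : ℕ → F)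
    (hx : ∀ i, x (i + 1) = x i - μx • mx i) (hy : ∀ i, y (i + 1) = y i + μy • my i) (T : ℕ) :
    ∑ i ∈ Finset.range T, (μx / 8 * ‖mx i‖ ^ 2
        + μy / 64 * (‖gy (x i) (y i)‖ ^ 2 + ‖my i‖ ^ 2))
      ≤ (P (x 0) - Pinf) + (P (x 0) - J (x 0) (y 0))
        + ∑ i ∈ Finset.range T, (2 * μx * ‖mx i - gx (x i) (y i)‖ ^ 2
          + μy * ‖my i - gy (x i) (y i)‖ ^ 2) := by
  have key : ∀ T, P (x T) + 1 / 16 * (P (x T) - J (x T) (y T))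
      + ∑ i ∈ Finset.range T, (μx / 8 * ‖mx i‖ ^ 2
        + μy / 64 * (‖gy (x i) (y i)‖ ^ 2 + ‖my i‖ ^ 2))
      ≤ P (x 0) + 1 / 16 * (P (x 0) - J (x 0) (y 0))
        + ∑ i ∈ Finset.range T, (2 * μx * ‖mx i - gx (x i) (y i)‖ ^ 2
          + μy * ‖my i - gy (x i) (y i)‖ ^ 2) := by
    intro T
    induction T with
    | zero => simp
    | succ T ih =>
      rw [Finset.sum_range_succ, Finset.sum_range_succ]
      have := h.potential_descent hμx hsx hsy hr (x T) (mx T) (y T) (my T)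
      rw [← hx, ← hy] at this
      linarith
  have h1 := key T
  have h2 := h.le_max (x T) (y T)
  have h3 := h.le_max (x 0) (y 0)
  have h4 := hP (x T)
  linarith

end SmoothPL

/-! ### A damped second-order recursion -/

/-- The vector recursion followed by an eigencomponent of exact diffusion. The energy
`(1 - ℓ)‖xₙ₊₁‖² + ℓ‖xₙ₊₁ - xₙ‖²` contracts by the factor `√ℓ`, the modulus of the roots of
`z² - 2ℓz + ℓ`. -/
theorem sum_norm_sq_le_of_second_order {E : Type*} [NormedAddCommGroup E] [InnerProductSpace ℝ E]
    {ℓ lam μ : ℝ} (h0 : 0 ≤ ℓ) (hle : ℓ ≤ lam) (h1 : lam < 1) (x m : ℕ → E) (hx0 : x 0 = 0)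
    (hx1 : x 1 = -((ℓ * μ) • m 0))
    (hx : ∀ i, x (i + 2) = (2 * ℓ) • x (i + 1) - ℓ • x i - (ℓ * μ) • (m (i + 1) - m i)) (n : ℕ) :
    ∑ i ∈ Finset.range (n + 1), ‖x i‖ ^ 2 ≤ 2 * μ ^ 2 / (1 - lam) ^ 2 * ‖ℓ • m 0‖ ^ 2
      + lam ^ 2 * μ ^ 2 / ((1 - √lam) ^ 2 * (1 - lam))
        * ∑ j ∈ Finset.range n, ‖m (j + 1) - m j‖ ^ 2 := by
  set s := √ℓ with hs
  have hs2 : s ^ 2 = ℓ := Real.sq_sqrt h0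
  have hs0 : 0 ≤ s := Real.sqrt_nonneg _
  have hl0 : 0 ≤ lam := h0.trans hle
  set r := √lam with hr
  have hr2 : r ^ 2 = lam := Real.sq_sqrt hl0
  have hr0 : 0 ≤ r := Real.sqrt_nonneg _
  have hsr : s ≤ r := Real.sqrt_le_sqrt hle
  have hr1 : r < 1 := by nlinarith
  have hs1 : s < 1 := hsr.trans_lt hr1
  let Q : ℕ → ℝ := fun n => (1 - ℓ) * ‖x (n + 1)‖ ^ 2 + ℓ * ‖x (n + 1) - x n‖ ^ 2
  have hQ0 : ∀ n, 0 ≤ Q n := fun n => by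
    have : 0 ≤ 1 - ℓ := by linarith
    positivity
  have hQ : ∀ n, Q (n + 1) ≤ s * Q n + 1 / (1 - s) * ‖(ℓ * μ) • (m (n + 1) - m n)‖ ^ 2 := by
    intro n
    set f := (ℓ * μ) • (m (n + 1) - m n)
    set d := x (n + 1) - x n with hd
    have e1 : x (n + 2) - ℓ • x (n + 1) = ℓ • d - f := by
      rw [hx]; simp only [hd, f]; module
    have e2 : x (n + 1 + 1) = x (n + 2) := rfl
    have e3 : Q (n + 1) = ‖ℓ • d - f‖ ^ 2 + ℓ * (1 - ℓ) * ‖x (n + 1)‖ ^ 2 := by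
      simp only [Q]
      rw [← e1, e2, norm_sub_sq_real, norm_sub_sq_real, inner_smul_right, norm_smul, mul_pow,
        Real.norm_eq_abs, sq_abs]
      ring
    have e4 : ‖ℓ • d - f‖ ^ 2 ≤ s ^ 3 * ‖d‖ ^ 2 + 1 / (1 - s) * ‖f‖ ^ 2 := by
      have e5 : ‖ℓ • d - f‖ ^ 2
          = s ^ 4 * ‖d‖ ^ 2 - 2 * (s ^ 2 * inner ℝ d f) + ‖f‖ ^ 2 := by
        rw [norm_sub_sq_real, inner_smul_left, norm_smul, mul_pow, Real.norm_eq_abs, sq_abs,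
          ← hs2]
        simp only [conj_trivial]; ring
      have e6 : 0 ≤ ‖((1 - s) * s) • d + f‖ ^ 2 := by positivity
      rw [norm_add_sq_real, inner_smul_left, norm_smul, mul_pow, Real.norm_eq_abs, sq_abs] at e6
      simp only [conj_trivial] at e6
      have e7 : 0 ≤ s / (1 - s) * (((1 - s) * s) ^ 2 * ‖d‖ ^ 2
          + 2 * ((1 - s) * s * inner ℝ d f) + ‖f‖ ^ 2) :=
        mul_nonneg (div_nonneg hs0 (by linarith)) e6
      have e8 : s / (1 - s) * (((1 - s) * s) ^ 2 * ‖d‖ ^ 2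
          + 2 * ((1 - s) * s * inner ℝ d f) + ‖f‖ ^ 2)
          = (1 - s) * s ^ 3 * ‖d‖ ^ 2 + 2 * (s ^ 2 * inner ℝ d f) + s / (1 - s) * ‖f‖ ^ 2 := by
        have : 1 - s ≠ 0 := by linarith
        field_simp
      have e9 : 1 / (1 - s) * ‖f‖ ^ 2 = ‖f‖ ^ 2 + s / (1 - s) * ‖f‖ ^ 2 := by
        have : 1 - s ≠ 0 := by linarith
        field_simp; ring
      rw [e5, e9]
      rw [e8] at e7
      linarith
    rw [e3]
    have e10 : ℓ * (1 - ℓ) * ‖x (n + 1)‖ ^ 2 ≤ s * ((1 - ℓ) * ‖x (n + 1)‖ ^ 2) := by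
      rw [mul_assoc]
      refine mul_le_mul_of_nonneg_right (by nlinarith) ?_
      exact mul_nonneg (by linarith) (sq_nonneg _)
    have e11 : s * Q n = s * ((1 - ℓ) * ‖x (n + 1)‖ ^ 2) + s ^ 3 * ‖d‖ ^ 2 := by
      simp only [Q]; rw [← hd]; rw [← hs2]; ring
    linarith
  have hsum : (1 - s) * ∑ i ∈ Finset.range n, Q i + Q n
      ≤ ‖x 1‖ ^ 2 + 1 / (1 - s) * ∑ j ∈ Finset.range n, ‖(ℓ * μ) • (m (j + 1) - m j)‖ ^ 2 := by
    induction n with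
    | zero => simp [Q, hx0]; linarith
    | succ n ih =>
      rw [Finset.sum_range_succ, Finset.sum_range_succ, mul_add, mul_add]
      have := hQ n
      linarith
  have hfirst : ∑ i ∈ Finset.range (n + 1), ‖x i‖ ^ 2
      ≤ 1 / (1 - ℓ) * ∑ i ∈ Finset.range n, Q i := by
    rw [Finset.sum_range_succ', hx0, norm_zero, Finset.mul_sum]
    simp only [ne_eq, OfNat.ofNat_ne_zero, not_false_eq_true, zero_pow, add_zero]
    refine Finset.sum_le_sum fun i _ => ?_
    have : 0 < 1 - ℓ := by linarith
    rw [one_div, ← div_eq_inv_mul, le_div_iff₀ this]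
    have : 0 ≤ ℓ * ‖x (i + 1) - x i‖ ^ 2 := by positivity
    simp only [Q]; linarith
  have e1 : ‖x 1‖ ^ 2 = μ ^ 2 * ‖ℓ • m 0‖ ^ 2 := by
    rw [hx1, norm_neg, norm_smul, norm_smul, norm_mul]
    simp only [mul_pow, Real.norm_eq_abs, sq_abs]; ring
  have e2 : ∑ j ∈ Finset.range n, ‖(ℓ * μ) • (m (j + 1) - m j)‖ ^ 2
      = ℓ ^ 2 * μ ^ 2 * ∑ j ∈ Finset.range n, ‖m (j + 1) - m j‖ ^ 2 := by
    rw [Finset.mul_sum]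
    refine Finset.sum_congr rfl fun j _ => ?_
    rw [norm_smul, mul_pow, Real.norm_eq_abs, sq_abs, mul_pow]
  rw [e1, e2] at hsum
  set A := ‖ℓ • m 0‖ ^ 2
  set S := ∑ j ∈ Finset.range n, ‖m (j + 1) - m j‖ ^ 2
  have hA : 0 ≤ A := sq_nonneg _
  have hS : 0 ≤ S := Finset.sum_nonneg fun _ _ => sq_nonneg _
  have p1 : 0 < 1 - s := by linarith
  have p2 : 0 < 1 - ℓ := by linarith
  have p3 : 0 < 1 - r := by linarith
  have p4 : 0 < 1 - lam := by linarith
  have h2 : ∑ i ∈ Finset.range n, Q i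
      ≤ 1 / (1 - s) * (μ ^ 2 * A + 1 / (1 - s) * (ℓ ^ 2 * μ ^ 2 * S)) := by
    rw [one_div_mul_eq_div, le_div_iff₀ p1]
    have := hQ0 n
    linarith
  have h3 : 1 / ((1 - ℓ) * (1 - s)) ≤ 2 / (1 - lam) ^ 2 := by
    rw [div_le_div_iff₀ (by positivity) (by positivity)]
    have h4 : 1 - lam ≤ 2 * (1 - s) := by nlinarith
    have h5 : (1 - lam) * (1 - lam) ≤ (1 - ℓ) * (2 * (1 - s)) := by gcongr
    nlinarith
  calc ∑ i ∈ Finset.range (n + 1), ‖x i‖ ^ 2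
      ≤ 1 / (1 - ℓ) * (1 / (1 - s) * (μ ^ 2 * A + 1 / (1 - s) * (ℓ ^ 2 * μ ^ 2 * S))) :=
        hfirst.trans (mul_le_mul_of_nonneg_left h2 (by positivity))
    _ = 1 / ((1 - ℓ) * (1 - s)) * (μ ^ 2 * A)
        + ℓ ^ 2 * μ ^ 2 / ((1 - s) ^ 2 * (1 - ℓ)) * S := by
        field_simp
    _ ≤ 2 / (1 - lam) ^ 2 * (μ ^ 2 * A)
        + lam ^ 2 * μ ^ 2 / ((1 - r) ^ 2 * (1 - lam)) * S := by
        refine add_le_add (mul_le_mul_of_nonneg_right h3 (by positivity)) ?_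
        gcongr
    _ = _ := by ring

/-! ### Block vectors and the combination matrix -/

section Block

variable {K d : ℕ}

theorem blockMul_add (A : Matrix (Fin K) (Fin K) ℝ) (X Y : Block K d) :
    blockMul A (X + Y) = blockMul A X + blockMul A Y := by
  funext k; simp [blockMul, Finset.sum_add_distrib]

theorem blockMul_sub (A : Matrix (Fin K) (Fin K) ℝ) (X Y : Block K d) :
    blockMul A (X - Y) = blockMul A X - blockMul A Y := by
  funext k; simp [blockMul, smul_sub]

theorem blockMul_smul (A : Matrix (Fin K) (Fin K) ℝ) (c : ℝ) (X : Block K d) :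
    blockMul A (c • X) = c • blockMul A X := by
  funext k; simp [blockMul, Finset.smul_sum, smul_smul, mul_comm]

theorem blockMul_one (X : Block K d) : blockMul 1 X = X := by
  funext k; simp [blockMul, Matrix.one_apply]

theorem sub_blockMul (A B : Matrix (Fin K) (Fin K) ℝ) (X : Block K d) :
    blockMul (A - B) X = blockMul A X - blockMul B X := by
  funext k; simp [blockMul, sub_smul]

theorem blockMul_mul (A B : Matrix (Fin K) (Fin K) ℝ) (X : Block K d) :
    blockMul (A * B) X = blockMul A (blockMul B X) := by
  funext k
  simp only [blockMul, Matrix.mul_apply, Finset.sum_smul, Finset.smul_sum, smul_smul]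
  exact Finset.sum_comm

theorem blockMul_const {A : Matrix (Fin K) (Fin K) ℝ} (c : ℝ) (h : ∀ k, ∑ l, A k l = c)
    (v : Vec d) : blockMul A (fun _ => v) = fun _ => c • v := by
  funext k; simp [blockMul, ← Finset.sum_smul, h]

/-- The component `(uᵀ ⊗ I) X` of a block vector. -/
noncomputable def proj (u : Fin K → ℝ) (X : Block K d) : Vec d := ∑ k, u k • X k

theorem proj_sub (u : Fin K → ℝ) (X Y : Block K d) : proj u (X - Y) = proj u X - proj u Y := by
  simp [proj, smul_sub]

theorem proj_smul (u : Fin K → ℝ) (c : ℝ) (X : Block K d) : proj u (c • X) = c • proj u X := by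
  simp [proj, Finset.smul_sum, smul_smul, mul_comm]

theorem proj_const (u : Fin K → ℝ) (v : Vec d) : proj u (fun _ => v) = (∑ k, u k) • v := by
  simp [proj, Finset.sum_smul]

theorem proj_blockMul {A : Matrix (Fin K) (Fin K) ℝ} (hA : A.IsSymm) {u : Fin K → ℝ} {ℓ : ℝ}
    (hu : A *ᵥ u = ℓ • u) (X : Block K d) : proj u (blockMul A X) = ℓ • proj u X := by
  have h : ∀ l, ∑ k, u k * A k l = ℓ * u l := fun l => by
    have := congrFun hu l
    simp only [Matrix.mulVec, dotProduct, Pi.smul_apply, smul_eq_mul] at this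
    rw [← this]
    exact Finset.sum_congr rfl fun k _ => by rw [← hA.apply k l, mul_comm]
  simp only [proj, blockMul, Finset.smul_sum, smul_smul]
  rw [Finset.sum_comm]
  refine Finset.sum_congr rfl fun l _ => ?_
  rw [← Finset.sum_smul, h]

theorem centroid_eq_proj (X : Block K d) : centroid X = proj (fun _ => 1 / (K : ℝ)) X := by
  simp [centroid, proj, Finset.smul_sum]

/-- The deviation of a block vector from its network average. -/
noncomputable def deviation (X : Block K d) : Block K d := X - fun _ => centroid X

theorem blockNormSq_nonneg (X : Block K d) : 0 ≤ blockNormSq X :=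
  Finset.sum_nonneg fun _ _ => sq_nonneg _

/-- Parseval's identity for the components in an orthonormal basis. -/
theorem sum_norm_sq_proj (e : OrthonormalBasis (Fin K) ℝ (EuclideanSpace ℝ (Fin K)))
    (X : Block K d) : ∑ j, ‖proj (e j).ofLp X‖ ^ 2 = blockNormSq X := by
  simp only [blockNormSq, EuclideanSpace.norm_sq_eq, Real.norm_eq_abs, sq_abs]
  rw [Finset.sum_comm, Finset.sum_comm (γ := Fin K)]
  refine Finset.sum_congr rfl fun c _ => ?_
  have h := e.sum_sq_norm_inner_right (WithLp.toLp 2 (fun k => X k c))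
  simp only [EuclideanSpace.norm_sq_eq, Real.norm_eq_abs, sq_abs] at h
  rw [← h]
  refine Finset.sum_congr rfl fun j _ => ?_
  congr 1
  simp [proj, PiLp.inner_apply, mul_comm]

theorem blockNormSq_eq_centroid_add_deviation (X : Block K d) :
    blockNormSq X = K * ‖centroid X‖ ^ 2 + blockNormSq (deviation X) := by
  rcases Nat.eq_zero_or_pos K with rfl | hK
  · simp [blockNormSq]
  have hK' : (K : ℝ) ≠ 0 := by positivity
  have h1 : ∑ k, X k = (K : ℝ) • centroid X := by
    simp [centroid, smul_smul, hK']
  simp only [blockNormSq, deviation, Pi.sub_apply, norm_sub_sq_real, Finset.sum_add_distrib,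
    Finset.sum_sub_distrib]
  rw [← Finset.mul_sum, ← sum_inner, h1, inner_smul_left, real_inner_self_eq_norm_sq]
  simp; ring

theorem norm_sq_centroid_le (X : Block K d) : (K : ℝ) * ‖centroid X‖ ^ 2 ≤ blockNormSq X := by
  have := blockNormSq_nonneg (deviation X)
  have := blockNormSq_eq_centroid_add_deviation X
  linarith

end Block

section Network

variable {K : ℕ} {W : Matrix (Fin K) (Fin K) ℝ}

theorem IsCombination.row_sum (hW : IsCombination W) (k : Fin K) : ∑ l, W k l = 1 :=
  (mem_doublyStochastic_iff_sum.1 hW.stochastic).2.1 k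

theorem IsCombination.col_sum (hW : IsCombination W) (l : Fin K) : ∑ k, W k l = 1 :=
  (mem_doublyStochastic_iff_sum.1 hW.stochastic).2.2 l

theorem eigenvalue_nonneg (hP : W.PosSemidef) {v : Fin K → ℝ} (hv : v ≠ 0) {w : ℝ}
    (h : W *ᵥ v = w • v) : 0 ≤ w := by
  have h1 := hP.dotProduct_mulVec_nonneg v
  rw [h, dotProduct_smul, smul_eq_mul] at h1
  have h2 : 0 < star v ⬝ᵥ v := by
    simpa using Matrix.dotProduct_star_self_pos_iff.2 hv
  exact nonneg_of_mul_nonneg_left h1 h2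

/-- Eigenvectors orthogonal to the constants have an eigenvalue less than one: at a maximal entry of
`v`, a positive power of `W` averages strictly. -/
theorem IsCombination.eigenvalue_lt_one (hW : IsCombination W) {v : Fin K → ℝ} (hv : v ≠ 0)
    (hsum : ∑ k, v k = 0) {w : ℝ} (h : W *ᵥ v = w • v) : w < 1 := by
  by_contra hw
  rw [not_lt] at hw
  obtain ⟨m, -, hm⟩ := hW.primitive.exists_pos_pow
  have hWm : W ^ m ∈ doublyStochastic ℝ (Fin K) := pow_mem hW.stochastic m
  have hrow := (mem_doublyStochastic_iff_sum.1 hWm).2.1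
  have hpow : (W ^ m) *ᵥ v = w ^ m • v := by
    clear hm hWm hrow
    induction m with
    | zero => simp
    | succ m ih => rw [pow_succ, ← Matrix.mulVec_mulVec, h, Matrix.mulVec_smul, ih, smul_smul,
        pow_succ, mul_comm]
  obtain ⟨k0, hk0⟩ : ∃ k, v k ≠ 0 := Function.ne_iff.1 hv
  obtain ⟨k, -, hk⟩ := Finset.exists_max_image Finset.univ v ⟨k0, Finset.mem_univ _⟩
  have hk' : ∀ l, v l ≤ v k := fun l => hk l (Finset.mem_univ _)
  have hpos : 0 ≤ v k := by
    by_contra hneg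
    have : ∑ l, v l < ∑ _l : Fin K, (0 : ℝ) :=
      Finset.sum_lt_sum_of_nonempty ⟨k, Finset.mem_univ _⟩
        fun l _ => (hk' l).trans_lt (not_le.1 hneg)
    simp [hsum] at this
  have h1 : ∑ l, (W ^ m) k l * v l = w ^ m * v k := by
    have := congrFun hpow k
    simpa [Matrix.mulVec, dotProduct] using this
  have h2 : v k ≤ w ^ m * v k := le_mul_of_one_le_left hpos (one_le_pow₀ hw)
  have h3 : ∑ l, (W ^ m) k l * (v k - v l) ≤ 0 := by
    simp only [mul_sub, Finset.sum_sub_distrib]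
    rw [← Finset.sum_mul, hrow, h1]; linarith
  have h4 : ∀ l, v l = v k := by
    have h5 : ∑ l, (W ^ m) k l * (v k - v l) = 0 :=
      le_antisymm h3 (Finset.sum_nonneg fun l _ =>
        mul_nonneg (hm k l).le (sub_nonneg.2 (hk' l)))
    intro l
    have := (Finset.sum_eq_zero_iff_of_nonneg fun l _ =>
        mul_nonneg (hm k l).le (sub_nonneg.2 (hk' l))).1 h5 l (Finset.mem_univ _)
    rcases mul_eq_zero.1 this with h6 | h6
    · exact absurd h6 (hm k l).ne'
    · linarith
  have h7 : (K : ℝ) * v k = 0 := by simpa [h4] using hsum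
  rcases mul_eq_zero.1 h7 with h8 | h8
  · have : 0 < K := k.pos
    simp at h8; omega
  · exact hk0 ((h4 k0).trans h8)

theorem finite_mixing_set (W : Matrix (Fin K) (Fin K) ℝ) :
    {w : ℝ | ∃ v : Fin K → ℝ, v ≠ 0 ∧ ∑ k, v k = 0 ∧ W *ᵥ v = w • v}.Finite := by
  refine (Module.End.finite_hasEigenvalue (Matrix.toLin' W)).subset ?_
  rintro w ⟨v, hv, -, h⟩
  exact Module.End.hasEigenvalue_of_hasEigenvector
    ⟨Module.End.mem_eigenspace_iff.2 (by simpa using h), hv⟩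

theorem le_mixing {v : Fin K → ℝ} (hv : v ≠ 0) (hsum : ∑ k, v k = 0) {w : ℝ}
    (h : W *ᵥ v = w • v) : w ≤ mixing W :=
  le_csSup (finite_mixing_set W).bddAbove ⟨v, hv, hsum, h⟩

theorem mixing_nonneg (hP : W.PosSemidef) : 0 ≤ mixing W :=
  Real.sSup_nonneg fun _ ⟨_, hv, _, h⟩ => eigenvalue_nonneg hP hv h

theorem IsCombination.mixing_lt_one (hW : IsCombination W) : mixing W < 1 := by
  rcases Set.eq_empty_or_nonempty
    {w : ℝ | ∃ v : Fin K → ℝ, v ≠ 0 ∧ ∑ k, v k = 0 ∧ W *ᵥ v = w • v} with h | h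
  · simp [mixing, h]
  · obtain ⟨v, hv, hs, h1⟩ := h.csSup_mem (finite_mixing_set W)
    exact hW.eigenvalue_lt_one hv hs h1

/-- Eigenvectors of `W` are orthogonal to the constants or constant. -/
theorem IsCombination.eigenvector_cases (hW : IsCombination W) {u : Fin K → ℝ} {ℓ : ℝ}
    (h : W *ᵥ u = ℓ • u) : ∑ k, u k = 0 ∨ ∃ c, u = fun _ => c := by
  by_cases hs : ∑ k, u k = 0
  · exact Or.inl hs
  right
  have hK : (K : ℝ) ≠ 0 := by
    rintro hK
    have : K = 0 := by exact_mod_cast hK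
    subst this
    simp at hs
  have h1 : ∑ k, (W *ᵥ u) k = ∑ k, u k := by
    simp only [Matrix.mulVec, dotProduct]
    rw [Finset.sum_comm]
    refine Finset.sum_congr rfl fun l _ => ?_
    rw [← Finset.sum_mul, hW.col_sum, one_mul]
  have hℓ : ℓ = 1 := by
    rw [h] at h1
    simp only [Pi.smul_apply, smul_eq_mul, ← Finset.mul_sum] at h1
    exact (mul_eq_right₀ hs).1 h1
  refine ⟨(∑ k, u k) / K, ?_⟩
  by_contra hne
  have hv : u - (fun _ => (∑ k, u k) / K) ≠ 0 := sub_ne_zero.2 hne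
  have := hW.eigenvalue_lt_one (w := 1) hv
    (by simp [Finset.sum_sub_distrib, mul_div_cancel₀ _ hK])
    (by
      rw [Matrix.mulVec_sub, h, hℓ, one_smul, one_smul]
      congr 1
      funext k
      simp only [Matrix.mulVec, dotProduct]
      rw [← Finset.sum_mul, hW.row_sum, one_mul])
  exact lt_irrefl _ this

theorem IsCombination.posSemidef_one_sub (hW : IsCombination W) : (1 - W).PosSemidef := by
  refine Matrix.PosSemidef.of_dotProduct_mulVec_nonneg ?_ ?_
  · rw [Matrix.IsHermitian, Matrix.conjTranspose_eq_transpose_of_trivial, Matrix.transpose_sub,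
      Matrix.transpose_one, hW.symm.eq]
  · intro x
    have h0 : 0 ≤ ∑ k, ∑ l, W k l * (x k - x l) ^ 2 :=
      Finset.sum_nonneg fun k _ => Finset.sum_nonneg fun l _ =>
        mul_nonneg (hW.primitive.nonneg k l) (sq_nonneg _)
    have e1 : ∑ k, ∑ l, W k l * (x k - x l) ^ 2
        = ∑ k, ∑ l, W k l * x k ^ 2 + ∑ k, ∑ l, W k l * x l ^ 2
          - 2 * ∑ k, ∑ l, x k * (W k l * x l) := by
      simp only [Finset.mul_sum, ← Finset.sum_add_distrib, ← Finset.sum_sub_distrib]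
      exact Finset.sum_congr rfl fun k _ => Finset.sum_congr rfl fun l _ => by ring
    have e2 : ∑ k, ∑ l, W k l * x k ^ 2 = ∑ k, x k ^ 2 :=
      Finset.sum_congr rfl fun k _ => by rw [← Finset.sum_mul, hW.row_sum, one_mul]
    have e3 : ∑ k, ∑ l, W k l * x l ^ 2 = ∑ k, x k ^ 2 := by
      rw [Finset.sum_comm]
      exact Finset.sum_congr rfl fun k _ => by rw [← Finset.sum_mul, hW.col_sum, one_mul]
    have e4 : star x ⬝ᵥ (1 - W) *ᵥ x = ∑ k, x k ^ 2 - ∑ k, ∑ l, x k * (W k l * x l) := by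
      rw [Matrix.sub_mulVec, Matrix.one_mulVec, dotProduct_sub]
      simp [dotProduct, Matrix.mulVec, Finset.mul_sum, sq]
    rw [e4]
    linarith

open scoped MatrixOrder in
theorem Design.ED_B_mul_B (hW : IsCombination W) : (Design.ED W).B * (Design.ED W).B = 1 - W :=
  CFC.sqrt_mul_sqrt_self _ (Matrix.nonneg_iff_posSemidef.mpr hW.posSemidef_one_sub)

open scoped MatrixOrder in
theorem Design.ED_B_isSymm (W : Matrix (Fin K) (Fin K) ℝ) : (Design.ED W).B.IsSymm := by
  have h : (Design.ED W).B.PosSemidef := Matrix.nonneg_iff_posSemidef.mp (CFC.sqrt_nonneg _)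
  have := h.isHermitian.eq
  rwa [Matrix.conjTranspose_eq_transpose_of_trivial] at this

/-- `(I - W)^{1/2}` annihilates the constants. -/
theorem Design.ED_B_mulVec_one (hW : IsCombination W) :
    (Design.ED W).B *ᵥ (fun _ => 1) = 0 := by
  set B := (Design.ED W).B with hB
  have h1 : (1 - W) *ᵥ (fun _ => (1 : ℝ)) = 0 := by
    rw [Matrix.sub_mulVec, Matrix.one_mulVec]
    funext k
    simp [Matrix.mulVec, dotProduct, hW.row_sum]
  have h2 : (B *ᵥ fun _ => (1 : ℝ)) ⬝ᵥ (B *ᵥ fun _ => (1 : ℝ)) = 0 := by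
    rw [Matrix.dotProduct_mulVec, ← Matrix.mulVec_transpose, (Design.ED_B_isSymm W).eq,
      Matrix.mulVec_mulVec, Design.ED_B_mul_B hW, h1]
    simp
  exact dotProduct_self_eq_zero.1 h2

theorem Design.ED_B_row_sum (hW : IsCombination W) (k : Fin K) : ∑ l, (Design.ED W).B k l = 0 := by
  have := congrFun (Design.ED_B_mulVec_one hW) k
  simpa [Matrix.mulVec, dotProduct] using this

end Network

/-! ### Consensus error of exact diffusion -/

section ExactDiffusion

variable {K d : ℕ} {W : Matrix (Fin K) (Fin K) ℝ}

/-- The primal and dual variables of exact diffusion with step size `μ`, driven by the directions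
`M i` and started in consensus. -/
structure IsExactDiffusion (W : Matrix (Fin K) (Fin K) ℝ) (μ : ℝ) (X D M : ℕ → Block K d) :
    Prop where
  init_X : ∃ v, X 0 = fun _ => v
  init_D : ∃ v, D 0 = fun _ => v
  step_X : ∀ i, X (i + 1) = blockMul W (X i - μ • M i) - blockMul (Design.ED W).B (D i)
  step_D : ∀ i, D (i + 1) = D i + blockMul (Design.ED W).B (X (i + 1))

variable {μ : ℝ} {X D M : ℕ → Block K d}

/-- The network average performs plain descent with the averaged direction. -/
theorem IsExactDiffusion.centroid_succ (h : IsExactDiffusion W μ X D M) (hW : IsCombination W)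
    (i : ℕ) : centroid (X (i + 1)) = centroid (X i) - μ • centroid (M i) := by
  have h1 : W *ᵥ (fun _ => 1 / (K : ℝ)) = (1 : ℝ) • (fun _ => 1 / (K : ℝ)) := by
    funext k
    simp only [Matrix.mulVec, dotProduct, ← Finset.sum_mul, hW.row_sum]
    simp
  have h2 : (Design.ED W).B *ᵥ (fun _ => 1 / (K : ℝ)) = (0 : ℝ) • (fun _ => 1 / (K : ℝ)) := by
    funext k
    simp only [Matrix.mulVec, dotProduct, ← Finset.sum_mul, Design.ED_B_row_sum hW]
    simp
  rw [h.step_X]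
  simp only [centroid_eq_proj]
  rw [proj_sub, proj_blockMul hW.symm h1, proj_blockMul (Design.ED_B_isSymm W) h2, proj_sub,
    proj_smul]
  simp

/-- Eliminating the dual variable. -/
theorem IsExactDiffusion.second_order (h : IsExactDiffusion W μ X D M) (hW : IsCombination W)
    (i : ℕ) : X (i + 2) = (2 : ℝ) • blockMul W (X (i + 1)) - blockMul W (X i)
      - μ • blockMul W (M (i + 1) - M i) := by
  have h1 : blockMul (Design.ED W).B (D i) = blockMul W (X i - μ • M i) - X (i + 1) := by
    rw [h.step_X]; abel
  have h2 : blockMul (Design.ED W).B (blockMul (Design.ED W).B (X (i + 1)))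
      = X (i + 1) - blockMul W (X (i + 1)) := by
    rw [← blockMul_mul, Design.ED_B_mul_B hW, sub_blockMul, blockMul_one]
  rw [h.step_X (i + 1), h.step_D, blockMul_add, h1, h2]
  simp only [blockMul_sub, blockMul_smul, smul_sub, two_smul]
  abel

theorem IsExactDiffusion.first_step (h : IsExactDiffusion W μ X D M) (hW : IsCombination W) :
    X 1 = blockMul W (X 0 - μ • M 0) := by
  obtain ⟨v, hv⟩ := h.init_D
  have := h.step_X 0
  rw [hv, blockMul_const 0 (Design.ED_B_row_sum hW)] at this
  rw [this]
  funext k; simp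

/-- The consensus error is controlled by the initial heterogeneity of the directions and by their
increments. -/
theorem IsExactDiffusion.sum_deviation_le (h : IsExactDiffusion W μ X D M) (hW : IsCombination W)
    (hP : W.PosSemidef) (n : ℕ) :
    ∑ i ∈ Finset.range (n + 1), blockNormSq (deviation (X i))
      ≤ 2 * μ ^ 2 / (1 - mixing W) ^ 2 * blockNormSq (blockMul (W - avgMatrix K) (M 0))
        + mixing W ^ 2 * μ ^ 2 / ((1 - √(mixing W)) ^ 2 * (1 - mixing W))
          * ∑ j ∈ Finset.range n, blockNormSq (M (j + 1) - M j) := by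
  have hl0 := mixing_nonneg hP
  have hl1 := hW.mixing_lt_one
  have hH : W.IsHermitian := hP.isHermitian
  set e := hH.eigenvectorBasis
  simp only [← sum_norm_sq_proj e]
  rw [Finset.sum_comm (s := Finset.range (n + 1)), Finset.sum_comm (s := Finset.range n),
    Finset.mul_sum, Finset.mul_sum, ← Finset.sum_add_distrib]
  refine Finset.sum_le_sum fun j _ => ?_
  set u := (e j).ofLp with hu
  set ℓ := hH.eigenvalues j with hℓ
  have hWu : W *ᵥ u = ℓ • u := hH.mulVec_eigenvectorBasis j
  rcases hW.eigenvector_cases hWu with hs | ⟨c, hc⟩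
  · have hne : u ≠ 0 := by
      intro h0
      have h1 : e j = 0 := by
        ext k
        exact congrFun h0 k
      have := e.orthonormal.1 j
      rw [h1, norm_zero] at this
      exact zero_ne_one this
    have h0 : 0 ≤ ℓ := eigenvalue_nonneg hP hne hWu
    have hle : ℓ ≤ mixing W := le_mixing hne hs hWu
    obtain ⟨v, hv⟩ := h.init_X
    have hdev : ∀ i, proj u (deviation (X i)) = proj u (X i) := fun i => by
      rw [deviation, proj_sub, proj_const, hs, zero_smul, sub_zero]
    have hinit : proj u (blockMul (W - avgMatrix K) (M 0)) = ℓ • proj u (M 0) := by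
      have hcst : blockMul (avgMatrix K) (M 0) = fun _ => centroid (M 0) := by
        funext k; simp [blockMul, avgMatrix, centroid, Finset.smul_sum]
      rw [sub_blockMul, hcst, proj_sub, proj_const, hs, zero_smul, sub_zero,
        proj_blockMul hW.symm hWu]
    simp only [hdev, hinit, proj_sub]
    refine sum_norm_sq_le_of_second_order h0 hle hl1 (fun i => proj u (X i))
      (fun i => proj u (M i)) ?_ ?_ (fun i => ?_) n
    · simp only [hv, proj_const, hs, zero_smul]
    · simp only [h.first_step hW, hv]
      rw [proj_blockMul hW.symm hWu, proj_sub, proj_const, hs, zero_smul, zero_sub, proj_smul,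
        smul_neg, smul_smul]
    · simp only [h.second_order hW, proj_sub, proj_smul, proj_blockMul hW.symm hWu, smul_smul]
      rw [smul_sub, smul_sub, mul_comm ℓ μ]
  · have hdev : ∀ i, proj u (deviation (X i)) = 0 := fun i => by
      rcases Nat.eq_zero_or_pos K with hK | hK
      · subst hK; simp [proj]
      have hK' : (K : ℝ) ≠ 0 := by positivity
      rw [deviation, proj_sub, proj_const, hc]
      simp only [proj, ← Finset.smul_sum, centroid, Finset.sum_const, Finset.card_univ,
        Fintype.card_fin, smul_smul, nsmul_eq_mul]
      rw [show (K : ℝ) * c * (1 / K) = c by field_simp, sub_self]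
    simp only [hdev]
    simp only [norm_zero, ne_eq, OfNat.ofNat_ne_zero, not_false_eq_true, zero_pow,
      Finset.sum_const_zero]
    have : 0 < 1 - mixing W := by linarith
    have := Finset.sum_nonneg (s := Finset.range n)
      fun i (_ : i ∈ Finset.range n) => sq_nonneg ‖proj u (M (i + 1) - M i)‖
    positivity

end ExactDiffusion

/-! ### Square-integrable random vectors -/

section SquareIntegrable

variable {Ω E : Type*} [MeasurableSpace Ω] {Pr : Measure Ω} [NormedAddCommGroup E]

theorem memLp_two_of_lintegral_sq_le {f : Ω → E} (hf : AEStronglyMeasurable f Pr) {c : ℝ}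
    (hc : 0 ≤ c) (h : ∫⁻ ω, ‖f ω‖ₑ ^ 2 ∂Pr ≤ ENNReal.ofReal c) :
    MemLp f 2 Pr ∧ ∫ ω, ‖f ω‖ ^ 2 ∂Pr ≤ c := by
  have e : ∀ ω, ENNReal.ofReal (‖f ω‖ ^ 2) = ‖f ω‖ₑ ^ 2 := fun ω => by
    rw [ENNReal.ofReal_pow (norm_nonneg _), ofReal_norm]
  have hm : AEStronglyMeasurable (fun ω => ‖f ω‖ ^ 2) Pr := hf.norm.pow 2
  have h0 : 0 ≤ᵐ[Pr] fun ω => ‖f ω‖ ^ 2 := Filter.Eventually.of_forall fun ω => sq_nonneg _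
  constructor
  · rw [memLp_two_iff_integrable_sq_norm hf]
    refine ⟨hm, ?_⟩
    rw [hasFiniteIntegral_iff_ofReal h0]
    simp only [e]
    exact h.trans_lt ENNReal.ofReal_lt_top
  · rw [integral_eq_lintegral_of_nonneg_ae h0 hm]
    simp only [e]
    exact ENNReal.toReal_le_of_le_ofReal hc h

theorem lintegral_sq_eq_ofReal {f : Ω → E} (hf : MemLp f 2 Pr) :
    ∫⁻ ω, ‖f ω‖ₑ ^ 2 ∂Pr = ENNReal.ofReal (∫ ω, ‖f ω‖ ^ 2 ∂Pr) := by
  rw [ofReal_integral_eq_lintegral_ofReal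
    ((memLp_two_iff_integrable_sq_norm hf.1).1 hf)
    (Filter.Eventually.of_forall fun ω => sq_nonneg _)]
  refine lintegral_congr fun ω => ?_
  rw [ENNReal.ofReal_pow (norm_nonneg _), ofReal_norm]

theorem integrable_norm_sq {f : Ω → E} (hf : MemLp f 2 Pr) :
    Integrable (fun ω => ‖f ω‖ ^ 2) Pr :=
  (memLp_two_iff_integrable_sq_norm hf.1).1 hf

theorem norm_add_sq_le (a b : E) : ‖a + b‖ ^ 2 ≤ 2 * ‖a‖ ^ 2 + 2 * ‖b‖ ^ 2 := by
  have := norm_add_le a b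
  nlinarith [norm_nonneg (a + b), sq_nonneg (‖a‖ - ‖b‖)]

theorem norm_sub_sq_le (a b : E) : ‖a - b‖ ^ 2 ≤ 2 * ‖a‖ ^ 2 + 2 * ‖b‖ ^ 2 := by
  have := norm_add_sq_le a (-b)
  rwa [norm_neg, ← sub_eq_add_neg] at this

variable [InnerProductSpace ℝ E]

theorem integrable_inner_of_memLp_two {f g : Ω → E} (hf : MemLp f 2 Pr) (hg : MemLp g 2 Pr) :
    Integrable (fun ω => inner ℝ (f ω) (g ω)) Pr := by
  refine ((integrable_norm_sq hf).add (integrable_norm_sq hg)).mono' (hf.1.inner hg.1) ?_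
  refine Filter.Eventually.of_forall fun ω => ?_
  have := abs_real_inner_le_norm (f ω) (g ω)
  simp only [Pi.add_apply, Real.norm_eq_abs]
  nlinarith [sq_nonneg (‖f ω‖ - ‖g ω‖), sq_nonneg (‖f ω‖ + ‖g ω‖)]

theorem integral_norm_add_sq_of_orthogonal {f g : Ω → E} (hf : MemLp f 2 Pr) (hg : MemLp g 2 Pr)
    (h : ∫ ω, inner ℝ (f ω) (g ω) ∂Pr = 0) :
    ∫ ω, ‖f ω + g ω‖ ^ 2 ∂Pr = ∫ ω, ‖f ω‖ ^ 2 ∂Pr + ∫ ω, ‖g ω‖ ^ 2 ∂Pr := by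
  have h1 := integrable_norm_sq hf
  have h2 := integrable_norm_sq hg
  have h3 := integrable_inner_of_memLp_two hf hg
  simp only [norm_add_sq_real]
  have h4 : Integrable (fun ω => ‖f ω‖ ^ 2 + 2 * inner ℝ (f ω) (g ω)) Pr :=
    h1.add (h3.const_mul 2)
  rw [integral_add h4 h2, integral_add h1 (h3.const_mul 2),
    integral_const_mul, h]
  ring

/-- Pythagoras for a square-integrable vector plus a finite orthogonal family. -/
theorem integral_norm_add_sum_sq {ι : Type*} [DecidableEq ι] (s : Finset ι) {V : Ω → E}
    {f : ι → Ω → E} (hV : MemLp V 2 Pr) (hf : ∀ a ∈ s, MemLp (f a) 2 Pr)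
    (hVf : ∀ a ∈ s, ∫ ω, inner ℝ (V ω) (f a ω) ∂Pr = 0)
    (hff : ∀ a ∈ s, ∀ b ∈ s, a ≠ b → ∫ ω, inner ℝ (f a ω) (f b ω) ∂Pr = 0) :
    ∫ ω, ‖V ω + ∑ a ∈ s, f a ω‖ ^ 2 ∂Pr
      = ∫ ω, ‖V ω‖ ^ 2 ∂Pr + ∑ a ∈ s, ∫ ω, ‖f a ω‖ ^ 2 ∂Pr := by
  induction s using Finset.induction_on with
  | empty => simp
  | insert a s ha ih =>
    have hs : ∀ b ∈ s, MemLp (f b) 2 Pr := fun b hb => hf b (Finset.mem_insert_of_mem hb)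
    have hfa := hf a (Finset.mem_insert_self a s)
    have h1 : MemLp (fun ω => V ω + ∑ b ∈ s, f b ω) 2 Pr := hV.add (memLp_finsetSum s hs)
    have h2 : ∫ ω, inner ℝ (V ω + ∑ b ∈ s, f b ω) (f a ω) ∂Pr = 0 := by
      simp only [inner_add_left, sum_inner]
      rw [integral_add (integrable_inner_of_memLp_two hV hfa)
        (integrable_finsetSum _ fun b hb => integrable_inner_of_memLp_two (hs b hb) hfa),
        integral_finsetSum _ fun b hb => integrable_inner_of_memLp_two (hs b hb) hfa,
        hVf a (Finset.mem_insert_self a s), zero_add]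
      refine Finset.sum_eq_zero fun b hb => ?_
      exact hff b (Finset.mem_insert_of_mem hb) a (Finset.mem_insert_self a s)
        (fun h => ha (h ▸ hb))
    have h3 := integral_norm_add_sq_of_orthogonal h1 hfa h2
    rw [ih hs (fun b hb => hVf b (Finset.mem_insert_of_mem hb)) (fun b hb c hc =>
      hff b (Finset.mem_insert_of_mem hb) c (Finset.mem_insert_of_mem hc))] at h3
    rw [Finset.sum_insert ha]
    have e : ∀ ω, V ω + ∑ b ∈ insert a s, f b ω = V ω + ∑ b ∈ s, f b ω + f a ω := fun ω => by
      rw [Finset.sum_insert ha]; abel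
    simp only [e, h3]
    ring

end SquareIntegrable

/-! ### Fresh samples -/

section Fresh

variable {Ω Ξ A E ι : Type*} [MeasurableSpace Ξ]

/-- The σ-algebra generated by the samples with index in `S`. -/
@[reducible] def sampleSigma (ξ : ι → Ω → Ξ) (S : Set ι) : MeasurableSpace Ω :=
  ⨆ s ∈ S, MeasurableSpace.comap (ξ s) inferInstance

theorem sampleSigma_mono (ξ : ι → Ω → Ξ) {S T : Set ι} (h : S ⊆ T) :
    sampleSigma ξ S ≤ sampleSigma ξ T := biSup_mono h

theorem measurable_sample (ξ : ι → Ω → Ξ) {S : Set ι} {t : ι} (ht : t ∈ S) :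
    Measurable[sampleSigma ξ S] (ξ t) :=
  (comap_measurable (ξ t)).mono (le_iSup₂_of_le t ht le_rfl) le_rfl

variable [mΩ : MeasurableSpace Ω] [MeasurableSpace A] {Pr : Measure Ω}

theorem sampleSigma_le {ξ : ι → Ω → Ξ} (hξ : ∀ t, Measurable (ξ t)) (S : Set ι) :
    sampleSigma ξ S ≤ mΩ := iSup₂_le fun t _ => (hξ t).comap_le

theorem indepFun_sample {ξ : ι → Ω → Ξ} (hξ : ∀ t, Measurable (ξ t)) (hind : iIndepFun ξ Pr)
    {t : ι} {U : Ω → A} (hU : Measurable[sampleSigma ξ {t}ᶜ] U) : IndepFun U (ξ t) Pr := by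
  have h := indep_iSup_of_disjoint (fun s => (hξ s).comap_le) hind.iIndep
    (S := {t}ᶜ) (T := {t}) disjoint_compl_left
  rw [IndepFun_iff_Indep]
  refine indep_of_indep_of_le_left (indep_of_indep_of_le_right h ?_) hU.comap_le
  exact le_iSup₂_of_le t rfl le_rfl

variable [IsProbabilityMeasure Pr] [NormedAddCommGroup E] [MeasurableSpace E] [BorelSpace E]
  [SecondCountableTopology E]

/-- Second moments may be computed by integrating out the fresh sample first. -/
theorem fresh_second_moment {ξ : ι → Ω → Ξ} (hξ : ∀ t, Measurable (ξ t))
    (hind : iIndepFun ξ Pr) {t : ι} {h : A → Ξ → E}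
    (hm : Measurable fun p : A × Ξ => h p.1 p.2) {U : Ω → A}
    (hU : Measurable[sampleSigma ξ {t}ᶜ] U) {B : Ω → ℝ} (hB : Integrable B Pr) (hB0 : ∀ ω, 0 ≤ B ω)
    (hbd : ∀ ω, ∫⁻ ζ, ‖h (U ω) ζ‖ₑ ^ 2 ∂(Pr.map (ξ t)) ≤ ENNReal.ofReal (B ω)) :
    MemLp (fun ω => h (U ω) (ξ t ω)) 2 Pr ∧
      ∫ ω, ‖h (U ω) (ξ t ω)‖ ^ 2 ∂Pr ≤ ∫ ω, B ω ∂Pr := by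
  have hle := sampleSigma_le hξ {t}ᶜ
  have hU' : Measurable U := hU.mono hle le_rfl
  have hprod := (indepFun_iff_map_prod_eq_prod_map_map
    hU'.aemeasurable (hξ t).aemeasurable).1 (indepFun_sample hξ hind hU)
  have hP := Measure.isProbabilityMeasure_map (μ := Pr) (hξ t).aemeasurable
  have hφ : Measurable fun ω => (U ω, ξ t ω) := hU'.prodMk (hξ t)
  have hF : Measurable fun q : A × Ξ => ‖h q.1 q.2‖ₑ ^ 2 := hm.enorm.pow_const 2
  have hmφ : Measurable fun ω => h (U ω) (ξ t ω) := hm.comp hφ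
  refine memLp_two_of_lintegral_sq_le hmφ.aestronglyMeasurable (integral_nonneg hB0) ?_
  have h1 : ∫⁻ ω, ‖h (U ω) (ξ t ω)‖ₑ ^ 2 ∂Pr
      = ∫⁻ q, ‖h q.1 q.2‖ₑ ^ 2 ∂(Pr.map fun ω => (U ω, ξ t ω)) := (lintegral_map hF hφ).symm
  rw [h1, hprod, lintegral_prod _ hF.aemeasurable, lintegral_map hF.lintegral_prod_right' hU',
    ofReal_integral_eq_lintegral_ofReal hB (Filter.Eventually.of_forall hB0)]
  exact lintegral_mono hbd

variable [InnerProductSpace ℝ E] [CompleteSpace E]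

/-- A centred function of a fresh sample is orthogonal to everything the other samples determine. -/
theorem integral_inner_fresh_eq_zero {ξ : ι → Ω → Ξ} (hξ : ∀ t, Measurable (ξ t))
    (hind : iIndepFun ξ Pr) {t : ι} {h : A → Ξ → E}
    (hm : Measurable fun p : A × Ξ => h p.1 p.2)
    (hint : ∀ u, Integrable (h u) (Pr.map (ξ t))) (hzero : ∀ u, ∫ ζ, h u ζ ∂(Pr.map (ξ t)) = 0)
    {V : Ω → E} {U : Ω → A} (hV : Measurable[sampleSigma ξ {t}ᶜ] V)
    (hU : Measurable[sampleSigma ξ {t}ᶜ] U) (hV2 : MemLp V 2 Pr)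
    (hh2 : MemLp (fun ω => h (U ω) (ξ t ω)) 2 Pr) :
    ∫ ω, inner ℝ (V ω) (h (U ω) (ξ t ω)) ∂Pr = 0 := by
  have hle := sampleSigma_le hξ {t}ᶜ
  have hV' : Measurable V := hV.mono hle le_rfl
  have hU' : Measurable U := hU.mono hle le_rfl
  have hVU : Measurable[sampleSigma ξ {t}ᶜ] fun ω => (V ω, U ω) := hV.prodMk hU
  have hprod := (indepFun_iff_map_prod_eq_prod_map_map
    (hVU.mono hle le_rfl).aemeasurable (hξ t).aemeasurable).1 (indepFun_sample hξ hind hVU)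
  have hP := Measure.isProbabilityMeasure_map (μ := Pr) (hξ t).aemeasurable
  let F : (E × A) × Ξ → ℝ := fun q => inner ℝ q.1.1 (h q.1.2 q.2)
  have hF : Measurable F :=
    (measurable_fst.comp measurable_fst).inner
      (hm.comp ((measurable_snd.comp measurable_fst).prodMk measurable_snd))
  have hφ : Measurable fun ω => ((V ω, U ω), ξ t ω) := (hV'.prodMk hU').prodMk (hξ t)
  have hFi : Integrable F (Pr.map fun ω => ((V ω, U ω), ξ t ω)) :=
    (integrable_map_measure hF.aestronglyMeasurable hφ.aemeasurable).2
      (integrable_inner_of_memLp_two hV2 hh2)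
  have h1 : ∫ ω, inner ℝ (V ω) (h (U ω) (ξ t ω)) ∂Pr
      = ∫ q, F q ∂(Pr.map fun ω => ((V ω, U ω), ξ t ω)) :=
    (integral_map hφ.aemeasurable hF.aestronglyMeasurable).symm
  rw [h1, hprod, integral_prod _ (hprod ▸ hFi)]
  refine integral_eq_zero_of_ae (Filter.Eventually.of_forall fun p => ?_)
  simp only [F, Pi.zero_apply]
  rw [integral_inner (hint p.2), hzero, inner_zero_right]

end Fresh

section Batch

variable {Ω Ξ A E : Type*} [MeasurableSpace Ξ] {K : ℕ}

/-- The σ-algebra of all samples drawn before iteration `i`. -/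
@[reducible] def past (ξ : ℕ → ℕ → Fin K → Ω → Ξ) (i : ℕ) : MeasurableSpace Ω :=
  sampleSigma (fun t : ℕ × ℕ × Fin K => ξ t.1 t.2.1 t.2.2) {t | t.1 < i}

theorem past_mono (ξ : ℕ → ℕ → Fin K → Ω → Ξ) {i i' : ℕ} (h : i ≤ i') : past ξ i ≤ past ξ i' :=
  sampleSigma_mono _ fun _ ht => lt_of_lt_of_le ht h

theorem measurable_past_sample (ξ : ℕ → ℕ → Fin K → Ω → Ξ) (i j : ℕ) (k : Fin K) :
    Measurable[past ξ (i + 1)] (ξ i j k) := by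
  unfold past
  have h : ((i, j, k) : ℕ × ℕ × Fin K) ∈ {t : ℕ × ℕ × Fin K | t.1 < i + 1} := Nat.lt_succ_self i
  have := measurable_sample (fun t : ℕ × ℕ × Fin K => ξ t.1 t.2.1 t.2.2) h
  exact this

variable [mΩ : MeasurableSpace Ω]

theorem past_le {ξ : ℕ → ℕ → Fin K → Ω → Ξ} (hξ : ∀ i j k, Measurable (ξ i j k)) (i : ℕ) :
    past ξ i ≤ mΩ :=
  sampleSigma_le (ξ := fun t : ℕ × ℕ × Fin K => ξ t.1 t.2.1 t.2.2) (fun t => hξ t.1 t.2.1 t.2.2) _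

variable [MeasurableSpace A]
  {Pr : Measure Ω} [IsProbabilityMeasure Pr] [NormedAddCommGroup E] [InnerProductSpace ℝ E]
  [CompleteSpace E] [MeasurableSpace E] [BorelSpace E] [SecondCountableTopology E]

/-- A weighted minibatch average of centred functions of the samples of iteration `i` is orthogonal
to the past, and its variance is the sum of the variances. -/
theorem minibatch_second_moment {ξ : ℕ → ℕ → Fin K → Ω → Ξ} {law : Fin K → Measure Ξ}
    (hξ : ∀ i j k, Measurable (ξ i j k)) (hlaw : ∀ i j k, Pr.map (ξ i j k) = law k)
    (hind : iIndepFun (fun t : ℕ × ℕ × Fin K => ξ t.1 t.2.1 t.2.2) Pr)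
    (i : ℕ) {n : ℕ} (hn : 1 ≤ n) {h : Fin K → A → Ξ → E}
    (hm : ∀ k, Measurable fun p : A × Ξ => h k p.1 p.2)
    (hint : ∀ k u, Integrable (h k u) (law k)) (hzero : ∀ k u, ∫ ζ, h k u ζ ∂(law k) = 0)
    {U : Fin K → Ω → A} (hU : ∀ k, Measurable[past ξ i] (U k))
    {B : Fin K → Ω → ℝ} (hB : ∀ k, Integrable (B k) Pr) (hB0 : ∀ k ω, 0 ≤ B k ω)
    (hbd : ∀ k ω, ∫⁻ ζ, ‖h k (U k ω) ζ‖ₑ ^ 2 ∂(law k) ≤ ENNReal.ofReal (B k ω))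
    {V : Ω → E} (hV : Measurable[past ξ i] V) (hV2 : MemLp V 2 Pr) (w : Fin K → ℝ) :
    MemLp (fun ω => ∑ k, w k • (1 / (n : ℝ)) • ∑ j ∈ Finset.range n, h k (U k ω) (ξ i j k ω)) 2 Pr ∧
    ∫ ω, ‖V ω + ∑ k, w k • (1 / (n : ℝ)) • ∑ j ∈ Finset.range n, h k (U k ω) (ξ i j k ω)‖ ^ 2 ∂Pr
      ≤ ∫ ω, ‖V ω‖ ^ 2 ∂Pr + 1 / (n : ℝ) * ∑ k, w k ^ 2 * ∫ ω, B k ω ∂Pr := by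
  set χ : ℕ × ℕ × Fin K → Ω → Ξ := fun t => ξ t.1 t.2.1 t.2.2 with hχ
  have hχm : ∀ t, Measurable (χ t) := fun t => hξ _ _ _
  have hpast : ∀ j k, past ξ i ≤ sampleSigma χ {(i, j, k)}ᶜ := fun j k =>
    sampleSigma_mono χ fun s hs hs' => by
      rw [Set.mem_singleton_iff] at hs'
      subst hs'
      exact (lt_irrefl i) hs
  have hUo : ∀ j k k', Measurable[sampleSigma χ {(i, j, k)}ᶜ] (U k') := fun j k k' =>
    (hU k').mono (hpast j k) le_rfl
  have hmom : ∀ j k, MemLp (fun ω => h k (U k ω) (ξ i j k ω)) 2 Pr ∧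
      ∫ ω, ‖h k (U k ω) (ξ i j k ω)‖ ^ 2 ∂Pr ≤ ∫ ω, B k ω ∂Pr := fun j k =>
    fresh_second_moment hχm hind (t := (i, j, k)) (hm k) (hUo j k k) (hB k) (hB0 k)
      (by simpa only [hχ, hlaw] using hbd k)
  let f : Fin K × ℕ → Ω → E := fun a ω => (w a.1 * (1 / (n : ℝ))) • h a.1 (U a.1 ω) (ξ i a.2 a.1 ω)
  have hf : ∀ a, MemLp (f a) 2 Pr := fun a => (hmom a.2 a.1).1.const_smul _
  have hsum : ∀ ω, ∑ k, w k • (1 / (n : ℝ)) • ∑ j ∈ Finset.range n, h k (U k ω) (ξ i j k ω)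
      = ∑ a ∈ Finset.univ ×ˢ Finset.range n, f a ω := fun ω => by
    rw [Finset.sum_product]
    refine Finset.sum_congr rfl fun k _ => ?_
    rw [smul_smul, Finset.smul_sum]
  have horth : ∀ (V : Ω → E) (a : Fin K × ℕ), Measurable[sampleSigma χ {(i, a.2, a.1)}ᶜ] V →
      MemLp V 2 Pr → ∫ ω, inner ℝ (V ω) (f a ω) ∂Pr = 0 := by
    intro V a hV hV2
    have := integral_inner_fresh_eq_zero hχm hind (t := (i, a.2, a.1)) (hm a.1)
      (by simpa only [hχ, hlaw] using hint a.1) (by simpa only [hχ, hlaw] using hzero a.1)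
      hV (hUo a.2 a.1 a.1) hV2 (hmom a.2 a.1).1
    simp only [f, inner_smul_right]
    rw [integral_const_mul]
    exact mul_eq_zero_of_right _ this
  simp only [hsum]
  refine ⟨memLp_finsetSum _ fun a _ => hf a, ?_⟩
  rw [integral_norm_add_sum_sq _ hV2 (fun a _ => hf a)
    (fun a _ => horth V a (hV.mono (hpast _ _) le_rfl) hV2) ?_]
  · refine add_le_add le_rfl ?_
    rw [Finset.sum_product, Finset.mul_sum]
    refine Finset.sum_le_sum fun k _ => ?_
    have hn' : (0 : ℝ) < n := by exact_mod_cast hn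
    calc ∑ j ∈ Finset.range n, ∫ ω, ‖f (k, j) ω‖ ^ 2 ∂Pr
        ≤ ∑ _j ∈ Finset.range n, (w k * (1 / (n : ℝ))) ^ 2 * ∫ ω, B k ω ∂Pr := by
          refine Finset.sum_le_sum fun j _ => ?_
          simp only [f, norm_smul, mul_pow, Real.norm_eq_abs, sq_abs]
          rw [integral_const_mul]
          exact mul_le_mul_of_nonneg_left (hmom j k).2 (by positivity)
      _ = 1 / (n : ℝ) * (w k ^ 2 * ∫ ω, B k ω ∂Pr) := by
          rw [Finset.sum_const, Finset.card_range, nsmul_eq_mul]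
          field_simp
  · intro a _ b _ hab
    refine horth (f a) b ?_ (hf a)
    have h1 : Measurable[sampleSigma χ {(i, b.2, b.1)}ᶜ] (ξ i a.2 a.1) :=
      measurable_sample χ (t := (i, a.2, a.1)) (by
        intro h
        simp only [Set.mem_singleton_iff, Prod.mk.injEq, true_and] at h
        exact hab (Prod.ext h.2 h.1))
    have h2 : Measurable[sampleSigma χ {(i, b.2, b.1)}ᶜ]
        fun ω => h a.1 (U a.1 ω) (ξ i a.2 a.1 ω) := (hm a.1).comp ((hUo b.2 b.1 a.1).prodMk h1)
    exact h2.const_smul _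

end Batch

/-! ### The STORM gradient estimator -/

/-- `G k z ζ` is a noisy gradient of agent `k` at the point `z` with mean `g k z` and variance at
most `σ²`, and `q` bounds the mean-square variation of `G k` between two points. -/
structure IsNoisyGradient {K : ℕ} {Z Ξ E : Type*} [MeasurableSpace Z] [MeasurableSpace Ξ]
    [NormedAddCommGroup E] [NormedSpace ℝ E] [MeasurableSpace E] (law : Fin K → Measure Ξ)
    (G : Fin K → Z → Ξ → E) (g : Fin K → Z → E) (q : Z → Z → ℝ) (σ : ℝ) : Prop where
  prob : ∀ k, IsProbabilityMeasure (law k)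
  meas : ∀ k, Measurable fun p : Z × Ξ => G k p.1 p.2
  meas_mean : ∀ k, Measurable (g k)
  mean : ∀ k z, ∫ ζ, G k z ζ ∂law k = g k z
  q_nonneg : ∀ z z', 0 ≤ q z z'
  smooth : ∀ k z z', ∫⁻ ζ, ‖G k z ζ - G k z' ζ‖ₑ ^ 2 ∂law k ≤ ENNReal.ofReal (q z z')
  var : ∀ k z, ∫⁻ ζ, ‖G k z ζ - g k z‖ₑ ^ 2 ∂law k ≤ ENNReal.ofReal (σ ^ 2)

namespace IsNoisyGradient

variable {K : ℕ} {Z Ξ E : Type*} [MeasurableSpace Z] [MeasurableSpace Ξ]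
    [NormedAddCommGroup E] [InnerProductSpace ℝ E] [MeasurableSpace E] [BorelSpace E]
    [SecondCountableTopology E] {law : Fin K → Measure Ξ}
    {G : Fin K → Z → Ξ → E} {g : Fin K → Z → E} {q : Z → Z → ℝ} {σ : ℝ}

theorem memLp_sub_mean (h : IsNoisyGradient law G g q σ) (k : Fin K) (z : Z) :
    MemLp (fun ζ => G k z ζ - g k z) 2 (law k) ∧ ∫ ζ, ‖G k z ζ - g k z‖ ^ 2 ∂law k ≤ σ ^ 2 :=
  memLp_two_of_lintegral_sq_le
    (((h.meas k).comp measurable_prodMk_left).sub_const _).aestronglyMeasurable (sq_nonneg σ)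
    (h.var k z)

theorem memLp_sub (h : IsNoisyGradient law G g q σ) (k : Fin K) (z z' : Z) :
    MemLp (fun ζ => G k z ζ - G k z' ζ) 2 (law k) ∧
      ∫ ζ, ‖G k z ζ - G k z' ζ‖ ^ 2 ∂law k ≤ q z z' :=
  memLp_two_of_lintegral_sq_le
    (((h.meas k).comp measurable_prodMk_left).sub
      ((h.meas k).comp measurable_prodMk_left)).aestronglyMeasurable (h.q_nonneg _ _)
    (h.smooth k z z')

theorem integrable (h : IsNoisyGradient law G g q σ) (k : Fin K) (z : Z) :
    Integrable (G k z) (law k) := by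
  have := h.prob k
  have h1 := ((h.memLp_sub_mean k z).1.integrable one_le_two).add (integrable_const (g k z))
  refine h1.congr (Filter.Eventually.of_forall fun ζ => ?_)
  simp

/-- The centred noise that one fresh sample adds to the estimator moving from `p.1` to `p.2`. -/
def stormNoise (G : Fin K → Z → Ξ → E) (g : Fin K → Z → E) (β : ℝ) (k : Fin K) (p : Z × Z)
    (ζ : Ξ) : E :=
  (G k p.2 ζ - g k p.2) - (1 - β) • (G k p.1 ζ - g k p.1)

theorem measurable_stormNoise (h : IsNoisyGradient law G g q σ) (β : ℝ) (k : Fin K) :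
    Measurable fun p : (Z × Z) × Ξ => stormNoise G g β k p.1 p.2 := by
  have h1 : Measurable fun p : (Z × Z) × Ξ => G k p.1.1 p.2 :=
    (h.meas k).comp ((measurable_fst.comp measurable_fst).prodMk measurable_snd)
  have h2 : Measurable fun p : (Z × Z) × Ξ => G k p.1.2 p.2 :=
    (h.meas k).comp ((measurable_snd.comp measurable_fst).prodMk measurable_snd)
  have h3 : Measurable fun p : (Z × Z) × Ξ => g k p.1.1 :=
    (h.meas_mean k).comp (measurable_fst.comp measurable_fst)
  have h4 : Measurable fun p : (Z × Z) × Ξ => g k p.1.2 :=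
    (h.meas_mean k).comp (measurable_snd.comp measurable_fst)
  exact (h2.sub h4).sub ((h1.sub h3).const_smul (1 - β))

theorem integrable_sub_mean (h : IsNoisyGradient law G g q σ) (k : Fin K) (z : Z) :
    Integrable (fun ζ => G k z ζ - g k z) (law k) := by
  have := h.prob k
  exact (h.integrable k z).sub (integrable_const _)

theorem integrable_stormNoise (h : IsNoisyGradient law G g q σ) (β : ℝ) (k : Fin K)
    (p : Z × Z) : Integrable (stormNoise G g β k p) (law k) :=
  (h.integrable_sub_mean k p.2).sub ((h.integrable_sub_mean k p.1).smul (1 - β))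

variable [CompleteSpace E]

/-- The mean gradient inherits the mean-square smoothness. -/
theorem norm_sq_mean_sub_le (h : IsNoisyGradient law G g q σ) (k : Fin K) (z z' : Z) :
    ‖g k z - g k z'‖ ^ 2 ≤ q z z' := by
  have := h.prob k
  have hi : Integrable (fun ζ => G k z ζ - G k z' ζ) (law k) :=
    (h.integrable k z).sub (h.integrable k z')
  have e : g k z - g k z' = ∫ ζ, (G k z ζ - G k z' ζ) ∂law k := by
    rw [integral_sub (h.integrable k z) (h.integrable k z'), h.mean, h.mean]
  set v := g k z - g k z'
  obtain ⟨h1, h2⟩ := h.memLp_sub k z z'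
  -- integrate `2⟪v, D⟫ ≤ ‖v‖² + ‖D‖²`, where `v` is the mean of `D`
  have h3 : ∫ ζ, (2 * inner ℝ v (G k z ζ - G k z' ζ) - ‖v‖ ^ 2) ∂law k
      ≤ ∫ ζ, ‖G k z ζ - G k z' ζ‖ ^ 2 ∂law k := by
    refine integral_mono (((hi.const_inner v).const_mul 2).sub (integrable_const _))
      (integrable_norm_sq h1) fun ζ => ?_
    have := sq_nonneg ‖v - (G k z ζ - G k z' ζ)‖
    rw [norm_sub_sq_real] at this
    simp only
    linarith
  have h4 : Integrable (fun ζ => 2 * inner ℝ v (G k z ζ - G k z' ζ)) (law k) :=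
    (hi.const_inner v).const_mul 2
  rw [integral_sub h4 (integrable_const _), integral_const_mul,
    integral_inner hi, ← e, real_inner_self_eq_norm_sq] at h3
  simp only [integral_const, probReal_univ, smul_eq_mul, one_mul] at h3
  linarith

theorem integral_sub_mean (h : IsNoisyGradient law G g q σ) (k : Fin K) (z : Z) :
    ∫ ζ, (G k z ζ - g k z) ∂law k = 0 := by
  have := h.prob k
  rw [integral_sub (h.integrable k z) (integrable_const _), h.mean]
  simp

theorem integral_stormNoise (h : IsNoisyGradient law G g q σ) (β : ℝ) (k : Fin K)
    (p : Z × Z) : ∫ ζ, stormNoise G g β k p ζ ∂law k = 0 := by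
  have h1 : Integrable (fun ζ => (1 - β) • (G k p.1 ζ - g k p.1)) (law k) :=
    (h.integrable_sub_mean k p.1).smul (1 - β)
  simp only [stormNoise]
  rw [integral_sub (h.integrable_sub_mean k p.2) h1, integral_smul, h.integral_sub_mean,
    h.integral_sub_mean]
  simp

/-- The noise is `(1 - β)` times a gradient difference, small by smoothness, plus `β` times the noise
at the new point. -/
theorem lintegral_stormNoise_le (h : IsNoisyGradient law G g q σ) {β : ℝ} (hβ : 0 ≤ β)
    (hβ1 : β ≤ 1) (k : Fin K) (p : Z × Z) :
    ∫⁻ ζ, ‖stormNoise G g β k p ζ‖ₑ ^ 2 ∂law k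
      ≤ ENNReal.ofReal (8 * q p.2 p.1 + 2 * β ^ 2 * σ ^ 2) := by
  have := h.prob k
  obtain ⟨a1, a2⟩ := h.memLp_sub_mean k p.2
  obtain ⟨b1, b2⟩ := h.memLp_sub_mean k p.1
  obtain ⟨c1, c2⟩ := h.memLp_sub k p.2 p.1
  have hm : MemLp (fun ζ => stormNoise G g β k p ζ) 2 (law k) := a1.sub (b1.const_smul (1 - β))
  rw [lintegral_sq_eq_ofReal hm]
  refine ENNReal.ofReal_le_ofReal ?_
  have i1 : Integrable (fun ζ => 4 * ‖G k p.2 ζ - G k p.1 ζ‖ ^ 2) (law k) :=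
    (integrable_norm_sq c1).const_mul 4
  have i2 : Integrable (fun ζ => 2 * β ^ 2 * ‖G k p.2 ζ - g k p.2‖ ^ 2) (law k) :=
    (integrable_norm_sq a1).const_mul _
  have i3 : Integrable (fun ζ => 4 * ‖G k p.2 ζ - G k p.1 ζ‖ ^ 2 + 4 * q p.2 p.1) (law k) :=
    i1.add (integrable_const _)
  calc ∫ ζ, ‖stormNoise G g β k p ζ‖ ^ 2 ∂law k
      ≤ ∫ ζ, (4 * ‖G k p.2 ζ - G k p.1 ζ‖ ^ 2 + 4 * q p.2 p.1
          + 2 * β ^ 2 * ‖G k p.2 ζ - g k p.2‖ ^ 2) ∂law k := by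
        refine integral_mono (integrable_norm_sq hm) (i3.add i2) fun ζ => ?_
        have e : stormNoise G g β k p ζ
            = (1 - β) • ((G k p.2 ζ - G k p.1 ζ) - (g k p.2 - g k p.1))
              + β • (G k p.2 ζ - g k p.2) := by
          simp only [stormNoise]; module
        have h1 := norm_add_sq_le ((1 - β) • ((G k p.2 ζ - G k p.1 ζ) - (g k p.2 - g k p.1)))
          (β • (G k p.2 ζ - g k p.2))
        have h2 := norm_sub_sq_le (G k p.2 ζ - G k p.1 ζ) (g k p.2 - g k p.1)
        have h3 := h.norm_sq_mean_sub_le k p.2 p.1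
        simp only [e]
        rw [norm_smul, norm_smul, mul_pow, mul_pow, Real.norm_eq_abs, Real.norm_eq_abs, sq_abs,
          sq_abs] at h1
        have h4 : (1 - β) ^ 2 * ‖(G k p.2 ζ - G k p.1 ζ) - (g k p.2 - g k p.1)‖ ^ 2
            ≤ ‖(G k p.2 ζ - G k p.1 ζ) - (g k p.2 - g k p.1)‖ ^ 2 :=
          mul_le_of_le_one_left (sq_nonneg _) (by nlinarith)
        linarith
    _ = 4 * ∫ ζ, ‖G k p.2 ζ - G k p.1 ζ‖ ^ 2 ∂law k + 4 * q p.2 p.1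
          + 2 * β ^ 2 * ∫ ζ, ‖G k p.2 ζ - g k p.2‖ ^ 2 ∂law k := by
        rw [integral_add i3 i2, integral_add i1 (integrable_const _)]
        simp only [integral_const_mul]
        simp
    _ ≤ 8 * q p.2 p.1 + 2 * β ^ 2 * σ ^ 2 := by
        have := mul_le_mul_of_nonneg_left a2 (show 0 ≤ 2 * β ^ 2 by positivity)
        linarith

end IsNoisyGradient

section Storm

theorem sum_single_smul {K : ℕ} (k : Fin K) {E : Type*} [AddCommGroup E] [Module ℝ E] (f : Fin K → E) :
    ∑ l, (Pi.single k (1 : ℝ) : Fin K → ℝ) l • f l = f k := by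
  rw [Finset.sum_eq_single k] <;> simp +contextual

theorem sum_single_sq_mul {K : ℕ} (k : Fin K) (f : Fin K → ℝ) :
    ∑ l, (Pi.single k (1 : ℝ) : Fin K → ℝ) l ^ 2 * f l = f k := by
  rw [Finset.sum_eq_single k] <;> simp +contextual

variable {K : ℕ} {Z Ξ E Ω : Type*} [MeasurableSpace Z] [MeasurableSpace Ξ]
    [NormedAddCommGroup E] [InnerProductSpace ℝ E] [CompleteSpace E] [MeasurableSpace E]
    [BorelSpace E] [SecondCountableTopology E] {law : Fin K → Measure Ξ}
    {G : Fin K → Z → Ξ → E} {g : Fin K → Z → E} {q : Z → Z → ℝ} {σ : ℝ}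
    [MeasurableSpace Ω] {Pr : Measure Ω} [IsProbabilityMeasure Pr]
    {ξ : ℕ → ℕ → Fin K → Ω → Ξ}

/-- The initial minibatch has variance of order `σ² / n` per agent. -/
theorem storm_init (h : IsNoisyGradient law G g q σ)
    (hξ : ∀ i j k, Measurable (ξ i j k)) (hlaw : ∀ i j k, Pr.map (ξ i j k) = law k)
    (hind : iIndepFun (fun t : ℕ × ℕ × Fin K => ξ t.1 t.2.1 t.2.2) Pr)
    {n : ℕ} (hn : 1 ≤ n) (z : Fin K → Z) {S : Fin K → Ω → E}
    (hS : ∀ k ω, S k ω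
      = (1 / (n : ℝ)) • ∑ j ∈ Finset.range n, G k (z k) (ξ 0 j k ω) - g k (z k)) :
    (∀ k, MemLp (S k) 2 Pr) ∧ ∀ w : Fin K → ℝ,
      ∫ ω, ‖∑ k, w k • S k ω‖ ^ 2 ∂Pr ≤ 1 / (n : ℝ) * ∑ k, w k ^ 2 * σ ^ 2 := by
  have hn' : (n : ℝ) ≠ 0 := by positivity
  have hm : ∀ k, Measurable fun p : Z × Ξ => G k p.1 p.2 - g k p.1 := fun k =>
    (h.meas k).sub ((h.meas_mean k).comp measurable_fst)
  have key := fun w : Fin K → ℝ => minibatch_second_moment hξ hlaw hind 0 hn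
    (h := fun k z ζ => G k z ζ - g k z) hm h.integrable_sub_mean h.integral_sub_mean
    (U := fun k _ => z k) (fun k => measurable_const) (B := fun _ _ => σ ^ 2)
    (fun k => integrable_const _) (fun _ _ => sq_nonneg σ) (fun k ω => h.var k (z k))
    (V := fun _ => (0 : E)) measurable_const (memLp_const 0) w
  have e : ∀ k ω, (1 / (n : ℝ)) • ∑ j ∈ Finset.range n, (G k (z k) (ξ 0 j k ω) - g k (z k))
      = S k ω := fun k ω => by
    rw [hS, Finset.sum_sub_distrib, smul_sub, Finset.sum_const, Finset.card_range,
      ← Nat.cast_smul_eq_nsmul ℝ, smul_smul, one_div_mul_cancel hn', one_smul]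
  simp only [e] at key
  refine ⟨fun k => ?_, fun w => ?_⟩
  · have := (key (Pi.single k 1)).1
    simpa only [sum_single_smul] using this
  · have := (key w).2
    simpa using this

/-- One STORM update: the error contracts by `1 - β` and the variance of the fresh noise averages
over agents and batch. -/
theorem storm_step (h : IsNoisyGradient law G g q σ)
    (hξ : ∀ i j k, Measurable (ξ i j k)) (hlaw : ∀ i j k, Pr.map (ξ i j k) = law k)
    (hind : iIndepFun (fun t : ℕ × ℕ × Fin K => ξ t.1 t.2.1 t.2.2) Pr)
    {β : ℝ} (hβ : 0 ≤ β) (hβ1 : β ≤ 1) {n : ℕ} (hn : 1 ≤ n) (i : ℕ)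
    {z z' : Fin K → Ω → Z} (hz : ∀ k, Measurable[past ξ i] (z k))
    (hz' : ∀ k, Measurable[past ξ i] (z' k))
    (hq : ∀ k, Integrable (fun ω => q (z' k ω) (z k ω)) Pr)
    {M M' : Fin K → Ω → E}
    (hM' : ∀ k ω, M' k ω
      = (1 - β) • (M k ω - (1 / (n : ℝ)) • ∑ j ∈ Finset.range n, G k (z k ω) (ξ i j k ω))
        + (1 / (n : ℝ)) • ∑ j ∈ Finset.range n, G k (z' k ω) (ξ i j k ω))
    (hM : ∀ k, Measurable[past ξ i] (M k))
    (hS2 : ∀ k, MemLp (fun ω => M k ω - g k (z k ω)) 2 Pr) :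
    (∀ k, MemLp (fun ω => M' k ω - g k (z' k ω)) 2 Pr) ∧
    (∀ w : Fin K → ℝ, ∫ ω, ‖∑ k, w k • (M' k ω - g k (z' k ω))‖ ^ 2 ∂Pr
      ≤ (1 - β) * ∫ ω, ‖∑ k, w k • (M k ω - g k (z k ω))‖ ^ 2 ∂Pr
        + 1 / (n : ℝ) * ∑ k, w k ^ 2 *
          (8 * ∫ ω, q (z' k ω) (z k ω) ∂Pr + 2 * β ^ 2 * σ ^ 2)) ∧
    (∀ k, ∫ ω, ‖M' k ω - M k ω‖ ^ 2 ∂Pr ≤ 3 * β ^ 2 * ∫ ω, ‖M k ω - g k (z k ω)‖ ^ 2 ∂Pr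
        + 3 * (1 / (n : ℝ) * (8 * ∫ ω, q (z' k ω) (z k ω) ∂Pr + 2 * β ^ 2 * σ ^ 2))
        + 3 * ∫ ω, q (z' k ω) (z k ω) ∂Pr) := by
  have hn' : (n : ℝ) ≠ 0 := by positivity
  have hSm : ∀ k, Measurable[past ξ i] fun ω => M k ω - g k (z k ω) := fun k =>
    (hM k).sub ((h.meas_mean k).comp (hz k))
  have hBint : ∀ k, Integrable (fun ω => 8 * q (z' k ω) (z k ω) + 2 * β ^ 2 * σ ^ 2) Pr :=
    fun k => ((hq k).const_mul 8).add (integrable_const _)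
  have hBval : ∀ k, ∫ ω, (8 * q (z' k ω) (z k ω) + 2 * β ^ 2 * σ ^ 2) ∂Pr
      = 8 * ∫ ω, q (z' k ω) (z k ω) ∂Pr + 2 * β ^ 2 * σ ^ 2 := fun k => by
    rw [integral_add ((hq k).const_mul 8) (integrable_const _), integral_const_mul]
    simp
  have key := fun (V : Ω → E) (hV : Measurable[past ξ i] V) (hV2 : MemLp V 2 Pr)
      (w : Fin K → ℝ) => minibatch_second_moment hξ hlaw hind i hn
    (h := IsNoisyGradient.stormNoise G g β) (h.measurable_stormNoise β)
    (h.integrable_stormNoise β) (h.integral_stormNoise β)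
    (U := fun k ω => (z k ω, z' k ω)) (fun k => (hz k).prodMk (hz' k))
    (B := fun k ω => 8 * q (z' k ω) (z k ω) + 2 * β ^ 2 * σ ^ 2) hBint
    (fun k ω => by have := h.q_nonneg (z' k ω) (z k ω); positivity)
    (fun k ω => h.lintegral_stormNoise_le hβ hβ1 k _) hV hV2 w
  set N : Fin K → Ω → E := fun k ω => (1 / (n : ℝ)) • ∑ j ∈ Finset.range n,
    IsNoisyGradient.stormNoise G g β k (z k ω, z' k ω) (ξ i j k ω) with hN
  have hrec : ∀ k ω, M' k ω - g k (z' k ω) = (1 - β) • (M k ω - g k (z k ω)) + N k ω := by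
    intro k ω
    simp only [hN, IsNoisyGradient.stormNoise, hM']
    rw [Finset.sum_sub_distrib, Finset.sum_sub_distrib, ← Finset.smul_sum,
      Finset.sum_sub_distrib, Finset.sum_const, Finset.sum_const, Finset.card_range]
    simp only [← Nat.cast_smul_eq_nsmul ℝ]
    have e : ∀ v : E, (1 / (n : ℝ)) • (n : ℝ) • v = v := fun v => by
      rw [smul_smul, one_div_mul_cancel hn', one_smul]
    simp only [smul_sub, smul_comm (1 / (n : ℝ)) (1 - β), e]
    module
  have hN2 : ∀ k, MemLp (N k) 2 Pr := fun k => by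
    have := (key (fun _ => 0) measurable_const (memLp_const 0) (Pi.single k 1)).1
    exact (memLp_congr_ae (Filter.Eventually.of_forall fun ω =>
      sum_single_smul k (fun l => N l ω))).1 this
  have hNb : ∀ k, ∫ ω, ‖N k ω‖ ^ 2 ∂Pr
      ≤ 1 / (n : ℝ) * (8 * ∫ ω, q (z' k ω) (z k ω) ∂Pr + 2 * β ^ 2 * σ ^ 2) := fun k => by
    have := (key (fun _ => 0) measurable_const (memLp_const 0) (Pi.single k 1)).2
    rw [sum_single_sq_mul, hBval] at this
    have e : ∀ ω, ∑ l, (Pi.single k (1 : ℝ) : Fin K → ℝ) l • (1 / (n : ℝ)) •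
        ∑ j ∈ Finset.range n,
          IsNoisyGradient.stormNoise G g β l (z l ω, z' l ω) (ξ i j l ω) = N k ω := fun ω =>
      sum_single_smul k (fun l => N l ω)
    simp only [e, norm_zero, zero_add] at this
    simpa using this
  refine ⟨fun k => ?_, fun w => ?_, fun k => ?_⟩
  · simp only [hrec]
    exact ((hS2 k).const_smul (1 - β)).add (hN2 k)
  · have hVm : Measurable[past ξ i] fun ω => ∑ k, w k • (1 - β) • (M k ω - g k (z k ω)) :=
      Finset.measurable_sum _ fun k _ => ((hSm k).const_smul _).const_smul _
    have hV2 : MemLp (fun ω => ∑ k, w k • (1 - β) • (M k ω - g k (z k ω))) 2 Pr :=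
      memLp_finsetSum _ fun k _ => ((hS2 k).const_smul _).const_smul _
    have := (key _ hVm hV2 w).2
    simp only [hBval] at this
    have e1 : ∀ ω, ∑ k, w k • (M' k ω - g k (z' k ω))
        = ∑ k, w k • (1 - β) • (M k ω - g k (z k ω)) + ∑ k, w k • N k ω := fun ω => by
      simp only [hrec, smul_add, Finset.sum_add_distrib]
    simp only [e1]
    refine this.trans (add_le_add ?_ le_rfl)
    have e2 : ∀ ω, ‖∑ k, w k • (1 - β) • (M k ω - g k (z k ω))‖ ^ 2
        = (1 - β) ^ 2 * ‖∑ k, w k • (M k ω - g k (z k ω))‖ ^ 2 := fun ω => by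
      simp only [smul_comm _ (1 - β)]
      rw [← Finset.smul_sum, norm_smul, mul_pow, Real.norm_eq_abs, sq_abs]
    simp only [e2]
    rw [integral_const_mul]
    exact mul_le_mul_of_nonneg_right (by nlinarith) (integral_nonneg fun _ => sq_nonneg _)
  · -- the increment is `-β` times the error, plus fresh noise, plus the change of the mean
    have h1 := integrable_norm_sq (hS2 k)
    have h2 := integrable_norm_sq (hN2 k)
    have hle : ∀ ω, ‖M' k ω - M k ω‖ ^ 2 ≤ 3 * β ^ 2 * ‖M k ω - g k (z k ω)‖ ^ 2
        + 3 * ‖N k ω‖ ^ 2 + 3 * q (z' k ω) (z k ω) := by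
      intro ω
      have e : M' k ω - M k ω
          = -(β • (M k ω - g k (z k ω))) + N k ω + (g k (z' k ω) - g k (z k ω)) := by
        have := hrec k ω
        rw [sub_eq_iff_eq_add] at this
        rw [this]; module
      have h3 := h.norm_sq_mean_sub_le k (z' k ω) (z k ω)
      have h4 := norm_add₃_le (a := -(β • (M k ω - g k (z k ω)))) (b := N k ω)
        (c := g k (z' k ω) - g k (z k ω))
      rw [e]
      rw [norm_neg, norm_smul, Real.norm_eq_abs, abs_of_nonneg hβ] at h4
      set a := β * ‖M k ω - g k (z k ω)‖ with ha
      set b := ‖N k ω‖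
      set c := ‖g k (z' k ω) - g k (z k ω)‖
      have h5 := pow_le_pow_left₀ (norm_nonneg _) h4 2
      have h6 : β ^ 2 * ‖M k ω - g k (z k ω)‖ ^ 2 = a ^ 2 := by rw [ha]; ring
      nlinarith [sq_nonneg (a - b), sq_nonneg (b - c), sq_nonneg (a - c)]
    have i1 : Integrable (fun ω => 3 * β ^ 2 * ‖M k ω - g k (z k ω)‖ ^ 2) Pr := h1.const_mul _
    have i2 : Integrable (fun ω => 3 * ‖N k ω‖ ^ 2) Pr := h2.const_mul _
    have i3 : Integrable (fun ω => 3 * q (z' k ω) (z k ω)) Pr := (hq k).const_mul _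
    have i4 : Integrable (fun ω => 3 * β ^ 2 * ‖M k ω - g k (z k ω)‖ ^ 2 + 3 * ‖N k ω‖ ^ 2) Pr :=
      i1.add i2
    calc ∫ ω, ‖M' k ω - M k ω‖ ^ 2 ∂Pr
        ≤ ∫ ω, (3 * β ^ 2 * ‖M k ω - g k (z k ω)‖ ^ 2
          + 3 * ‖N k ω‖ ^ 2 + 3 * q (z' k ω) (z k ω)) ∂Pr :=
          integral_mono_of_nonneg (Filter.Eventually.of_forall fun _ => sq_nonneg _) (i4.add i3)
            (Filter.Eventually.of_forall hle)
      _ = 3 * β ^ 2 * ∫ ω, ‖M k ω - g k (z k ω)‖ ^ 2 ∂Pr + 3 * ∫ ω, ‖N k ω‖ ^ 2 ∂Pr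
          + 3 * ∫ ω, q (z' k ω) (z k ω) ∂Pr := by
          rw [integral_add i4 i3, integral_add i1 i2, integral_const_mul, integral_const_mul,
            integral_const_mul]
      _ ≤ _ := by
          have := hNb k
          linarith

end Storm

/-! ### Combining the recursions -/

theorem sum_le_of_contraction {β : ℝ} {u c : ℕ → ℝ} (h0 : ∀ i, 0 ≤ u i)
    (h : ∀ i, u (i + 1) ≤ (1 - β) * u i + c i) (T : ℕ) :
    β * ∑ i ∈ Finset.range T, u i ≤ u 0 + ∑ i ∈ Finset.range T, c i := by
  have key : β * ∑ i ∈ Finset.range T, u i + u T ≤ u 0 + ∑ i ∈ Finset.range T, c i := by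
    induction T with
    | zero => simp
    | succ T ih =>
      rw [Finset.sum_range_succ, Finset.sum_range_succ, mul_add]
      have := h T
      linarith
  have := h0 T
  linarith

/-- The expected error quantities of a run: `V` and `S` are the mean-square errors of the averaged
and of the individual gradient estimates, `Dl` and `Θ` the squared increments of the iterates and of
the estimates, `c` the consensus error, `A` the error of the averaged estimates at the centroid,
`qx`, `qy` their squared norms, and `gx`, `gy` the squared gradient norms. -/
structure ErrorRecursion (K b n₀ T : ℕ) (L μx μy β lam s2 Z G : ℝ)
    (V S Dl Θ c A qx qy gx gy : ℕ → ℝ) : Prop where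
  V_nonneg : ∀ i, 0 ≤ V i
  S_nonneg : ∀ i, 0 ≤ S i
  c_nonneg : ∀ i, 0 ≤ c i
  qx_nonneg : ∀ i, 0 ≤ qx i
  qy_nonneg : ∀ i, 0 ≤ qy i
  gy_nonneg : ∀ i, 0 ≤ gy i
  V_zero : V 0 ≤ 2 * s2 / (K * n₀)
  V_succ : ∀ i, V (i + 1) ≤ (1 - β) * V i
    + (16 * L ^ 2 / (K ^ 2 * b) * Dl i + 4 * β ^ 2 * s2 / (K * b))
  S_zero : S 0 ≤ 2 * K * s2 / n₀
  S_succ : ∀ i, S (i + 1) ≤ (1 - β) * S i + (16 * L ^ 2 / b * Dl i + 4 * K * β ^ 2 * s2 / b)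
  Θ_le : ∀ i, Θ i ≤ 3 * β ^ 2 * S i
    + (3 * (16 * L ^ 2 / b * Dl i + 4 * K * β ^ 2 * s2 / b) + 6 * L ^ 2 * Dl i)
  c_le : ∑ i ∈ Finset.range (T + 1), c i ≤ 2 * μy ^ 2 * K * Z / (1 - lam) ^ 2
    + lam ^ 2 * μy ^ 2 / ((1 - √lam) ^ 2 * (1 - lam)) * ∑ j ∈ Finset.range T, Θ j
  Dl_le : ∀ i, Dl i ≤ K * (μx ^ 2 * qx i + μy ^ 2 * qy i) + 2 * (c i + c (i + 1))
  A_le : ∀ i, A i ≤ 2 * V i + 4 * L ^ 2 / K * c i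
  gx_le : ∀ i, gx i ≤ 2 * qx i + 2 * A i
  descent : ∑ i ∈ Finset.range T, (μx / 8 * qx i + μy / 64 * (gy i + qy i))
    ≤ G + 2 * μy * ∑ i ∈ Finset.range T, A i

set_option maxHeartbeats 2000000 in
/-- Solving the coupled recursions: under the step size conditions every cyclic dependence carries a
small factor and is absorbed. -/
theorem ErrorRecursion.sum_grad_le {K b n₀ T : ℕ} {L μx μy β lam s2 Z G : ℝ}
    {V S Dl Θ c A qx qy gx gy : ℕ → ℝ}
    (h : ErrorRecursion K b n₀ T L μx μy β lam s2 Z G V S Dl Θ c A qx qy gx gy)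
    (hK : 1 ≤ K) (hb : 1 ≤ b) (hn : 1 ≤ n₀) (hμx : 0 < μx) (hμy : 0 < μy)
    (hxy : μx ≤ μy) (hβ : 0 < β) (hβ1 : β ≤ 1) (hlam1 : lam < 1)
    (hs2 : 0 ≤ s2) (hZ : 0 ≤ Z) (hG : 0 ≤ G)
    (hnet : L ^ 2 * (lam ^ 2 * μy ^ 2 / ((1 - √lam) ^ 2 * (1 - lam))) ≤ 1 / 1000000)
    (hyb : L ^ 2 * μy ^ 2 ≤ 1 / 1000000 * (K * b * β))
    (hxb : L ^ 2 * (μx * μy) ≤ 1 / 1000000 * (K * b * β)) (hR1 : K * b * β ≤ 1) :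
    μx * ∑ i ∈ Finset.range T, (gx i + gy i) ≤ 1000 * G
      + 10000 * μy * (s2 / (K * n₀ * β) + T * β * s2 / (K * b) + Z / (1 - lam) ^ 2) := by
  have hK' : (1 : ℝ) ≤ K := by exact_mod_cast hK
  have hb' : (1 : ℝ) ≤ b := by exact_mod_cast hb
  have hn' : (1 : ℝ) ≤ n₀ := by exact_mod_cast hn
  have hK0 : (0 : ℝ) < K := by linarith
  have hb0 : (0 : ℝ) < b := by linarith
  have hn0 : (0 : ℝ) < n₀ := by linarith
  have hlam : 0 < 1 - lam := by linarith
  set Γ : ℝ := lam ^ 2 * μy ^ 2 / ((1 - √lam) ^ 2 * (1 - lam)) with hΓ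
  have hΓ0 : 0 ≤ Γ := by positivity
  set R : ℝ := K * b * β with hR
  have hR0 : 0 < R := by positivity
  set sD := ∑ i ∈ Finset.range T, Dl i
  set sA := ∑ i ∈ Finset.range T, A i
  set sV := ∑ i ∈ Finset.range T, V i
  set sS := ∑ i ∈ Finset.range T, S i
  set sT := ∑ i ∈ Finset.range T, Θ i
  set H := ∑ i ∈ Finset.range (T + 1), c i with hH
  set Qx := ∑ i ∈ Finset.range T, qx i
  set Qy := ∑ i ∈ Finset.range T, qy i
  set Gy := ∑ i ∈ Finset.range T, gy i
  have hQx0 : 0 ≤ Qx := Finset.sum_nonneg fun i _ => h.qx_nonneg i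
  have hQy0 : 0 ≤ Qy := Finset.sum_nonneg fun i _ => h.qy_nonneg i
  have hGy0 : 0 ≤ Gy := Finset.sum_nonneg fun i _ => h.gy_nonneg i
  have hH0 : 0 ≤ H := Finset.sum_nonneg fun i _ => h.c_nonneg i
  set N := μx ^ 2 * Qx + μy ^ 2 * Qy with hN
  have hN0 : 0 ≤ N := by positivity
  set p := β * K * s2 / n₀ with hp
  set r := T * K * β ^ 2 * s2 / b with hr
  have hp0 : 0 ≤ p := by positivity
  have hr0 : 0 ≤ r := by positivity
  -- increments of the iterates
  have hc1 : ∑ i ∈ Finset.range T, c i ≤ H := by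
    rw [hH, Finset.sum_range_succ]
    linarith [h.c_nonneg T]
  have hc2 : ∑ i ∈ Finset.range T, c (i + 1) ≤ H := by
    rw [hH, Finset.sum_range_succ']
    linarith [h.c_nonneg 0]
  have hsD : sD ≤ K * N + 4 * H := by
    calc sD ≤ ∑ i ∈ Finset.range T, (K * (μx ^ 2 * qx i + μy ^ 2 * qy i) + 2 * (c i + c (i + 1))) :=
          Finset.sum_le_sum fun i _ => h.Dl_le i
      _ = K * N + 2 * (∑ i ∈ Finset.range T, c i + ∑ i ∈ Finset.range T, c (i + 1)) := by
          rw [hN, Finset.sum_add_distrib, ← Finset.mul_sum, ← Finset.mul_sum,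
            Finset.sum_add_distrib, Finset.sum_add_distrib, ← Finset.mul_sum, ← Finset.mul_sum]
      _ ≤ _ := by linarith
  -- errors of the individual estimates
  have hsS : β * sS ≤ 2 * K * s2 / n₀ + (16 * L ^ 2 / b * sD + T * (4 * K * β ^ 2 * s2 / b)) := by
    have h1 := sum_le_of_contraction h.S_nonneg h.S_succ T
    rw [Finset.sum_add_distrib, ← Finset.mul_sum, Finset.sum_const, Finset.card_range,
      nsmul_eq_mul] at h1
    linarith [h.S_zero]
  have hLb : 0 ≤ L ^ 2 * (K * N + 4 * H) := by positivity
  have hLD : L ^ 2 * sD ≤ L ^ 2 * (K * N + 4 * H) :=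
    mul_le_mul_of_nonneg_left hsD (sq_nonneg L)
  have hLDb : L ^ 2 / b * sD ≤ L ^ 2 * (K * N + 4 * H) := by
    calc L ^ 2 / b * sD ≤ L ^ 2 / b * (K * N + 4 * H) :=
          mul_le_mul_of_nonneg_left hsD (by positivity)
      _ = L ^ 2 * (K * N + 4 * H) / b := by ring
      _ ≤ _ := div_le_self hLb hb'
  have hsT : sT ≤ 6 * p + 24 * r + 102 * (L ^ 2 * (K * N + 4 * H)) := by
    have h1 : sT ≤ 3 * β * (β * sS) + (3 * (16 * (L ^ 2 / b * sD) + 4 * r) + 6 * (L ^ 2 * sD)) := by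
      calc sT ≤ ∑ i ∈ Finset.range T, (3 * β ^ 2 * S i
            + (3 * (16 * L ^ 2 / b * Dl i + 4 * K * β ^ 2 * s2 / b) + 6 * L ^ 2 * Dl i)) :=
            Finset.sum_le_sum fun i _ => h.Θ_le i
        _ = _ := by
          simp only [Finset.sum_add_distrib, ← Finset.mul_sum, Finset.sum_const,
            Finset.card_range, nsmul_eq_mul]
          rw [hr]; ring
    have h2 : 3 * β * (β * sS) ≤ 3 * β * (2 * K * s2 / n₀
        + (16 * L ^ 2 / b * sD + T * (4 * K * β ^ 2 * s2 / b))) :=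
      mul_le_mul_of_nonneg_left hsS (by positivity)
    have h3 : 3 * β * (2 * K * s2 / n₀ + (16 * L ^ 2 / b * sD + T * (4 * K * β ^ 2 * s2 / b)))
        = 6 * p + 48 * (β * (L ^ 2 / b * sD)) + 12 * (β * r) := by
      rw [hp, hr]; ring
    have h4 : β * (L ^ 2 / b * sD) ≤ L ^ 2 * (K * N + 4 * H) :=
      (mul_le_mul_of_nonneg_left hLDb hβ.le).trans (mul_le_of_le_one_left hLb hβ1)
    have h5 : β * r ≤ r := mul_le_of_le_one_left hr0 hβ1
    linarith
  -- consensus error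
  set zq := Z / (1 - lam) ^ 2 with hzq
  have hzq0 : 0 ≤ zq := by positivity
  set H₀ := 4 * (μy ^ 2 * K * zq) + Γ * (12 * p + 48 * r) with hH₀
  have hH₀0 : 0 ≤ H₀ := by positivity
  have hHle : H ≤ H₀ + K * N := by
    have h1 : H ≤ 2 * (μy ^ 2 * K * zq) + Γ * sT := by
      have := h.c_le
      have e : 2 * μy ^ 2 * K * Z / (1 - lam) ^ 2 = 2 * (μy ^ 2 * K * zq) := by rw [hzq]; ring
      linarith
    have h2 : Γ * sT ≤ Γ * (6 * p + 24 * r) + 102 * (L ^ 2 * Γ * (K * N + 4 * H)) := by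
      have := mul_le_mul_of_nonneg_left hsT hΓ0
      linarith
    have h3 : L ^ 2 * Γ * (K * N + 4 * H) ≤ 1 / 1000000 * (K * N + 4 * H) :=
      mul_le_mul_of_nonneg_right hnet (by positivity)
    have h4 : 0 ≤ K * N := by positivity
    rw [hH₀]
    linarith
  -- errors of the averaged estimates
  set P₁ := s2 / (K * n₀ * β) with hP₁
  set P₂ := T * β * s2 / (K * b) with hP₂
  have hP₁0 : 0 ≤ P₁ := by positivity
  have hP₂0 : 0 ≤ P₂ := by positivity
  set F := L ^ 2 * N / R with hF
  set Y := L ^ 2 * H₀ / (K * R) with hY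
  have hF0 : 0 ≤ F := by positivity
  have hY0 : 0 ≤ Y := by positivity
  have hsV : sV ≤ 2 * P₁ + 80 * F + 64 * Y + 4 * P₂ := by
    have h1 := sum_le_of_contraction h.V_nonneg h.V_succ T
    rw [Finset.sum_add_distrib, ← Finset.mul_sum, Finset.sum_const, Finset.card_range,
      nsmul_eq_mul] at h1
    have h2 : 16 * L ^ 2 / (K ^ 2 * b) * sD ≤ 16 * L ^ 2 / (K ^ 2 * b) * (5 * (K * N) + 4 * H₀) :=
      mul_le_mul_of_nonneg_left (by linarith) (by positivity)
    have h3 : β * sV ≤ β * (2 * P₁ + 80 * F + 64 * Y + 4 * P₂) := by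
      have e : β * (2 * P₁ + 80 * F + 64 * Y + 4 * P₂) = 2 * s2 / (K * n₀)
          + (16 * L ^ 2 / (K ^ 2 * b) * (5 * (K * N) + 4 * H₀)
            + T * (4 * β ^ 2 * s2 / (K * b))) := by
        rw [hP₁, hF, hY, hP₂, hR]
        field_simp
        ring
      rw [e]
      linarith [h.V_zero]
    exact le_of_mul_le_mul_left h3 hβ
  have hLN : L ^ 2 * N ≤ F := le_div_self (by positivity) hR0 hR1
  have hLH : L ^ 2 / K * H₀ ≤ Y := by
    have e : Y = L ^ 2 / K * H₀ / R := by rw [hY]; field_simp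
    rw [e]
    exact le_div_self (by positivity) hR0 hR1
  have hYle : Y ≤ 1 / 1000000 * (4 * zq + 12 * P₁ + 48 * P₂) := by
    have e : Y = 4 * (L ^ 2 * μy ^ 2 / R * zq) + L ^ 2 * Γ * (12 * (p / (K * R)) + 48 * (r / (K * R))) := by
      rw [hY, hH₀]
      field_simp
    have h1 : L ^ 2 * μy ^ 2 / R ≤ 1 / 1000000 := by rwa [div_le_iff₀ hR0]
    have h2 : p / (K * R) ≤ P₁ := by
      have e2 : p / (K * R) = β * P₁ / b := by rw [hp, hP₁, hR]; field_simp
      rw [e2, div_le_iff₀ hb0]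
      nlinarith
    have h3 : r / (K * R) ≤ P₂ := by
      have e2 : r / (K * R) = P₂ / b := by rw [hr, hP₂, hR]; field_simp
      rw [e2]
      exact div_le_self hP₂0 hb'
    have h4 : L ^ 2 * μy ^ 2 / R * zq ≤ 1 / 1000000 * zq := mul_le_mul_of_nonneg_right h1 hzq0
    have h5 : L ^ 2 * Γ * (12 * (p / (K * R)) + 48 * (r / (K * R)))
        ≤ 1 / 1000000 * (12 * P₁ + 48 * P₂) := by
      refine mul_le_mul hnet (by linarith) (by positivity) (by norm_num)
    rw [e]
    linarith
  have hsA : sA ≤ 5 * P₁ + 9 * P₂ + zq + 164 * F := by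
    have h1 : sA ≤ 2 * sV + 4 * (L ^ 2 / K * H) := by
      calc sA ≤ ∑ i ∈ Finset.range T, (2 * V i + 4 * L ^ 2 / K * c i) :=
            Finset.sum_le_sum fun i _ => h.A_le i
        _ = 2 * sV + 4 * (L ^ 2 / K * ∑ i ∈ Finset.range T, c i) := by
            rw [Finset.sum_add_distrib, ← Finset.mul_sum, ← Finset.mul_sum]; ring
        _ ≤ _ := by gcongr
    have h2 : L ^ 2 / K * H ≤ L ^ 2 / K * H₀ + L ^ 2 * N := by
      calc L ^ 2 / K * H ≤ L ^ 2 / K * (H₀ + K * N) := by gcongr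
        _ = _ := by field_simp
    linarith
  -- the remaining feedback through the estimates themselves
  have hμF : μy * F ≤ 1 / 1000000 * (μx * Qx + μy * Qy) := by
    have e : μy * F = L ^ 2 * (μx * μy) / R * (μx * Qx) + L ^ 2 * μy ^ 2 / R * (μy * Qy) := by
      rw [hF, hN]; field_simp
    have h1 : L ^ 2 * μy ^ 2 / R ≤ 1 / 1000000 := by rwa [div_le_iff₀ hR0]
    have h2 : L ^ 2 * (μx * μy) / R ≤ 1 / 1000000 := by rwa [div_le_iff₀ hR0]
    have h3 := mul_le_mul_of_nonneg_right h1 (show 0 ≤ μy * Qy by positivity)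
    have h4 := mul_le_mul_of_nonneg_right h2 (show 0 ≤ μx * Qx by positivity)
    rw [e]; linarith
  have hμA : μy * sA ≤ 9 * (μy * (P₁ + P₂ + zq)) + 164 * (1 / 1000000 * (μx * Qx + μy * Qy)) := by
    have h1 := mul_le_mul_of_nonneg_left hsA hμy.le
    have h2 : 0 ≤ μy * P₁ := by positivity
    have h3 : 0 ≤ μy * zq := by positivity
    linarith
  have hdesc : μx / 8 * Qx + μy / 64 * (Gy + Qy) ≤ G + 2 * μy * sA := by
    have := h.descent
    rwa [Finset.sum_add_distrib, ← Finset.mul_sum, ← Finset.mul_sum, Finset.sum_add_distrib] at this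
  set W := μy * (P₁ + P₂ + zq) with hW
  have hW0 : 0 ≤ W := by positivity
  have q1 : 0 ≤ μx * Qx := by positivity
  have q2 : 0 ≤ μy * Qy := by positivity
  have q3 : 0 ≤ μy * Gy := by positivity
  have hfin : μx * Qx + μy * (Gy + Qy) ≤ 128 * (G + 18 * W) := by linarith
  have hgrad : ∑ i ∈ Finset.range T, (gx i + gy i) ≤ 2 * Qx + 2 * sA + Gy := by
    calc ∑ i ∈ Finset.range T, (gx i + gy i)
        ≤ ∑ i ∈ Finset.range T, (2 * qx i + 2 * A i + gy i) :=
          Finset.sum_le_sum fun i _ => by linarith [h.gx_le i]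
      _ = _ := by
          rw [Finset.sum_add_distrib, Finset.sum_add_distrib, ← Finset.mul_sum, ← Finset.mul_sum]
  have h1 : μx * ∑ i ∈ Finset.range T, (gx i + gy i)
      ≤ 2 * (μx * Qx) + 2 * (μx * sA) + μx * Gy := by
    have := mul_le_mul_of_nonneg_left hgrad hμx.le
    linarith
  have h2 : μx * Gy ≤ μy * Gy := mul_le_mul_of_nonneg_right hxy hGy0
  have h3 : μx * sA ≤ μy * (5 * P₁ + 9 * P₂ + zq + 164 * F) :=
    (mul_le_mul_of_nonneg_left hsA hμx.le).trans
      (mul_le_mul_of_nonneg_right hxy (by positivity))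
  have h4 : μy * (5 * P₁ + 9 * P₂ + zq + 164 * F) ≤ 9 * W + 164 * (μy * F) := by
    have h2 : 0 ≤ μy * P₁ := by positivity
    have h3 : 0 ≤ μy * zq := by positivity
    rw [hW]; linarith
  have e : 10000 * μy * (P₁ + P₂ + zq) = 10000 * W := by rw [hW]; ring
  rw [e]
  linarith

/-! ### The risks of a regular problem -/

section PartialGradients

variable {E F : Type*} [NormedAddCommGroup E] [InnerProductSpace ℝ E] [CompleteSpace E]
  [NormedAddCommGroup F] [InnerProductSpace ℝ F] [CompleteSpace F]

/-- The derivative of a differentiable function of two variables through its partial gradients. -/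
theorem hasFDerivAt_of_partial_gradient {f : E × F → ℝ} {x : E} {y : F}
    (hf : DifferentiableAt ℝ f (x, y)) :
    HasFDerivAt f ((innerSL ℝ (gradient (fun u => f (u, y)) x)).coprod
      (innerSL ℝ (gradient (fun v => f (x, v)) y))) (x, y) := by
  have hx : HasFDerivAt (fun u => f (u, y)) ((fderiv ℝ f (x, y)).comp (.inl ℝ E F)) x :=
    hf.hasFDerivAt.comp x (hasFDerivAt_prodMk_left x y)
  have hy : HasFDerivAt (fun v => f (x, v)) ((fderiv ℝ f (x, y)).comp (.inr ℝ E F)) y :=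
    hf.hasFDerivAt.comp y (hasFDerivAt_prodMk_right x y)
  convert hf.hasFDerivAt using 1
  ext1
  · ext u
    simp [gradient, hx.fderiv]
  · ext v
    simp [gradient, hy.fderiv]

end PartialGradients

namespace Problem

variable {K d₁ d₂ : ℕ} {Ξ : Type*} [MeasurableSpace Ξ] {Q : Problem K d₁ d₂ Ξ}

/-- The scaled squared distance that bounds the mean-square variation of the sample gradients. -/
noncomputable def gradVar (L : ℝ) (z z' : Vec d₁ × Vec d₂) : ℝ :=
  L ^ 2 * (‖z.1 - z'.1‖ ^ 2 + ‖z.2 - z'.2‖ ^ 2)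

theorem gradVar_nonneg (L : ℝ) (z z' : Vec d₁ × Vec d₂) : 0 ≤ gradVar L z z' := by
  unfold gradVar; positivity

theorem Regular.isNoisyGradientX (hR : Q.Regular) {L σ : ℝ} (hS : Q.ExpectedSmooth L)
    (hN : Q.GradientNoise σ) :
    IsNoisyGradient Q.law (fun k (z : Vec d₁ × Vec d₂) ζ => Q.lossGradX k z.1 z.2 ζ)
      (fun k z => Q.localGradX k z.1 z.2) (gradVar L) σ where
  prob := hR.law_prob
  meas := hR.lossGradX_meas
  meas_mean k := by
    have := hR.law_prob k
    have h : StronglyMeasurable (Function.uncurry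
        fun (z : Vec d₁ × Vec d₂) ζ => Q.lossGradX k z.1 z.2 ζ) :=
      (hR.lossGradX_meas k).stronglyMeasurable
    have := (h.integral_prod_right (ν := Q.law k)).measurable
    simpa only [hN.unbiasedX] using this
  mean k z := hN.unbiasedX k z.1 z.2
  q_nonneg := gradVar_nonneg L
  smooth k z z' := hS.gradX k z.1 z.2 z'.1 z'.2
  var k z := hN.varianceX k z.1 z.2

theorem Regular.isNoisyGradientY (hR : Q.Regular) {L σ : ℝ} (hS : Q.ExpectedSmooth L)
    (hN : Q.GradientNoise σ) :
    IsNoisyGradient Q.law (fun k (z : Vec d₁ × Vec d₂) ζ => Q.lossGradY k z.1 z.2 ζ)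
      (fun k z => Q.localGradY k z.1 z.2) (gradVar L) σ where
  prob := hR.law_prob
  meas := hR.lossGradY_meas
  meas_mean k := by
    have := hR.law_prob k
    have h : StronglyMeasurable (Function.uncurry
        fun (z : Vec d₁ × Vec d₂) ζ => Q.lossGradY k z.1 z.2 ζ) :=
      (hR.lossGradY_meas k).stronglyMeasurable
    have := (h.integral_prod_right (ν := Q.law k)).measurable
    simpa only [hN.unbiasedY] using this
  mean k z := hN.unbiasedY k z.1 z.2
  q_nonneg := gradVar_nonneg L
  smooth k z z' := hS.gradY k z.1 z.2 z'.1 z'.2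
  var k z := hN.varianceY k z.1 z.2

theorem Regular.hasFDerivAt_cost (hR : Q.Regular) (x : Vec d₁) (y : Vec d₂) :
    HasFDerivAt (fun p : Vec d₁ × Vec d₂ => Q.cost p.1 p.2)
      ((innerSL ℝ (centroid fun k => Q.localGradX k x y)).coprod
        (innerSL ℝ (centroid fun k => Q.localGradY k x y))) (x, y) := by
  have h : HasFDerivAt (fun p : Vec d₁ × Vec d₂ => Q.cost p.1 p.2) ((1 / (K : ℝ)) • ∑ k,
      ((innerSL ℝ (Q.localGradX k x y)).coprod (innerSL ℝ (Q.localGradY k x y)))) (x, y) :=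
    (HasFDerivAt.fun_sum (u := Finset.univ) fun k _ =>
      hasFDerivAt_of_partial_gradient ((hR.localCost_diff k) (x, y))).const_mul (1 / (K : ℝ))
  refine h.congr_fderiv ?_
  refine ContinuousLinearMap.ext fun p => ?_
  simp [centroid, sum_apply, Finset.sum_add_distrib, mul_add]

theorem Regular.costGradX_eq (hR : Q.Regular) (x : Vec d₁) (y : Vec d₂) :
    Q.costGradX x y = centroid fun k => Q.localGradX k x y := by
  have h : HasFDerivAt (fun u => Q.cost u y) _ x :=
    HasFDerivAt.comp (f := fun u : Vec d₁ => (u, y)) x (hR.hasFDerivAt_cost x y)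
      (hasFDerivAt_prodMk_left x y)
  have h2 : HasFDerivAt (fun u => Q.cost u y)
      (InnerProductSpace.toDual ℝ _ (centroid fun k => Q.localGradX k x y)) x := by
    refine h.congr_fderiv (ContinuousLinearMap.ext fun u => ?_)
    simp
  exact (hasGradientAt_iff_hasFDerivAt.2 h2).gradient

theorem Regular.costGradY_eq (hR : Q.Regular) (x : Vec d₁) (y : Vec d₂) :
    Q.costGradY x y = centroid fun k => Q.localGradY k x y := by
  have h : HasFDerivAt (fun v => Q.cost x v) _ y :=
    HasFDerivAt.comp (f := fun v : Vec d₂ => (x, v)) y (hR.hasFDerivAt_cost x y)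
      (hasFDerivAt_prodMk_right x y)
  have h2 : HasFDerivAt (fun v => Q.cost x v)
      (InnerProductSpace.toDual ℝ _ (centroid fun k => Q.localGradY k x y)) y := by
    refine h.congr_fderiv (ContinuousLinearMap.ext fun u => ?_)
    simp
  exact (hasGradientAt_iff_hasFDerivAt.2 h2).gradient

theorem norm_sq_centroid_sub_le {d : ℕ} (hK : 1 ≤ K) {c : ℝ} {X Y : Block K d}
    (h : ∀ k, ‖X k - Y k‖ ^ 2 ≤ c) : ‖centroid X - centroid Y‖ ^ 2 ≤ c := by
  have hK' : (0 : ℝ) < K := by exact_mod_cast hK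
  have e : centroid X - centroid Y = centroid (X - Y) := by
    simp [centroid, smul_sub]
  have h1 := norm_sq_centroid_le (X - Y)
  have h2 : blockNormSq (X - Y) ≤ K * c := by
    calc blockNormSq (X - Y) ≤ ∑ _k : Fin K, c := Finset.sum_le_sum fun k _ => h k
      _ = K * c := by simp
  rw [e]
  exact le_of_mul_le_mul_left (h1.trans h2) hK'

theorem Regular.cost_le_primal (hR : Q.Regular) (x : Vec d₁) (y : Vec d₂) :
    Q.cost x y ≤ Q.primal x := by
  obtain ⟨yo, hyo⟩ := hR.max_attained x
  exact le_ciSup (f := fun y => Q.cost x y) ⟨Q.cost x yo, by rintro _ ⟨y, rfl⟩; exact hyo y⟩ y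

theorem PLCondition.primalInf_le {ν : ℝ} (hP : Q.PLCondition ν) (x : Vec d₁) :
    Q.primalInf ≤ Q.primal x := ciInf_le hP.primal_bddBelow x

theorem Regular.smoothPL (hR : Q.Regular) (hK : 1 ≤ K) {L σ ν : ℝ} (hν : 0 < ν) (hνL : ν ≤ L)
    (hP : Q.PLCondition ν) (hS : Q.ExpectedSmooth L) (hN : Q.GradientNoise σ) :
    SmoothPL Q.cost Q.costGradX Q.costGradY Q.primal L ν where
  ν_pos := hν
  ν_le := hνL
  hasFDerivAt x y := by
    rw [hR.costGradX_eq, hR.costGradY_eq]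
    exact hR.hasFDerivAt_cost x y
  lipX x y x' y' := by
    rw [hR.costGradX_eq, hR.costGradX_eq]
    exact norm_sq_centroid_sub_le hK fun k =>
      (hR.isNoisyGradientX hS hN).norm_sq_mean_sub_le k (x, y) (x', y')
  lipY x y x' y' := by
    rw [hR.costGradY_eq, hR.costGradY_eq]
    exact norm_sq_centroid_sub_le hK fun k =>
      (hR.isNoisyGradientY hS hN).norm_sq_mean_sub_le k (x, y) (x', y')
  le_max := hR.cost_le_primal
  pl := hP.pl

end Problem

/-- A mean gradient evaluated at a square-integrable random point is square integrable. -/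
theorem IsNoisyGradient.memLp_mean {K : ℕ} {Z Ξ E Ω : Type*} [MeasurableSpace Z]
    [MeasurableSpace Ξ] [NormedAddCommGroup E] [InnerProductSpace ℝ E] [CompleteSpace E]
    [MeasurableSpace E] [BorelSpace E] [SecondCountableTopology E] {law : Fin K → Measure Ξ}
    {G : Fin K → Z → Ξ → E} {g : Fin K → Z → E} {q : Z → Z → ℝ} {σ : ℝ}
    (h : IsNoisyGradient law G g q σ)
    [MeasurableSpace Ω] {Pr : Measure Ω} [IsFiniteMeasure Pr] {z : Ω → Z} (hz : Measurable z)
    (z₀ : Z) (hq : Integrable (fun ω => q (z ω) z₀) Pr) (k : Fin K) :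
    MemLp (fun ω => g k (z ω)) 2 Pr := by
  have hm : Measurable fun ω => g k (z ω) := (h.meas_mean k).comp hz
  have h1 : MemLp (fun ω => g k (z ω) - g k z₀) 2 Pr := by
    have hm' : AEStronglyMeasurable (fun ω => g k (z ω) - g k z₀) Pr :=
      (hm.sub_const _).aestronglyMeasurable
    refine (memLp_two_iff_integrable_sq_norm hm').2 (hq.mono' (hm'.norm.pow 2) ?_)
    refine Filter.Eventually.of_forall fun ω => ?_
    rw [Real.norm_eq_abs, abs_of_nonneg (sq_nonneg _)]
    exact h.norm_sq_mean_sub_le k _ _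
  have h2 := h1.add (memLp_const (g k z₀))
  refine (memLp_congr_ae (Filter.Eventually.of_forall fun ω => ?_)).1 h2
  simp

/-! ### Square-integrable block vectors -/

section BlockL2

variable {K d : ℕ} {Ω : Type*}

theorem measurable_blockMul {m : MeasurableSpace Ω} (A : Matrix (Fin K) (Fin K) ℝ)
    {X : Ω → Block K d} (hX : ∀ k, Measurable[m] fun ω => X ω k) (k : Fin K) :
    Measurable[m] fun ω => blockMul A (X ω) k :=
  Finset.measurable_sum _ fun l _ => (hX l).const_smul (A k l)

variable [MeasurableSpace Ω] {Pr : Measure Ω}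

/-- All blocks of a random block vector are square integrable. -/
def BlockL2 (Pr : Measure Ω) (X : Ω → Block K d) : Prop := ∀ k, MemLp (fun ω => X ω k) 2 Pr

variable {X Y : Ω → Block K d}

theorem BlockL2.add (hX : BlockL2 Pr X) (hY : BlockL2 Pr Y) : BlockL2 Pr fun ω => X ω + Y ω :=
  fun k => (hX k).add (hY k)

theorem BlockL2.sub (hX : BlockL2 Pr X) (hY : BlockL2 Pr Y) : BlockL2 Pr fun ω => X ω - Y ω :=
  fun k => (hX k).sub (hY k)

theorem BlockL2.smul (hX : BlockL2 Pr X) (c : ℝ) : BlockL2 Pr fun ω => c • X ω :=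
  fun k => (hX k).const_smul c

theorem BlockL2.blockMul (hX : BlockL2 Pr X) (A : Matrix (Fin K) (Fin K) ℝ) :
    BlockL2 Pr fun ω => DAMA.blockMul A (X ω) :=
  fun k => memLp_finsetSum _ fun l _ => (hX l).const_smul (A k l)

theorem BlockL2.centroid (hX : BlockL2 Pr X) : MemLp (fun ω => DAMA.centroid (X ω)) 2 Pr := by
  have h : MemLp (fun ω => ∑ k, X ω k) 2 Pr := memLp_finsetSum _ fun k _ => hX k
  exact h.const_smul (1 / (K : ℝ))

theorem BlockL2.deviation (hX : BlockL2 Pr X) : BlockL2 Pr fun ω => DAMA.deviation (X ω) :=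
  fun k => (hX k).sub hX.centroid

theorem BlockL2.integrable (hX : BlockL2 Pr X) : Integrable (fun ω => blockNormSq (X ω)) Pr :=
  integrable_finsetSum _ fun k _ => integrable_norm_sq (hX k)

theorem BlockL2.integral_eq (hX : BlockL2 Pr X) :
    ∫ ω, blockNormSq (X ω) ∂Pr = ∑ k, ∫ ω, ‖X ω k‖ ^ 2 ∂Pr :=
  integral_finsetSum _ fun k _ => integrable_norm_sq (hX k)

theorem integrable_gradVar {d₁ d₂ : ℕ} (L : ℝ) {x x' : Ω → Vec d₁} {y y' : Ω → Vec d₂}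
    (hx : MemLp x 2 Pr) (hx' : MemLp x' 2 Pr) (hy : MemLp y 2 Pr) (hy' : MemLp y' 2 Pr) :
    Integrable (fun ω => Problem.gradVar L (x ω, y ω) (x' ω, y' ω)) Pr :=
  ((integrable_norm_sq (hx.sub hx')).add (integrable_norm_sq (hy.sub hy'))).const_mul _

theorem sum_integral_gradVar {d₁ d₂ : ℕ} (L : ℝ) {X X' : Ω → Block K d₁} {Y Y' : Ω → Block K d₂}
    (hX : BlockL2 Pr X) (hX' : BlockL2 Pr X') (hY : BlockL2 Pr Y) (hY' : BlockL2 Pr Y') :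
    ∑ k, ∫ ω, Problem.gradVar L (X ω k, Y ω k) (X' ω k, Y' ω k) ∂Pr
      = L ^ 2 * (∫ ω, blockNormSq (X ω - X' ω) ∂Pr + ∫ ω, blockNormSq (Y ω - Y' ω) ∂Pr) := by
  rw [(hX.sub hX').integral_eq, (hY.sub hY').integral_eq, ← Finset.sum_add_distrib,
    Finset.mul_sum]
  refine Finset.sum_congr rfl fun k _ => ?_
  simp only [Problem.gradVar]
  have i1 : Integrable (fun ω => ‖X ω k - X' ω k‖ ^ 2) Pr :=
    integrable_norm_sq ((hX k).sub (hX' k))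
  have i2 : Integrable (fun ω => ‖Y ω k - Y' ω k‖ ^ 2) Pr :=
    integrable_norm_sq ((hY k).sub (hY' k))
  rw [integral_const_mul, integral_add i1 i2]
  simp

theorem blockNormSq_sub_le (X Y : Block K d) :
    blockNormSq (X - Y) ≤ 2 * blockNormSq X + 2 * blockNormSq Y := by
  simp only [blockNormSq, Finset.mul_sum, ← Finset.sum_add_distrib]
  exact Finset.sum_le_sum fun k _ => norm_sub_sq_le _ _

theorem deviation_sub (X Y : Block K d) : deviation (X - Y) = deviation X - deviation Y := by
  funext k
  simp [deviation, centroid, smul_sub]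
  abel

/-- One exact-diffusion step moves the blocks by the averaged direction and by consensus errors. -/
theorem IsExactDiffusion.blockNormSq_step_le {W : Matrix (Fin K) (Fin K) ℝ} {μ : ℝ}
    {X D M : ℕ → Block K d} (h : IsExactDiffusion W μ X D M) (hW : IsCombination W) (i : ℕ) :
    blockNormSq (X (i + 1) - X i) ≤ K * (μ ^ 2 * ‖centroid (M i)‖ ^ 2)
      + 2 * (blockNormSq (deviation (X i)) + blockNormSq (deviation (X (i + 1)))) := by
  have h1 : centroid (X (i + 1) - X i) = -(μ • centroid (M i)) := by
    have e : centroid (X (i + 1) - X i) = centroid (X (i + 1)) - centroid (X i) := by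
      simp [centroid, smul_sub]
    rw [e, h.centroid_succ hW]; abel
  rw [blockNormSq_eq_centroid_add_deviation, h1, deviation_sub, norm_neg, norm_smul, mul_pow,
    Real.norm_eq_abs, sq_abs]
  have := blockNormSq_sub_le (deviation (X (i + 1))) (deviation (X i))
  linarith

end BlockL2

/-! ### Trajectories of the algorithm -/

section Trajectory

variable {K d₁ d₂ : ℕ} {Ξ : Type*} [MeasurableSpace Ξ]

/-- The random trajectory of exact diffusion with STORM. -/
noncomputable def traj {Ω : Type*} (Q : Problem K d₁ d₂ Ξ) (W : Matrix (Fin K) (Fin K) ℝ) (h : Hyper)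
    (x₀ dx₀ : Vec d₁) (y₀ dy₀ : Vec d₂) (ξ : ℕ → ℕ → Fin K → Ω → Ξ) (i : ℕ) (ω : Ω) :
    State K d₁ d₂ :=
  iterate Q (Design.ED W) h x₀ dx₀ y₀ dy₀ (fun i j k => ξ i j k ω) i

/-- The standing assumptions on the problem, the network and the parameters of a run. -/
structure IsRun {Ω : Type*} [MeasurableSpace Ω] (Q : Problem K d₁ d₂ Ξ)
    (W : Matrix (Fin K) (Fin K) ℝ) (h : Hyper) (L ν σ : ℝ) (Pr : Measure Ω)
    (ξ : ℕ → ℕ → Fin K → Ω → Ξ) : Prop where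
  K_pos : 1 ≤ K
  ν_pos : 0 < ν
  ν_le : ν ≤ L
  comb : IsCombination W
  psd : W.PosSemidef
  reg : Q.Regular
  pl : Q.PLCondition ν
  smooth : Q.ExpectedSmooth L
  noise : Q.GradientNoise σ
  sampling : Q.IsSampling Pr ξ
  b_pos : 1 ≤ h.b
  b₀_pos : 1 ≤ h.b₀
  β_nonneg : 0 ≤ h.β
  β_le : h.β ≤ 1

variable {Ω : Type*} {Q : Problem K d₁ d₂ Ξ} {W : Matrix (Fin K) (Fin K) ℝ} {h : Hyper}
  {L ν σ : ℝ} {ξ : ℕ → ℕ → Fin K → Ω → Ξ} {x₀ dx₀ : Vec d₁} {y₀ dy₀ : Vec d₂}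

theorem traj_exactDiffusionX (ω : Ω) : IsExactDiffusion W h.μx
    (fun i => (traj Q W h x₀ dx₀ y₀ dy₀ ξ i ω).X) (fun i => (traj Q W h x₀ dx₀ y₀ dy₀ ξ i ω).Dx)
    (fun i => (traj Q W h x₀ dx₀ y₀ dy₀ ξ i ω).Mx) where
  init_X := ⟨x₀, rfl⟩
  init_D := ⟨dx₀, rfl⟩
  step_X i := by
    conv_rhs => rw [← blockMul_one (traj Q W h x₀ dx₀ y₀ dy₀ ξ i ω).X]
    rfl
  step_D i := rfl

/-- The ascent in `y` is a descent with the negative step size. -/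
theorem traj_exactDiffusionY (ω : Ω) : IsExactDiffusion W (-h.μy)
    (fun i => (traj Q W h x₀ dx₀ y₀ dy₀ ξ i ω).Y) (fun i => (traj Q W h x₀ dx₀ y₀ dy₀ ξ i ω).Dy)
    (fun i => (traj Q W h x₀ dx₀ y₀ dy₀ ξ i ω).My) where
  init_X := ⟨y₀, rfl⟩
  init_D := ⟨dy₀, rfl⟩
  step_X i := by
    rw [neg_smul, sub_neg_eq_add]
    conv_rhs => rw [← blockMul_one (traj Q W h x₀ dx₀ y₀ dy₀ ξ i ω).Y]
    rfl
  step_D i := rfl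

theorem measurable_batchX {m : MeasurableSpace Ω} (hR : Q.Regular) (n : ℕ)
    {s : ℕ → Fin K → Ω → Ξ} {X : Ω → Block K d₁} {Y : Ω → Block K d₂}
    (hs : ∀ j k, Measurable[m] (s j k)) (hX : ∀ k, Measurable[m] fun ω => X ω k)
    (hY : ∀ k, Measurable[m] fun ω => Y ω k) (k : Fin K) :
    Measurable[m] fun ω => batchX Q n (fun j k => s j k ω) (X ω) (Y ω) k := by
  have h1 : Measurable[m] fun ω => ∑ j ∈ Finset.range n,
      Q.lossGradX k (X ω k) (Y ω k) (s j k ω) :=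
    Finset.measurable_sum _ fun j _ =>
      (hR.lossGradX_meas k).comp (((hX k).prodMk (hY k)).prodMk (hs j k))
  exact h1.const_smul (1 / (n : ℝ))

theorem measurable_batchY {m : MeasurableSpace Ω} (hR : Q.Regular) (n : ℕ)
    {s : ℕ → Fin K → Ω → Ξ} {X : Ω → Block K d₁} {Y : Ω → Block K d₂}
    (hs : ∀ j k, Measurable[m] (s j k)) (hX : ∀ k, Measurable[m] fun ω => X ω k)
    (hY : ∀ k, Measurable[m] fun ω => Y ω k) (k : Fin K) :
    Measurable[m] fun ω => batchY Q n (fun j k => s j k ω) (X ω) (Y ω) k := by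
  have h1 : Measurable[m] fun ω => ∑ j ∈ Finset.range n,
      Q.lossGradY k (X ω k) (Y ω k) (s j k ω) :=
    Finset.measurable_sum _ fun j _ =>
      (hR.lossGradY_meas k).comp (((hX k).prodMk (hY k)).prodMk (hs j k))
  exact h1.const_smul (1 / (n : ℝ))

/-- The iterates are determined by the samples of earlier iterations; the gradient estimates also
use the current samples. -/
structure TrajMeasurable (Q : Problem K d₁ d₂ Ξ) (W : Matrix (Fin K) (Fin K) ℝ) (h : Hyper)
    (x₀ dx₀ : Vec d₁) (y₀ dy₀ : Vec d₂) (ξ : ℕ → ℕ → Fin K → Ω → Ξ) (i : ℕ) : Prop where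
  X : ∀ k, Measurable[past ξ i] fun ω => (traj Q W h x₀ dx₀ y₀ dy₀ ξ i ω).X k
  Y : ∀ k, Measurable[past ξ i] fun ω => (traj Q W h x₀ dx₀ y₀ dy₀ ξ i ω).Y k
  Dx : ∀ k, Measurable[past ξ i] fun ω => (traj Q W h x₀ dx₀ y₀ dy₀ ξ i ω).Dx k
  Dy : ∀ k, Measurable[past ξ i] fun ω => (traj Q W h x₀ dx₀ y₀ dy₀ ξ i ω).Dy k
  Mx : ∀ k, Measurable[past ξ (i + 1)] fun ω => (traj Q W h x₀ dx₀ y₀ dy₀ ξ i ω).Mx k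
  My : ∀ k, Measurable[past ξ (i + 1)] fun ω => (traj Q W h x₀ dx₀ y₀ dy₀ ξ i ω).My k

theorem trajMeasurable (hR : Q.Regular) (i : ℕ) :
    TrajMeasurable Q W h x₀ dx₀ y₀ dy₀ ξ i := by
  induction i with
  | zero =>
    have hs := measurable_past_sample ξ 0
    exact
    { X := fun k => measurable_const
      Y := fun k => measurable_const
      Dx := fun k => measurable_const
      Dy := fun k => measurable_const
      Mx := fun k => measurable_batchX hR h.b₀ hs (X := fun _ _ => x₀) (Y := fun _ _ => y₀)
        (fun _ => measurable_const) (fun _ => measurable_const) k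
      My := fun k => measurable_batchY hR h.b₀ hs (X := fun _ _ => x₀) (Y := fun _ _ => y₀)
        (fun _ => measurable_const) (fun _ => measurable_const) k }
  | succ i ih =>
    have hle : past ξ i ≤ past ξ (i + 1) := past_mono ξ (Nat.le_succ i)
    have hle' : past ξ (i + 1) ≤ past ξ (i + 1 + 1) := past_mono ξ (Nat.le_succ _)
    have hs := measurable_past_sample ξ (i + 1)
    have oX := fun k => (ih.X k).mono hle le_rfl
    have oY := fun k => (ih.Y k).mono hle le_rfl
    have oDx := fun k => (ih.Dx k).mono hle le_rfl
    have oDy := fun k => (ih.Dy k).mono hle le_rfl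
    have hX : ∀ k, Measurable[past ξ (i + 1)]
        fun ω => (traj Q W h x₀ dx₀ y₀ dy₀ ξ (i + 1) ω).X k := fun k => by
      simp only [(traj_exactDiffusionX _).step_X]
      exact (measurable_blockMul W (fun k => (oX k).sub ((ih.Mx k).const_smul h.μx)) k).sub
        (measurable_blockMul _ oDx k)
    have hY : ∀ k, Measurable[past ξ (i + 1)]
        fun ω => (traj Q W h x₀ dx₀ y₀ dy₀ ξ (i + 1) ω).Y k := fun k => by
      simp only [(traj_exactDiffusionY _).step_X]
      exact (measurable_blockMul W (fun k => (oY k).sub ((ih.My k).const_smul (-h.μy))) k).sub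
        (measurable_blockMul _ oDy k)
    refine ⟨hX, hY, fun k => ?_, fun k => ?_, fun k => ?_, fun k => ?_⟩
    · simp only [(traj_exactDiffusionX _).step_D]
      exact (oDx k).add (measurable_blockMul _ hX k)
    · simp only [(traj_exactDiffusionY _).step_D]
      exact (oDy k).add (measurable_blockMul _ hY k)
    · exact (((ih.Mx k).mono hle' le_rfl).sub (measurable_batchX hR h.b hs
        (fun k => (oX k).mono hle' le_rfl) (fun k => (oY k).mono hle' le_rfl) k)).const_smul
          (1 - h.β) |>.add (measurable_batchX hR h.b hs
        (fun k => (hX k).mono hle' le_rfl) (fun k => (hY k).mono hle' le_rfl) k)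
    · exact (((ih.My k).mono hle' le_rfl).sub (measurable_batchY hR h.b hs
        (fun k => (oX k).mono hle' le_rfl) (fun k => (oY k).mono hle' le_rfl) k)).const_smul
          (1 - h.β) |>.add (measurable_batchY hR h.b hs
        (fun k => (hX k).mono hle' le_rfl) (fun k => (hY k).mono hle' le_rfl) k)

/-- Errors of the agents' estimates of their local `x`-gradients. -/
noncomputable def errX (Q : Problem K d₁ d₂ Ξ) (z : State K d₁ d₂) : Block K d₁ :=
  fun k => z.Mx k - Q.localGradX k (z.X k) (z.Y k)

/-- Errors of the agents' estimates of their local `y`-gradients. -/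
noncomputable def errY (Q : Problem K d₁ d₂ Ξ) (z : State K d₁ d₂) : Block K d₂ :=
  fun k => z.My k - Q.localGradY k (z.X k) (z.Y k)

variable [MeasurableSpace Ω] {Pr : Measure Ω}

/-- The trajectory and its gradient errors are square integrable. -/
structure TrajL2 (Q : Problem K d₁ d₂ Ξ) (Pr : Measure Ω) (z : Ω → State K d₁ d₂) : Prop where
  X : BlockL2 Pr fun ω => (z ω).X
  Y : BlockL2 Pr fun ω => (z ω).Y
  Dx : BlockL2 Pr fun ω => (z ω).Dx
  Dy : BlockL2 Pr fun ω => (z ω).Dy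
  Mx : BlockL2 Pr fun ω => (z ω).Mx
  My : BlockL2 Pr fun ω => (z ω).My
  errX : BlockL2 Pr fun ω => errX Q (z ω)
  errY : BlockL2 Pr fun ω => errY Q (z ω)

variable [IsProbabilityMeasure Pr]

theorem memLp_localGrad (hr : IsRun Q W h L ν σ Pr ξ) {x : Ω → Vec d₁} {y : Ω → Vec d₂}
    (hxm : Measurable x) (hym : Measurable y) (hx : MemLp x 2 Pr) (hy : MemLp y 2 Pr) (k : Fin K) :
    MemLp (fun ω => Q.localGradX k (x ω) (y ω)) 2 Pr ∧
      MemLp (fun ω => Q.localGradY k (x ω) (y ω)) 2 Pr := by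
  have hq := integrable_gradVar L hx (memLp_const (0 : Vec d₁)) hy (memLp_const (0 : Vec d₂))
  exact ⟨(hr.reg.isNoisyGradientX hr.smooth hr.noise).memLp_mean (hxm.prodMk hym) (0, 0) hq k,
    (hr.reg.isNoisyGradientY hr.smooth hr.noise).memLp_mean (hxm.prodMk hym) (0, 0) hq k⟩

/-- The data of one STORM update along the trajectory; `z` and `z'` are consecutive states. -/
theorem traj_storm_step (hr : IsRun Q W h L ν σ Pr ξ) (i : ℕ)
    (h1 : TrajL2 Q Pr (traj Q W h x₀ dx₀ y₀ dy₀ ξ i))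
    (hX : BlockL2 Pr fun ω => (traj Q W h x₀ dx₀ y₀ dy₀ ξ (i + 1) ω).X)
    (hY : BlockL2 Pr fun ω => (traj Q W h x₀ dx₀ y₀ dy₀ ξ (i + 1) ω).Y)
    {z z' : Ω → State K d₁ d₂} (hz : z = traj Q W h x₀ dx₀ y₀ dy₀ ξ i)
    (hz' : z' = traj Q W h x₀ dx₀ y₀ dy₀ ξ (i + 1)) {D : Fin K → ℝ}
    (hD : D = fun k => ∫ ω, Problem.gradVar L ((z' ω).X k, (z' ω).Y k)
      ((z ω).X k, (z ω).Y k) ∂Pr) :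
    ((∀ k, MemLp (fun ω => errX Q (z' ω) k) 2 Pr) ∧
    (∀ w : Fin K → ℝ, ∫ ω, ‖∑ k, w k • errX Q (z' ω) k‖ ^ 2 ∂Pr
      ≤ (1 - h.β) * ∫ ω, ‖∑ k, w k • errX Q (z ω) k‖ ^ 2 ∂Pr
        + 1 / (h.b : ℝ) * ∑ k, w k ^ 2 * (8 * D k + 2 * h.β ^ 2 * σ ^ 2)) ∧
    (∀ k, ∫ ω, ‖(z' ω).Mx k - (z ω).Mx k‖ ^ 2 ∂Pr
      ≤ 3 * h.β ^ 2 * ∫ ω, ‖errX Q (z ω) k‖ ^ 2 ∂Pr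
        + 3 * (1 / (h.b : ℝ) * (8 * D k + 2 * h.β ^ 2 * σ ^ 2)) + 3 * D k)) ∧
    ((∀ k, MemLp (fun ω => errY Q (z' ω) k) 2 Pr) ∧
    (∀ w : Fin K → ℝ, ∫ ω, ‖∑ k, w k • errY Q (z' ω) k‖ ^ 2 ∂Pr
      ≤ (1 - h.β) * ∫ ω, ‖∑ k, w k • errY Q (z ω) k‖ ^ 2 ∂Pr
        + 1 / (h.b : ℝ) * ∑ k, w k ^ 2 * (8 * D k + 2 * h.β ^ 2 * σ ^ 2)) ∧
    (∀ k, ∫ ω, ‖(z' ω).My k - (z ω).My k‖ ^ 2 ∂Pr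
      ≤ 3 * h.β ^ 2 * ∫ ω, ‖errY Q (z ω) k‖ ^ 2 ∂Pr
        + 3 * (1 / (h.b : ℝ) * (8 * D k + 2 * h.β ^ 2 * σ ^ 2)) + 3 * D k)) := by
  subst hz hz' hD
  have hm := trajMeasurable (W := W) (h := h) (x₀ := x₀) (dx₀ := dx₀) (y₀ := y₀) (dy₀ := dy₀)
    (ξ := ξ) hr.reg i
  have hm' := trajMeasurable (W := W) (h := h) (x₀ := x₀) (dx₀ := dx₀) (y₀ := y₀) (dy₀ := dy₀)
    (ξ := ξ) hr.reg (i + 1)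
  have hle : past ξ i ≤ past ξ (i + 1) := past_mono ξ (Nat.le_succ i)
  have hzm : ∀ k, Measurable[past ξ (i + 1)] fun ω =>
      ((traj Q W h x₀ dx₀ y₀ dy₀ ξ i ω).X k, (traj Q W h x₀ dx₀ y₀ dy₀ ξ i ω).Y k) := fun k =>
    ((hm.X k).mono hle le_rfl).prodMk ((hm.Y k).mono hle le_rfl)
  have hzm' := fun k => (hm'.X k).prodMk (hm'.Y k)
  have hq := fun k => integrable_gradVar L (hX k) (h1.X k) (hY k) (h1.Y k)
  exact ⟨storm_step (hr.reg.isNoisyGradientX hr.smooth hr.noise) hr.sampling.meas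
      hr.sampling.law_eq hr.sampling.indep hr.β_nonneg hr.β_le hr.b_pos (i + 1) hzm hzm' hq
      (M := fun k ω => (traj Q W h x₀ dx₀ y₀ dy₀ ξ i ω).Mx k)
      (M' := fun k ω => (traj Q W h x₀ dx₀ y₀ dy₀ ξ (i + 1) ω).Mx k)
      (fun k ω => rfl) hm.Mx h1.errX,
    storm_step (hr.reg.isNoisyGradientY hr.smooth hr.noise) hr.sampling.meas
      hr.sampling.law_eq hr.sampling.indep hr.β_nonneg hr.β_le hr.b_pos (i + 1) hzm hzm' hq
      (M := fun k ω => (traj Q W h x₀ dx₀ y₀ dy₀ ξ i ω).My k)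
      (M' := fun k ω => (traj Q W h x₀ dx₀ y₀ dy₀ ξ (i + 1) ω).My k)
      (fun k ω => rfl) hm.My h1.errY⟩

/-- The variance of the initial gradient estimates. -/
theorem traj_storm_init (hr : IsRun Q W h L ν σ Pr ξ) {z : Ω → State K d₁ d₂}
    (hz : z = traj Q W h x₀ dx₀ y₀ dy₀ ξ 0) :
    ((∀ k, MemLp (fun ω => errX Q (z ω) k) 2 Pr) ∧ ∀ w : Fin K → ℝ,
      ∫ ω, ‖∑ k, w k • errX Q (z ω) k‖ ^ 2 ∂Pr ≤ 1 / (h.b₀ : ℝ) * ∑ k, w k ^ 2 * σ ^ 2) ∧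
    ((∀ k, MemLp (fun ω => errY Q (z ω) k) 2 Pr) ∧ ∀ w : Fin K → ℝ,
      ∫ ω, ‖∑ k, w k • errY Q (z ω) k‖ ^ 2 ∂Pr ≤ 1 / (h.b₀ : ℝ) * ∑ k, w k ^ 2 * σ ^ 2) := by
  subst hz
  exact ⟨storm_init (hr.reg.isNoisyGradientX hr.smooth hr.noise) hr.sampling.meas
      hr.sampling.law_eq hr.sampling.indep hr.b₀_pos (fun _ => (x₀, y₀)) (fun k ω => rfl),
    storm_init (hr.reg.isNoisyGradientY hr.smooth hr.noise) hr.sampling.meas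
      hr.sampling.law_eq hr.sampling.indep hr.b₀_pos (fun _ => (x₀, y₀)) (fun k ω => rfl)⟩

theorem trajL2 (hr : IsRun Q W h L ν σ Pr ξ) (i : ℕ) :
    TrajL2 Q Pr (traj Q W h x₀ dx₀ y₀ dy₀ ξ i) := by
  have hm := fun i => trajMeasurable (W := W) (h := h) (x₀ := x₀) (dx₀ := dx₀) (y₀ := y₀)
    (dy₀ := dy₀) (ξ := ξ) hr.reg i
  have hpast := past_le (ξ := ξ) hr.sampling.meas
  -- the estimates are their errors plus the mean gradients
  have key : ∀ i, BlockL2 Pr (fun ω => (traj Q W h x₀ dx₀ y₀ dy₀ ξ i ω).X) →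
      BlockL2 Pr (fun ω => (traj Q W h x₀ dx₀ y₀ dy₀ ξ i ω).Y) →
      BlockL2 Pr (fun ω => errX Q (traj Q W h x₀ dx₀ y₀ dy₀ ξ i ω)) →
      BlockL2 Pr (fun ω => errY Q (traj Q W h x₀ dx₀ y₀ dy₀ ξ i ω)) →
      BlockL2 Pr (fun ω => (traj Q W h x₀ dx₀ y₀ dy₀ ξ i ω).Mx) ∧
      BlockL2 Pr (fun ω => (traj Q W h x₀ dx₀ y₀ dy₀ ξ i ω).My) := by
    intro i hX hY hex hey
    have hg := fun k => memLp_localGrad hr (((hm i).X k).mono (hpast i) le_rfl)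
      (((hm i).Y k).mono (hpast i) le_rfl) (hX k) (hY k) k
    refine ⟨fun k => ?_, fun k => ?_⟩
    · refine (memLp_congr_ae (Filter.Eventually.of_forall fun ω => ?_)).1 ((hex k).add (hg k).1)
      simp [errX]
    · refine (memLp_congr_ae (Filter.Eventually.of_forall fun ω => ?_)).1 ((hey k).add (hg k).2)
      simp [errY]
  induction i with
  | zero =>
    have hX : BlockL2 Pr (fun ω => (traj Q W h x₀ dx₀ y₀ dy₀ ξ 0 ω).X) := fun k => memLp_const x₀
    have hY : BlockL2 Pr (fun ω => (traj Q W h x₀ dx₀ y₀ dy₀ ξ 0 ω).Y) := fun k => memLp_const y₀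
    obtain ⟨⟨hex, -⟩, hey, -⟩ := traj_storm_init (x₀ := x₀) (dx₀ := dx₀) (y₀ := y₀)
      (dy₀ := dy₀) hr rfl
    obtain ⟨hMx, hMy⟩ := key 0 hX hY hex hey
    exact ⟨hX, hY, fun k => memLp_const dx₀, fun k => memLp_const dy₀, hMx, hMy, hex, hey⟩
  | succ i ih =>
    have hX : BlockL2 Pr (fun ω => (traj Q W h x₀ dx₀ y₀ dy₀ ξ (i + 1) ω).X) := by
      simp only [(traj_exactDiffusionX _).step_X]
      exact ((ih.X.sub (ih.Mx.smul h.μx)).blockMul W).sub (ih.Dx.blockMul _)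
    have hY : BlockL2 Pr (fun ω => (traj Q W h x₀ dx₀ y₀ dy₀ ξ (i + 1) ω).Y) := by
      simp only [(traj_exactDiffusionY _).step_X]
      exact ((ih.Y.sub (ih.My.smul (-h.μy))).blockMul W).sub (ih.Dy.blockMul _)
    obtain ⟨⟨hex, -⟩, hey, -⟩ := traj_storm_step hr i ih hX hY rfl rfl rfl
    obtain ⟨hMx, hMy⟩ := key (i + 1) hX hY hex hey
    refine ⟨hX, hY, ?_, ?_, hMx, hMy, hex, hey⟩
    · simp only [(traj_exactDiffusionX _).step_D]
      exact ih.Dx.add (hX.blockMul _)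
    · simp only [(traj_exactDiffusionY _).step_D]
      exact ih.Dy.add (hY.blockMul _)

end Trajectory

/-! ### The error recursion along a trajectory -/

section Recursion

variable {K d₁ d₂ : ℕ} {Ξ : Type*} [MeasurableSpace Ξ] {Ω : Type*} {Q : Problem K d₁ d₂ Ξ}
  {W : Matrix (Fin K) (Fin K) ℝ} {h : Hyper}
  {L ν σ : ℝ} {ξ : ℕ → ℕ → Fin K → Ω → Ξ} {x₀ dx₀ : Vec d₁} {y₀ dy₀ : Vec d₂}

/-- Errors of the averaged estimates at the centroid split into the averaged local errors and the
consensus error. -/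
theorem centroid_error_le {d : ℕ} (hK : 1 ≤ K) {G : Fin K → Vec d₁ → Vec d₂ → Vec d}
    (hG : ∀ k x y x' y', ‖G k x y - G k x' y'‖ ^ 2 ≤ L ^ 2 * (‖x - x'‖ ^ 2 + ‖y - y'‖ ^ 2))
    (X : Block K d₁) (Y : Block K d₂) (M : Block K d) :
    ‖centroid M - centroid fun k => G k (centroid X) (centroid Y)‖ ^ 2
      ≤ 2 * ‖centroid fun k => M k - G k (X k) (Y k)‖ ^ 2
        + 2 * L ^ 2 / K * (blockNormSq (deviation X) + blockNormSq (deviation Y)) := by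
  have hK' : (0 : ℝ) < K := by exact_mod_cast hK
  set E : Block K d := fun k => M k - G k (X k) (Y k)
  set F : Block K d := fun k => G k (X k) (Y k) - G k (centroid X) (centroid Y)
  have e : centroid M - centroid (fun k => G k (centroid X) (centroid Y))
      = centroid E + centroid F := by
    simp only [centroid, E, F, Finset.sum_sub_distrib, smul_sub]
    abel
  have h1 : K * ‖centroid F‖ ^ 2
      ≤ L ^ 2 * (blockNormSq (deviation X) + blockNormSq (deviation Y)) := by
    refine (norm_sq_centroid_le F).trans ?_
    simp only [blockNormSq, ← Finset.sum_add_distrib, Finset.mul_sum]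
    exact Finset.sum_le_sum fun k _ => hG k _ _ _ _
  have h2 := norm_add_sq_le (centroid E) (centroid F)
  have h3 : ‖centroid F‖ ^ 2
      ≤ L ^ 2 * (blockNormSq (deviation X) + blockNormSq (deviation Y)) / K := by
    rw [le_div_iff₀ hK']; linarith
  rw [e]
  have e2 : 2 * L ^ 2 / K * (blockNormSq (deviation X) + blockNormSq (deviation Y))
      = 2 * (L ^ 2 * (blockNormSq (deviation X) + blockNormSq (deviation Y)) / K) := by ring
  rw [e2]
  linarith

theorem sum_one_div_sq_mul (hK : 1 ≤ K) (c : ℝ) (D : Fin K → ℝ) :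
    ∑ k, (1 / (K : ℝ)) ^ 2 * (8 * D k + c) = 8 / (K : ℝ) ^ 2 * ∑ k, D k + c / K := by
  have hK' : (K : ℝ) ≠ 0 := by positivity
  rw [← Finset.mul_sum, Finset.sum_add_distrib, ← Finset.mul_sum, Finset.sum_const,
    Finset.card_univ, Fintype.card_fin, nsmul_eq_mul]
  field_simp

variable [MeasurableSpace Ω] {Pr : Measure Ω}

/-- The expected consensus error of exact diffusion, for step sizes of size at most `m`. -/
theorem IsExactDiffusion.sum_integral_deviation_le {d : ℕ} {μ m : ℝ}
    {X D M : ℕ → Ω → Block K d} (hW : IsCombination W) (hP : W.PosSemidef)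
    (hE : ∀ ω, IsExactDiffusion W μ (fun i => X i ω) (fun i => D i ω) (fun i => M i ω))
    (hX : ∀ i, BlockL2 Pr (X i)) (hM : ∀ i, BlockL2 Pr (M i)) (hμ : μ ^ 2 ≤ m ^ 2) (T : ℕ) :
    ∑ i ∈ Finset.range (T + 1), ∫ ω, blockNormSq (deviation (X i ω)) ∂Pr
      ≤ 2 * m ^ 2 / (1 - mixing W) ^ 2
          * ∫ ω, blockNormSq (blockMul (W - avgMatrix K) (M 0 ω)) ∂Pr
        + mixing W ^ 2 * m ^ 2 / ((1 - √(mixing W)) ^ 2 * (1 - mixing W))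
          * ∑ j ∈ Finset.range T, ∫ ω, blockNormSq (M (j + 1) ω - M j ω) ∂Pr := by
  have hl : 0 ≤ 1 - mixing W := by have := hW.mixing_lt_one; linarith
  have i1 : Integrable (fun ω => blockNormSq (blockMul (W - avgMatrix K) (M 0 ω))) Pr :=
    ((hM 0).blockMul _).integrable
  have i2 : ∀ j, Integrable (fun ω => blockNormSq (M (j + 1) ω - M j ω)) Pr := fun j =>
    ((hM (j + 1)).sub (hM j)).integrable
  rw [← integral_finsetSum _ fun i _ => (hX i).deviation.integrable,
    ← integral_finsetSum _ fun j _ => i2 j, ← integral_const_mul, ← integral_const_mul,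
    ← integral_add (i1.const_mul _) ((integrable_finsetSum _ fun j _ => i2 j).const_mul _)]
  refine integral_mono (integrable_finsetSum _ fun i _ => (hX i).deviation.integrable)
    ((i1.const_mul _).add ((integrable_finsetSum _ fun j _ => i2 j).const_mul _)) fun ω => ?_
  refine ((hE ω).sum_deviation_le hW hP T).trans (add_le_add ?_ ?_)
  · exact mul_le_mul_of_nonneg_right
      (div_le_div_of_nonneg_right (by linarith) (sq_nonneg _)) (blockNormSq_nonneg _)
  · exact mul_le_mul_of_nonneg_right
      (div_le_div_of_nonneg_right (mul_le_mul_of_nonneg_left hμ (sq_nonneg _))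
        (mul_nonneg (sq_nonneg _) hl))
      (Finset.sum_nonneg fun j _ => blockNormSq_nonneg _)

variable [IsProbabilityMeasure Pr]

/-- The gradients at the centroid are square integrable. -/
theorem memLp_costGrad (hr : IsRun Q W h L ν σ Pr ξ) (i : ℕ) :
    MemLp (fun ω => Q.costGradX (centroid (traj Q W h x₀ dx₀ y₀ dy₀ ξ i ω).X)
      (centroid (traj Q W h x₀ dx₀ y₀ dy₀ ξ i ω).Y)) 2 Pr ∧
    MemLp (fun ω => Q.costGradY (centroid (traj Q W h x₀ dx₀ y₀ dy₀ ξ i ω).X)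
      (centroid (traj Q W h x₀ dx₀ y₀ dy₀ ξ i ω).Y)) 2 Pr := by
  have h2 := trajL2 (x₀ := x₀) (dx₀ := dx₀) (y₀ := y₀) (dy₀ := dy₀) hr i
  have hm := trajMeasurable (W := W) (h := h) (x₀ := x₀) (dx₀ := dx₀) (y₀ := y₀)
    (dy₀ := dy₀) (ξ := ξ) hr.reg i
  have hpast := past_le (ξ := ξ) hr.sampling.meas i
  have hxm : Measurable fun ω => centroid (traj Q W h x₀ dx₀ y₀ dy₀ ξ i ω).X := by
    have : Measurable fun ω => ∑ k, (traj Q W h x₀ dx₀ y₀ dy₀ ξ i ω).X k :=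
      Finset.measurable_sum _ fun k _ => (hm.X k).mono hpast le_rfl
    exact this.const_smul (1 / (K : ℝ))
  have hym : Measurable fun ω => centroid (traj Q W h x₀ dx₀ y₀ dy₀ ξ i ω).Y := by
    have : Measurable fun ω => ∑ k, (traj Q W h x₀ dx₀ y₀ dy₀ ξ i ω).Y k :=
      Finset.measurable_sum _ fun k _ => (hm.Y k).mono hpast le_rfl
    exact this.const_smul (1 / (K : ℝ))
  have hg := fun k => memLp_localGrad hr hxm hym h2.X.centroid h2.Y.centroid k
  simp only [hr.reg.costGradX_eq, hr.reg.costGradY_eq]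
  exact ⟨BlockL2.centroid fun k => (hg k).1, BlockL2.centroid fun k => (hg k).2⟩

variable {z : ℕ → Ω → State K d₁ d₂}

/-- Mean-square errors of the averaged estimates. -/
noncomputable def avgErr (Q : Problem K d₁ d₂ Ξ) (Pr : Measure Ω) (z : ℕ → Ω → State K d₁ d₂)
    (i : ℕ) : ℝ :=
  ∫ ω, ‖centroid (errX Q (z i ω))‖ ^ 2 ∂Pr + ∫ ω, ‖centroid (errY Q (z i ω))‖ ^ 2 ∂Pr

/-- Mean-square errors of the individual estimates. -/
noncomputable def blockErr (Q : Problem K d₁ d₂ Ξ) (Pr : Measure Ω) (z : ℕ → Ω → State K d₁ d₂)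
    (i : ℕ) : ℝ :=
  ∫ ω, blockNormSq (errX Q (z i ω)) ∂Pr + ∫ ω, blockNormSq (errY Q (z i ω)) ∂Pr

/-- Mean-square increments of the iterates. -/
noncomputable def iterIncr (Pr : Measure Ω) (z : ℕ → Ω → State K d₁ d₂) (i : ℕ) : ℝ :=
  ∫ ω, blockNormSq ((z (i + 1) ω).X - (z i ω).X) ∂Pr
    + ∫ ω, blockNormSq ((z (i + 1) ω).Y - (z i ω).Y) ∂Pr

/-- Mean-square increments of the estimates. -/
noncomputable def estIncr (Pr : Measure Ω) (z : ℕ → Ω → State K d₁ d₂) (i : ℕ) : ℝ :=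
  ∫ ω, blockNormSq ((z (i + 1) ω).Mx - (z i ω).Mx) ∂Pr
    + ∫ ω, blockNormSq ((z (i + 1) ω).My - (z i ω).My) ∂Pr

/-- Mean-square consensus errors. -/
noncomputable def consErr (Pr : Measure Ω) (z : ℕ → Ω → State K d₁ d₂) (i : ℕ) : ℝ :=
  ∫ ω, blockNormSq (deviation (z i ω).X) ∂Pr + ∫ ω, blockNormSq (deviation (z i ω).Y) ∂Pr

/-- Mean-square errors of the averaged estimates of the gradients at the centroid. -/
noncomputable def centErr (Q : Problem K d₁ d₂ Ξ) (Pr : Measure Ω) (z : ℕ → Ω → State K d₁ d₂)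
    (i : ℕ) : ℝ :=
  ∫ ω, ‖centroid (z i ω).Mx - Q.costGradX (centroid (z i ω).X) (centroid (z i ω).Y)‖ ^ 2 ∂Pr
    + ∫ ω, ‖centroid (z i ω).My - Q.costGradY (centroid (z i ω).X) (centroid (z i ω).Y)‖ ^ 2 ∂Pr

theorem traj_avgErr_zero (hr : IsRun Q W h L ν σ Pr ξ)
    (hz : z = traj Q W h x₀ dx₀ y₀ dy₀ ξ) :
    avgErr Q Pr z 0 ≤ 2 * σ ^ 2 / (K * h.b₀) := by
  have hK : (K : ℝ) ≠ 0 := by have := hr.K_pos; positivity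
  have hb : (h.b₀ : ℝ) ≠ 0 := by have := hr.b₀_pos; positivity
  obtain ⟨⟨-, h1⟩, -, h2⟩ := traj_storm_init hr (congrFun hz 0)
  have h1 := h1 fun _ => 1 / (K : ℝ)
  have h2 := h2 fun _ => 1 / (K : ℝ)
  simp only [avgErr, centroid_eq_proj]
  have e : 1 / (h.b₀ : ℝ) * ∑ _k : Fin K, (1 / (K : ℝ)) ^ 2 * σ ^ 2 = σ ^ 2 / (K * h.b₀) := by
    simp only [Finset.sum_const, Finset.card_univ, Fintype.card_fin, nsmul_eq_mul]
    field_simp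
  rw [e] at h1 h2
  refine (add_le_add h1 h2).trans (le_of_eq ?_)
  ring

theorem traj_blockErr_zero (hr : IsRun Q W h L ν σ Pr ξ)
    (hz : z = traj Q W h x₀ dx₀ y₀ dy₀ ξ) :
    blockErr Q Pr z 0 ≤ 2 * K * σ ^ 2 / h.b₀ := by
  have h0 : TrajL2 Q Pr (z 0) := hz ▸ trajL2 hr 0
  obtain ⟨⟨-, h1⟩, -, h2⟩ := traj_storm_init hr (congrFun hz 0)
  rw [blockErr, h0.errX.integral_eq, h0.errY.integral_eq]
  have h3 : ∀ k, ∫ ω, ‖errX Q (z 0 ω) k‖ ^ 2 ∂Pr ≤ 1 / (h.b₀ : ℝ) * σ ^ 2 := fun k => by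
    simpa only [sum_single_smul, sum_single_sq_mul] using h1 (Pi.single k 1)
  have h4 : ∀ k, ∫ ω, ‖errY Q (z 0 ω) k‖ ^ 2 ∂Pr ≤ 1 / (h.b₀ : ℝ) * σ ^ 2 := fun k => by
    simpa only [sum_single_smul, sum_single_sq_mul] using h2 (Pi.single k 1)
  refine (add_le_add (Finset.sum_le_sum fun k _ => h3 k)
    (Finset.sum_le_sum fun k _ => h4 k)).trans (le_of_eq ?_)
  simp only [Finset.sum_const, Finset.card_univ, Fintype.card_fin, nsmul_eq_mul]
  ring

/-- The STORM recursions: the errors of the averaged and of the individual estimates contract by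
`1 - β`, and the estimates change by at most the contracted error, fresh noise and the variation of
the gradients. -/
theorem traj_recursion (hr : IsRun Q W h L ν σ Pr ξ)
    (hz : z = traj Q W h x₀ dx₀ y₀ dy₀ ξ) (i : ℕ) :
    avgErr Q Pr z (i + 1) ≤ (1 - h.β) * avgErr Q Pr z i
      + (16 * L ^ 2 / (K ^ 2 * h.b) * iterIncr Pr z i + 4 * h.β ^ 2 * σ ^ 2 / (K * h.b)) ∧
    blockErr Q Pr z (i + 1) ≤ (1 - h.β) * blockErr Q Pr z i
      + (16 * L ^ 2 / h.b * iterIncr Pr z i + 4 * K * h.β ^ 2 * σ ^ 2 / h.b) ∧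
    estIncr Pr z i ≤ 3 * h.β ^ 2 * blockErr Q Pr z i
      + (3 * (16 * L ^ 2 / h.b * iterIncr Pr z i + 4 * K * h.β ^ 2 * σ ^ 2 / h.b)
        + 6 * L ^ 2 * iterIncr Pr z i) := by
  have h0 : TrajL2 Q Pr (z i) := hz ▸ trajL2 hr i
  have h1 : TrajL2 Q Pr (z (i + 1)) := hz ▸ trajL2 hr (i + 1)
  obtain ⟨⟨-, a1, a2⟩, -, b1, b2⟩ := traj_storm_step (dx₀ := dx₀) (dy₀ := dy₀) hr i (trajL2 hr i)
    (trajL2 hr (i + 1)).X (trajL2 hr (i + 1)).Y (congrFun hz i) (congrFun hz (i + 1)) rfl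
  have hDsum := sum_integral_gradVar L h1.X h0.X h1.Y h0.Y
  set D : Fin K → ℝ := fun k => ∫ ω, Problem.gradVar L ((z (i + 1) ω).X k, (z (i + 1) ω).Y k)
      ((z i ω).X k, (z i ω).Y k) ∂Pr with hD
  have hDs : ∑ k, D k = L ^ 2 * iterIncr Pr z i := hDsum
  have hb : (h.b : ℝ) ≠ 0 := by have := hr.b_pos; positivity
  have hK : (K : ℝ) ≠ 0 := by have := hr.K_pos; positivity
  have hsum : ∀ c : ℝ, ∑ k, (8 * D k + c) = 8 * (L ^ 2 * iterIncr Pr z i) + K * c := fun c => by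
    rw [Finset.sum_add_distrib, ← Finset.mul_sum, hDs]
    simp
  refine ⟨?_, ?_, ?_⟩
  · have a := a1 fun _ => 1 / (K : ℝ)
    have b := b1 fun _ => 1 / (K : ℝ)
    rw [sum_one_div_sq_mul hr.K_pos, hDs] at a b
    simp only [avgErr, centroid_eq_proj]
    refine (add_le_add a b).trans (le_of_eq ?_)
    simp only [proj]
    field_simp
    ring
  · rw [blockErr, blockErr, h0.errX.integral_eq, h0.errY.integral_eq, h1.errX.integral_eq,
      h1.errY.integral_eq]
    have a : ∀ k, ∫ ω, ‖errX Q (z (i + 1) ω) k‖ ^ 2 ∂Pr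
        ≤ (1 - h.β) * ∫ ω, ‖errX Q (z i ω) k‖ ^ 2 ∂Pr
          + 1 / (h.b : ℝ) * (8 * D k + 2 * h.β ^ 2 * σ ^ 2) := fun k => by
      simpa only [sum_single_smul, sum_single_sq_mul] using a1 (Pi.single k 1)
    have b : ∀ k, ∫ ω, ‖errY Q (z (i + 1) ω) k‖ ^ 2 ∂Pr
        ≤ (1 - h.β) * ∫ ω, ‖errY Q (z i ω) k‖ ^ 2 ∂Pr
          + 1 / (h.b : ℝ) * (8 * D k + 2 * h.β ^ 2 * σ ^ 2) := fun k => by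
      simpa only [sum_single_smul, sum_single_sq_mul] using b1 (Pi.single k 1)
    refine (add_le_add (Finset.sum_le_sum fun k _ => a k)
      (Finset.sum_le_sum fun k _ => b k)).trans (le_of_eq ?_)
    simp only [Finset.sum_add_distrib (f := fun k => (1 - h.β) * _), ← Finset.mul_sum, hsum]
    field_simp
    ring
  · rw [estIncr, blockErr, h0.errX.integral_eq, h0.errY.integral_eq,
      (h1.Mx.sub h0.Mx).integral_eq, (h1.My.sub h0.My).integral_eq]
    refine (add_le_add (Finset.sum_le_sum fun k _ => a2 k)
      (Finset.sum_le_sum fun k _ => b2 k)).trans (le_of_eq ?_)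
    have e : ∀ f : Fin K → ℝ, ∑ k, (3 * h.β ^ 2 * f k
        + 3 * (1 / (h.b : ℝ) * (8 * D k + 2 * h.β ^ 2 * σ ^ 2)) + 3 * D k)
        = 3 * h.β ^ 2 * ∑ k, f k + 3 * (1 / (h.b : ℝ) * (8 * (L ^ 2 * iterIncr Pr z i)
          + K * (2 * h.β ^ 2 * σ ^ 2))) + 3 * (L ^ 2 * iterIncr Pr z i) := fun f => by
      rw [← hsum, ← hDs]
      simp only [Finset.mul_sum, ← Finset.sum_add_distrib]
    rw [e, e]
    field_simp
    ring

theorem traj_consErr_le (hr : IsRun Q W h L ν σ Pr ξ)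
    (hz : z = traj Q W h x₀ dx₀ y₀ dy₀ ξ) (hμx : 0 ≤ h.μx) (hxy : h.μx ≤ h.μy) (T : ℕ) :
    ∑ i ∈ Finset.range (T + 1), consErr Pr z i
      ≤ 2 * h.μy ^ 2 * K * initDiscrepancy Pr (Design.ED W) z / (1 - mixing W) ^ 2
        + mixing W ^ 2 * h.μy ^ 2 / ((1 - √(mixing W)) ^ 2 * (1 - mixing W))
          * ∑ j ∈ Finset.range T, estIncr Pr z j := by
  have h2 : ∀ i, TrajL2 Q Pr (z i) := fun i => hz ▸ trajL2 hr i
  have hK : (K : ℝ) ≠ 0 := by have := hr.K_pos; positivity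
  have kx := IsExactDiffusion.sum_integral_deviation_le (Pr := Pr) (μ := h.μx) (m := h.μy)
    (X := fun i ω => (z i ω).X) (D := fun i ω => (z i ω).Dx) (M := fun i ω => (z i ω).Mx)
    hr.comb hr.psd (fun ω => hz ▸ traj_exactDiffusionX ω) (fun i => (h2 i).X)
    (fun i => (h2 i).Mx) (pow_le_pow_left₀ hμx hxy 2) T
  have ky := IsExactDiffusion.sum_integral_deviation_le (Pr := Pr) (μ := -h.μy) (m := h.μy)
    (X := fun i ω => (z i ω).Y) (D := fun i ω => (z i ω).Dy) (M := fun i ω => (z i ω).My)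
    hr.comb hr.psd (fun ω => hz ▸ traj_exactDiffusionY ω) (fun i => (h2 i).Y)
    (fun i => (h2 i).My) (by rw [neg_sq]) T
  simp only [consErr, estIncr, Finset.sum_add_distrib]
  refine (add_le_add kx ky).trans (le_of_eq ?_)
  have e : K * initDiscrepancy Pr (Design.ED W) z
      = ∫ ω, blockNormSq (blockMul (W - avgMatrix K) (z 0 ω).Mx) ∂Pr
        + ∫ ω, blockNormSq (blockMul (W - avgMatrix K) (z 0 ω).My) ∂Pr := by
    simp only [initDiscrepancy, Design.ED]
    field_simp
  have e2 : 2 * h.μy ^ 2 * K * initDiscrepancy Pr (Design.ED W) z / (1 - mixing W) ^ 2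
      = 2 * h.μy ^ 2 / (1 - mixing W) ^ 2 * (K * initDiscrepancy Pr (Design.ED W) z) := by ring
  rw [e2, e]
  ring

theorem traj_iterIncr_le (hr : IsRun Q W h L ν σ Pr ξ)
    (hz : z = traj Q W h x₀ dx₀ y₀ dy₀ ξ) (i : ℕ) :
    iterIncr Pr z i ≤ K * (h.μx ^ 2 * ∫ ω, ‖centroid (z i ω).Mx‖ ^ 2 ∂Pr
      + h.μy ^ 2 * ∫ ω, ‖centroid (z i ω).My‖ ^ 2 ∂Pr)
      + 2 * (consErr Pr z i + consErr Pr z (i + 1)) := by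
  have h2 : ∀ i, TrajL2 Q Pr (z i) := fun i => hz ▸ trajL2 hr i
  have key : ∀ {d : ℕ} (μ : ℝ) (X D M : ℕ → Ω → Block K d),
      (∀ ω, IsExactDiffusion W μ (fun i => X i ω) (fun i => D i ω) (fun i => M i ω)) →
      (∀ i, BlockL2 Pr (X i)) → (∀ i, BlockL2 Pr (M i)) →
      ∫ ω, blockNormSq (X (i + 1) ω - X i ω) ∂Pr
        ≤ K * (μ ^ 2 * ∫ ω, ‖centroid (M i ω)‖ ^ 2 ∂Pr)
          + 2 * (∫ ω, blockNormSq (deviation (X i ω)) ∂Pr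
            + ∫ ω, blockNormSq (deviation (X (i + 1) ω)) ∂Pr) := by
    intro d μ X D M hE hX hM
    have i1 : Integrable (fun ω => (K : ℝ) * (μ ^ 2 * ‖centroid (M i ω)‖ ^ 2)) Pr :=
      ((integrable_norm_sq (hM i).centroid).const_mul _).const_mul _
    have i2 := (hX i).deviation.integrable
    have i3 := (hX (i + 1)).deviation.integrable
    have i4 : Integrable (fun ω => 2 * (blockNormSq (deviation (X i ω))
        + blockNormSq (deviation (X (i + 1) ω)))) Pr := (i2.add i3).const_mul 2
    rw [← integral_add i2 i3, ← integral_const_mul, ← integral_const_mul, ← integral_const_mul,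
      ← integral_add i1 i4]
    exact integral_mono ((hX (i + 1)).sub (hX i)).integrable (i1.add i4)
      fun ω => (hE ω).blockNormSq_step_le hr.comb i
  have kx := key h.μx (fun i ω => (z i ω).X) (fun i ω => (z i ω).Dx) (fun i ω => (z i ω).Mx)
    (fun ω => hz ▸ traj_exactDiffusionX ω) (fun i => (h2 i).X) (fun i => (h2 i).Mx)
  have ky := key (-h.μy) (fun i ω => (z i ω).Y) (fun i ω => (z i ω).Dy) (fun i ω => (z i ω).My)
    (fun ω => hz ▸ traj_exactDiffusionY ω) (fun i => (h2 i).Y) (fun i => (h2 i).My)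
  rw [neg_sq] at ky
  simp only [iterIncr, consErr]
  linarith

theorem traj_centErr_le (hr : IsRun Q W h L ν σ Pr ξ)
    (hz : z = traj Q W h x₀ dx₀ y₀ dy₀ ξ) (i : ℕ) :
    centErr Q Pr z i ≤ 2 * avgErr Q Pr z i + 4 * L ^ 2 / K * consErr Pr z i := by
  have h2 : TrajL2 Q Pr (z i) := hz ▸ trajL2 hr i
  have hg := memLp_costGrad (x₀ := x₀) (dx₀ := dx₀) (y₀ := y₀) (dy₀ := dy₀) hr i
  rw [← congrFun hz i] at hg
  have jX := integrable_norm_sq h2.errX.centroid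
  have jY := integrable_norm_sq h2.errY.centroid
  have jc : Integrable (fun ω => blockNormSq (deviation (z i ω).X)
      + blockNormSq (deviation (z i ω).Y)) Pr :=
    h2.X.deviation.integrable.add h2.Y.deviation.integrable
  have ec : consErr Pr z i = ∫ ω, (blockNormSq (deviation (z i ω).X)
      + blockNormSq (deviation (z i ω).Y)) ∂Pr :=
    (integral_add h2.X.deviation.integrable h2.Y.deviation.integrable).symm
  have kX : ∫ ω, ‖centroid (z i ω).Mx
      - Q.costGradX (centroid (z i ω).X) (centroid (z i ω).Y)‖ ^ 2 ∂Pr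
      ≤ 2 * ∫ ω, ‖centroid (errX Q (z i ω))‖ ^ 2 ∂Pr + 2 * L ^ 2 / K * consErr Pr z i := by
    rw [ec, ← integral_const_mul, ← integral_const_mul,
      ← integral_add (jX.const_mul _) (jc.const_mul _)]
    refine integral_mono (integrable_norm_sq (h2.Mx.centroid.sub hg.1))
      ((jX.const_mul _).add (jc.const_mul _)) fun ω => ?_
    simp only [hr.reg.costGradX_eq]
    exact centroid_error_le hr.K_pos (fun k x y x' y' =>
      (hr.reg.isNoisyGradientX hr.smooth hr.noise).norm_sq_mean_sub_le k (x, y) (x', y')) _ _ _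
  have kY : ∫ ω, ‖centroid (z i ω).My
      - Q.costGradY (centroid (z i ω).X) (centroid (z i ω).Y)‖ ^ 2 ∂Pr
      ≤ 2 * ∫ ω, ‖centroid (errY Q (z i ω))‖ ^ 2 ∂Pr + 2 * L ^ 2 / K * consErr Pr z i := by
    rw [ec, ← integral_const_mul, ← integral_const_mul,
      ← integral_add (jY.const_mul _) (jc.const_mul _)]
    refine integral_mono (integrable_norm_sq (h2.My.centroid.sub hg.2))
      ((jY.const_mul _).add (jc.const_mul _)) fun ω => ?_
    simp only [hr.reg.costGradY_eq]
    exact centroid_error_le hr.K_pos (fun k x y x' y' =>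
      (hr.reg.isNoisyGradientY hr.smooth hr.noise).norm_sq_mean_sub_le k (x, y) (x', y')) _ _ _
  refine (add_le_add kX kY).trans (le_of_eq ?_)
  simp only [avgErr]
  ring

theorem traj_descent (hr : IsRun Q W h L ν σ Pr ξ)
    (hz : z = traj Q W h x₀ dx₀ y₀ dy₀ ξ) (hμx : 0 ≤ h.μx) (hxy : h.μx ≤ h.μy)
    (hsx : L * (1 + L / ν / 2) * h.μx ≤ 1 / 1024) (hsy : L * h.μy ≤ 1 / 1024)
    (hratio : (L / ν) ^ 2 * h.μx ≤ 1 / 1024 * h.μy) (T : ℕ) :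
    ∑ i ∈ Finset.range T, (h.μx / 8 * ∫ ω, ‖centroid (z i ω).Mx‖ ^ 2 ∂Pr
      + h.μy / 64 * (∫ ω, ‖Q.costGradY (centroid (z i ω).X) (centroid (z i ω).Y)‖ ^ 2 ∂Pr
        + ∫ ω, ‖centroid (z i ω).My‖ ^ 2 ∂Pr))
      ≤ ((Q.primal x₀ - Q.primalInf) + (Q.primal x₀ - Q.cost x₀ y₀))
        + 2 * h.μy * ∑ i ∈ Finset.range T, centErr Q Pr z i := by
  have h2 : ∀ i, TrajL2 Q Pr (z i) := fun i => hz ▸ trajL2 hr i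
  have hg : ∀ i, _ := fun i => memLp_costGrad (x₀ := x₀) (dx₀ := dx₀) (y₀ := y₀) (dy₀ := dy₀) hr i
  simp only [← congrFun hz] at hg
  have hPL := hr.reg.smoothPL hr.K_pos hr.ν_pos hr.ν_le hr.pl hr.smooth hr.noise
  have hK : (K : ℝ) ≠ 0 := by have := hr.K_pos; positivity
  have hc0 : ∀ {d : ℕ} (v : Vec d), centroid (fun _ : Fin K => v) = v := fun v => by
    simp only [centroid, Finset.sum_const, Finset.card_univ, Fintype.card_fin]
    rw [← Nat.cast_smul_eq_nsmul ℝ, smul_smul, one_div_mul_cancel hK, one_smul]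
  have hpath : ∀ ω, _ := fun ω => hPL.sum_descent hμx hsx hsy hratio hr.pl.primalInf_le
    (fun i => centroid (z i ω).X) (fun i => centroid (z i ω).Mx)
    (fun i => centroid (z i ω).Y) (fun i => centroid (z i ω).My)
    (fun i => by
      subst hz
      exact (traj_exactDiffusionX ω).centroid_succ hr.comb i)
    (fun i => by
      subst hz
      have := (traj_exactDiffusionY (Q := Q) (W := W) (h := h) (ξ := ξ) (x₀ := x₀) (dx₀ := dx₀)
        (y₀ := y₀) (dy₀ := dy₀) ω).centroid_succ hr.comb i
      simpa only [neg_smul, sub_neg_eq_add] using this) T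
  have hx0 : ∀ ω, centroid (z 0 ω).X = x₀ := fun ω => by subst hz; exact hc0 x₀
  have hy0 : ∀ ω, centroid (z 0 ω).Y = y₀ := fun ω => by subst hz; exact hc0 y₀
  simp only [hx0, hy0] at hpath
  have i1 := fun i => integrable_norm_sq (h2 i).Mx.centroid
  have i2 := fun i => integrable_norm_sq (h2 i).My.centroid
  have i3 := fun i => integrable_norm_sq (hg i).2
  have i4 := fun i => integrable_norm_sq ((h2 i).Mx.centroid.sub (hg i).1)
  have i5 := fun i => integrable_norm_sq ((h2 i).My.centroid.sub (hg i).2)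
  simp only [Pi.sub_apply] at i4 i5
  have hl : ∀ i, Integrable (fun ω => h.μx / 8 * ‖centroid (z i ω).Mx‖ ^ 2
      + h.μy / 64 * (‖Q.costGradY (centroid (z i ω).X) (centroid (z i ω).Y)‖ ^ 2
        + ‖centroid (z i ω).My‖ ^ 2)) Pr := fun i =>
    ((i1 i).const_mul _).add (((i3 i).add (i2 i)).const_mul _)
  have hrr : ∀ i, Integrable (fun ω =>
      2 * h.μx * ‖centroid (z i ω).Mx
        - Q.costGradX (centroid (z i ω).X) (centroid (z i ω).Y)‖ ^ 2
      + h.μy * ‖centroid (z i ω).My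
        - Q.costGradY (centroid (z i ω).X) (centroid (z i ω).Y)‖ ^ 2) Pr := fun i =>
    ((i4 i).const_mul _).add ((i5 i).const_mul _)
  have hint := integral_mono (integrable_finsetSum (Finset.range T) fun i _ => hl i)
    ((integrable_const _).add (integrable_finsetSum (Finset.range T) fun i _ => hrr i)) hpath
  simp only [Pi.add_apply] at hint
  rw [integral_add (integrable_const _) (integrable_finsetSum (Finset.range T) fun i _ => hrr i),
    integral_finsetSum _ fun i _ => hl i, integral_finsetSum _ fun i _ => hrr i] at hint
  simp only [integral_const, probReal_univ, one_smul] at hint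
  have el : ∀ i, ∫ ω, (h.μx / 8 * ‖centroid (z i ω).Mx‖ ^ 2
      + h.μy / 64 * (‖Q.costGradY (centroid (z i ω).X) (centroid (z i ω).Y)‖ ^ 2
        + ‖centroid (z i ω).My‖ ^ 2)) ∂Pr
      = h.μx / 8 * ∫ ω, ‖centroid (z i ω).Mx‖ ^ 2 ∂Pr
      + h.μy / 64 * (∫ ω, ‖Q.costGradY (centroid (z i ω).X) (centroid (z i ω).Y)‖ ^ 2 ∂Pr
        + ∫ ω, ‖centroid (z i ω).My‖ ^ 2 ∂Pr) := fun i => by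
    have j : Integrable (fun ω => h.μy / 64
        * (‖Q.costGradY (centroid (z i ω).X) (centroid (z i ω).Y)‖ ^ 2
          + ‖centroid (z i ω).My‖ ^ 2)) Pr := ((i3 i).add (i2 i)).const_mul _
    rw [integral_add ((i1 i).const_mul _) j, integral_const_mul,
      integral_const_mul, integral_add (i3 i) (i2 i)]
  have er : ∀ i, ∫ ω, (2 * h.μx * ‖centroid (z i ω).Mx
        - Q.costGradX (centroid (z i ω).X) (centroid (z i ω).Y)‖ ^ 2
      + h.μy * ‖centroid (z i ω).My
        - Q.costGradY (centroid (z i ω).X) (centroid (z i ω).Y)‖ ^ 2) ∂Pr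
      ≤ 2 * h.μy * centErr Q Pr z i := fun i => by
    rw [integral_add ((i4 i).const_mul _) ((i5 i).const_mul _), integral_const_mul,
      integral_const_mul, centErr]
    have n1 : 0 ≤ ∫ ω, ‖centroid (z i ω).Mx
        - Q.costGradX (centroid (z i ω).X) (centroid (z i ω).Y)‖ ^ 2 ∂Pr :=
      integral_nonneg fun _ => sq_nonneg _
    have n2 : 0 ≤ ∫ ω, ‖centroid (z i ω).My
        - Q.costGradY (centroid (z i ω).X) (centroid (z i ω).Y)‖ ^ 2 ∂Pr :=
      integral_nonneg fun _ => sq_nonneg _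
    nlinarith
  simp only [el] at hint
  rw [Finset.mul_sum]
  refine hint.trans (add_le_add le_rfl (Finset.sum_le_sum fun i _ => er i))

/-- The expected error quantities of a trajectory satisfy the coupled recursions. -/
theorem traj_errorRecursion (hr : IsRun Q W h L ν σ Pr ξ)
    (hz : z = traj Q W h x₀ dx₀ y₀ dy₀ ξ) (hμx : 0 ≤ h.μx) (hxy : h.μx ≤ h.μy)
    (hsx : L * (1 + L / ν / 2) * h.μx ≤ 1 / 1024) (hsy : L * h.μy ≤ 1 / 1024)
    (hratio : (L / ν) ^ 2 * h.μx ≤ 1 / 1024 * h.μy) (T : ℕ) :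
    ErrorRecursion K h.b h.b₀ T L h.μx h.μy h.β (mixing W) (σ ^ 2)
      (initDiscrepancy Pr (Design.ED W) z)
      ((Q.primal x₀ - Q.primalInf) + (Q.primal x₀ - Q.cost x₀ y₀))
      (avgErr Q Pr z) (blockErr Q Pr z) (iterIncr Pr z) (estIncr Pr z) (consErr Pr z)
      (centErr Q Pr z) (fun i => ∫ ω, ‖centroid (z i ω).Mx‖ ^ 2 ∂Pr)
      (fun i => ∫ ω, ‖centroid (z i ω).My‖ ^ 2 ∂Pr)
      (fun i => ∫ ω, ‖Q.costGradX (centroid (z i ω).X) (centroid (z i ω).Y)‖ ^ 2 ∂Pr)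
      (fun i => ∫ ω, ‖Q.costGradY (centroid (z i ω).X) (centroid (z i ω).Y)‖ ^ 2 ∂Pr) where
  V_nonneg i := add_nonneg (integral_nonneg fun _ => sq_nonneg _)
    (integral_nonneg fun _ => sq_nonneg _)
  S_nonneg i := add_nonneg (integral_nonneg fun _ => blockNormSq_nonneg _)
    (integral_nonneg fun _ => blockNormSq_nonneg _)
  c_nonneg i := add_nonneg (integral_nonneg fun _ => blockNormSq_nonneg _)
    (integral_nonneg fun _ => blockNormSq_nonneg _)
  qx_nonneg i := integral_nonneg fun _ => sq_nonneg _
  qy_nonneg i := integral_nonneg fun _ => sq_nonneg _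
  gy_nonneg i := integral_nonneg fun _ => sq_nonneg _
  V_zero := traj_avgErr_zero hr hz
  V_succ i := (traj_recursion hr hz i).1
  S_zero := traj_blockErr_zero hr hz
  S_succ i := (traj_recursion hr hz i).2.1
  Θ_le i := (traj_recursion hr hz i).2.2
  c_le := traj_consErr_le hr hz hμx hxy T
  Dl_le i := traj_iterIncr_le hr hz i
  A_le i := traj_centErr_le hr hz i
  gx_le i := by
    have h2 : TrajL2 Q Pr (z i) := hz ▸ trajL2 hr i
    have hg := memLp_costGrad (x₀ := x₀) (dx₀ := dx₀) (y₀ := y₀) (dy₀ := dy₀) hr i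
    rw [← congrFun hz i] at hg
    have i1 := integrable_norm_sq h2.Mx.centroid
    have i2 : Integrable (fun ω => ‖centroid (z i ω).Mx
        - Q.costGradX (centroid (z i ω).X) (centroid (z i ω).Y)‖ ^ 2) Pr :=
      integrable_norm_sq (h2.Mx.centroid.sub hg.1)
    have h3 : ∫ ω, ‖Q.costGradX (centroid (z i ω).X) (centroid (z i ω).Y)‖ ^ 2 ∂Pr
        ≤ 2 * ∫ ω, ‖centroid (z i ω).Mx‖ ^ 2 ∂Pr + 2 * ∫ ω, ‖centroid (z i ω).Mx
          - Q.costGradX (centroid (z i ω).X) (centroid (z i ω).Y)‖ ^ 2 ∂Pr := by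
      rw [← integral_const_mul, ← integral_const_mul,
        ← integral_add (i1.const_mul _) (i2.const_mul _)]
      refine integral_mono (integrable_norm_sq hg.1) ((i1.const_mul _).add (i2.const_mul _))
        fun ω => ?_
      have := norm_sub_sq_le (centroid (z i ω).Mx) (centroid (z i ω).Mx
          - Q.costGradX (centroid (z i ω).X) (centroid (z i ω).Y))
      rwa [sub_sub_cancel] at this
    have n2 : 0 ≤ ∫ ω, ‖centroid (z i ω).My
        - Q.costGradY (centroid (z i ω).X) (centroid (z i ω).Y)‖ ^ 2 ∂Pr :=
      integral_nonneg fun _ => sq_nonneg _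
    simp only [centErr]
    linarith
  descent := traj_descent hr hz hμx hxy hsx hsy hratio T

end Recursion

/-! ### The rate -/

theorem rpow_third_pow_three {x : ℝ} (hx : 0 ≤ x) : (x ^ (1 / 3 : ℝ)) ^ 3 = x := by
  rw [← Real.rpow_natCast, ← Real.rpow_mul hx]
  norm_num

theorem rpow_two_thirds {x : ℝ} (hx : 0 ≤ x) : x ^ (2 / 3 : ℝ) = (x ^ (1 / 3 : ℝ)) ^ 2 := by
  rw [← Real.rpow_natCast, ← Real.rpow_mul hx]
  norm_num

/-- The constant of the rate. -/
noncomputable def rateConst (cx cy cβ c₀ b : ℝ) : ℝ :=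
  1000 / cx + 10000 * (cy / cx) * (1 / (c₀ * cβ) + cβ / b + 1)

theorem rateConst_pos {cx cy cβ c₀ b : ℝ} (hcx : 0 < cx) (hcy : 0 < cy) (hcβ : 0 < cβ)
    (hc₀ : 0 < c₀) (hb : 0 < b) : 0 < rateConst cx cy cβ c₀ b := by
  unfold rateConst
  positivity

/-- Inserting the step sizes, with `a = K^{1/3}` and `t = T^{1/3}`, into the summed bound. -/
theorem rate_of_sum_le {cx cy cβ c₀ b κ a t n μx μy β s G V Z l : ℝ} (hcx : 0 < cx) (hcy : 0 < cy)
    (hcβ : 0 < cβ) (hc₀ : 0 < c₀) (hb : 0 < b) (hκ : 0 < κ) (ha : 0 < a) (ht : 0 < t)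
    (hl : 0 < l) (hG : 0 ≤ G) (hV : 0 ≤ V) (hZ : 0 ≤ Z)
    (hμx : μx = cx * a ^ 2 / (t * κ ^ 2)) (hμy : μy = cy * a ^ 2 / t)
    (hβ : β = cβ * a / t ^ 2) (hn : c₀ * (t / a ^ 2) ≤ n)
    (h : μx * s ≤ 1000 * G
      + 10000 * μy * (V / (a ^ 3 * n * β) + t ^ 3 * β * V / (a ^ 3 * b) + Z / l)) :
    1 / t ^ 3 * s ≤ rateConst cx cy cβ c₀ b * (κ ^ 2 * (G + V) / (a ^ 2 * t ^ 2)
      + κ ^ 2 * Z / (t ^ 3 * l)) := by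
  have hμ : 0 < μx := by rw [hμx]; positivity
  have hy : 0 < μy := by rw [hμy]; positivity
  have hβ0 : 0 < β := by rw [hβ]; positivity
  have hn0 : 0 < n := lt_of_lt_of_le (by positivity) hn
  have h1 : V / (a ^ 3 * n * β) ≤ t / (a ^ 2 * (c₀ * cβ)) * V := by
    rw [div_mul_eq_mul_div, div_le_div_iff₀ (by positivity) (by positivity)]
    have e : a ^ 3 * (c₀ * (t / a ^ 2)) * β * t = a ^ 2 * (c₀ * cβ) := by
      rw [hβ]; field_simp
    calc V * (a ^ 2 * (c₀ * cβ)) = V * (a ^ 3 * (c₀ * (t / a ^ 2)) * β * t) := by rw [e]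
      _ ≤ V * (a ^ 3 * n * β * t) := by gcongr
      _ = t * V * (a ^ 3 * n * β) := by ring
  have h2 : t ^ 3 * β * V / (a ^ 3 * b) = t / a ^ 2 * (cβ / b) * V := by
    rw [hβ]; field_simp
  have h3 : 1 / t ^ 3 * s ≤ 1 / (t ^ 3 * μx) * (1000 * G
      + 10000 * μy * (t / (a ^ 2 * (c₀ * cβ)) * V + t / a ^ 2 * (cβ / b) * V + Z / l)) := by
    have : 1 / t ^ 3 * s = 1 / (t ^ 3 * μx) * (μx * s) := by field_simp
    rw [this]
    refine mul_le_mul_of_nonneg_left (h.trans ?_) (by positivity)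
    rw [h2]
    gcongr
  refine h3.trans ?_
  have e : 1 / (t ^ 3 * μx) * (1000 * G
      + 10000 * μy * (t / (a ^ 2 * (c₀ * cβ)) * V + t / a ^ 2 * (cβ / b) * V + Z / l))
      = 1000 / cx * (κ ^ 2 * G / (a ^ 2 * t ^ 2))
        + 10000 * (cy / cx) * (1 / (c₀ * cβ) + cβ / b) * (κ ^ 2 * V / (a ^ 2 * t ^ 2))
        + 10000 * (cy / cx) * (κ ^ 2 * Z / (t ^ 3 * l)) := by
    rw [hμx, hμy]
    field_simp
    ring
  rw [e, rateConst]
  have nG : 0 ≤ κ ^ 2 * G / (a ^ 2 * t ^ 2) := by positivity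
  have nV : 0 ≤ κ ^ 2 * V / (a ^ 2 * t ^ 2) := by positivity
  have nZ : 0 ≤ κ ^ 2 * Z / (t ^ 3 * l) := by positivity
  have e2 : κ ^ 2 * (G + V) / (a ^ 2 * t ^ 2)
      = κ ^ 2 * G / (a ^ 2 * t ^ 2) + κ ^ 2 * V / (a ^ 2 * t ^ 2) := by ring
  rw [e2]
  have p1 : 0 ≤ 1000 / cx := by positivity
  have p2 : 0 ≤ 10000 * (cy / cx) := by positivity
  have p3 : 0 ≤ 1 / (c₀ * cβ) + cβ / b := by positivity
  generalize κ ^ 2 * G / (a ^ 2 * t ^ 2) = g at *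
  generalize κ ^ 2 * V / (a ^ 2 * t ^ 2) = v at *
  generalize κ ^ 2 * Z / (t ^ 3 * l) = w at *
  generalize 1000 / cx = p at *
  generalize 10000 * (cy / cx) = q at *
  generalize 1 / (c₀ * cβ) + cβ / b = r at *
  have := mul_nonneg p1 nV
  have := mul_nonneg p1 nZ
  have := mul_nonneg p2 nG
  have := mul_nonneg p2 nV
  have := mul_nonneg (mul_nonneg p2 p3) nG
  have := mul_nonneg (mul_nonneg p2 p3) nZ
  nlinarith

section Bound

variable {K d₁ d₂ : ℕ} {Ξ : Type*} [MeasurableSpace Ξ] {Ω : Type*} [MeasurableSpace Ω]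
  {Q : Problem K d₁ d₂ Ξ} {W : Matrix (Fin K) (Fin K) ℝ} {h : Hyper} {L ν σ : ℝ}
  {Pr : Measure Ω} {ξ : ℕ → ℕ → Fin K → Ω → Ξ} {x₀ dx₀ : Vec d₁} {y₀ dy₀ : Vec d₂}
  {z : ℕ → Ω → State K d₁ d₂}

theorem initDiscrepancy_nonneg (S : Design K) : 0 ≤ initDiscrepancy Pr S z :=
  add_nonneg (mul_nonneg (by positivity) (integral_nonneg fun _ => blockNormSq_nonneg _))
    (mul_nonneg (by positivity) (integral_nonneg fun _ => blockNormSq_nonneg _))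

variable [IsProbabilityMeasure Pr]

theorem traj_integrable_gradNormSq (hr : IsRun Q W h L ν σ Pr ξ)
    (hz : z = traj Q W h x₀ dx₀ y₀ dy₀ ξ) (i : ℕ) :
    Integrable (fun ω => gradNormSq Q (z i ω)) Pr := by
  subst hz
  have hg := memLp_costGrad (x₀ := x₀) (dx₀ := dx₀) (y₀ := y₀) (dy₀ := dy₀) hr i
  exact (integrable_norm_sq hg.1).add (integrable_norm_sq hg.2)

/-- The summed bound under the step size conditions. -/
theorem traj_sum_le (hr : IsRun Q W h L ν σ Pr ξ) (hz : z = traj Q W h x₀ dx₀ y₀ dy₀ ξ)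
    (hA : Admissible (1 / 1024) L ν (mixing W) K h) (hμx : 0 < h.μx) (hμy : 0 < h.μy)
    (hβ : 0 < h.β) (T : ℕ) :
    h.μx * ∑ i ∈ Finset.range T, ∫ ω, gradNormSq Q (z i ω) ∂Pr
      ≤ 1000 * ((Q.primal x₀ - Q.primalInf) + (Q.primal x₀ - Q.cost x₀ y₀))
        + 10000 * h.μy * (σ ^ 2 / (K * h.b₀ * h.β) + T * h.β * σ ^ 2 / (K * h.b)
          + initDiscrepancy Pr (Design.ED W) z / (1 - mixing W) ^ 2) := by
  have hL : 0 < L := hr.ν_pos.trans_le hr.ν_le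
  have hκ : 1 ≤ L / ν := (one_le_div hr.ν_pos).2 hr.ν_le
  have hl0 := mixing_nonneg hr.psd
  have hl1 := hr.comb.mixing_lt_one
  have hs : √(mixing W) < 1 := by rw [Real.sqrt_lt' one_pos]; simpa using hl1
  have hK : (0 : ℝ) < K := by have := hr.K_pos; positivity
  have hb : (0 : ℝ) < h.b := by have := hr.b_pos; positivity
  have hR : 0 < K * h.b * h.β := by positivity
  have hxy : h.μx ≤ h.μy := by
    have : h.μx ≤ (L / ν) ^ 2 * h.μx := le_mul_of_one_le_left hμx.le (one_le_pow₀ hκ)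
    linarith [hA.μx_ratio]
  -- the step size conditions enter squared, and `(1 / 1024)² ≤ 1 / 1000000`
  have hnet : L ^ 2 * (mixing W ^ 2 * h.μy ^ 2 / ((1 - √(mixing W)) ^ 2 * (1 - mixing W)))
      ≤ 1 / 1000000 := by
    have p : 0 < (1 - √(mixing W)) ^ 2 * (1 - mixing W) :=
      mul_pos (pow_pos (by linarith) 2) (by linarith)
    rw [mul_div_assoc', div_le_iff₀ p]
    have := pow_le_pow_left₀ (by positivity) hA.μy_network 2
    rw [mul_pow (1 / 1024 : ℝ), mul_pow (1 - √(mixing W)), Real.sq_sqrt (by linarith)] at this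
    nlinarith
  have hyb : L ^ 2 * h.μy ^ 2 ≤ 1 / 1000000 * (K * h.b * h.β) := by
    have := pow_le_pow_left₀ (by positivity) hA.μy_batch 2
    rw [mul_pow (1 / 1024 : ℝ), Real.sq_sqrt hR.le, mul_pow] at this
    linarith
  have hxb : L ^ 2 * (h.μx * h.μy) ≤ 1 / 1000000 * (K * h.b * h.β) := by
    refine le_trans ?_ hyb
    rw [sq h.μy]
    gcongr
  have hR1 : K * h.b * h.β ≤ 1 := by
    have := mul_le_mul_of_nonneg_left hA.β_batch hK.le
    rw [mul_one_div_cancel hK.ne'] at this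
    linarith
  have e : ∀ i, ∫ ω, gradNormSq Q (z i ω) ∂Pr
      = ∫ ω, ‖Q.costGradX (centroid (z i ω).X) (centroid (z i ω).Y)‖ ^ 2 ∂Pr
        + ∫ ω, ‖Q.costGradY (centroid (z i ω).X) (centroid (z i ω).Y)‖ ^ 2 ∂Pr := fun i => by
    have hg := memLp_costGrad (x₀ := x₀) (dx₀ := dx₀) (y₀ := y₀) (dy₀ := dy₀) hr i
    rw [← congrFun hz i] at hg
    exact integral_add (integrable_norm_sq hg.1) (integrable_norm_sq hg.2)
  simp only [e]
  exact (traj_errorRecursion hr hz hμx.le hxy hA.μx_smooth hA.μy_smooth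
    hA.μx_ratio T).sum_grad_le hr.K_pos hr.b_pos hr.b₀_pos hμx hμy hxy hβ hA.β_le_one hl1
    (sq_nonneg σ) (initDiscrepancy_nonneg _)
    (add_nonneg (sub_nonneg.2 (hr.pl.primalInf_le x₀)) (sub_nonneg.2 (hr.reg.cost_le_primal x₀ y₀)))
    hnet hyb hxb hR1

end Bound

/-- The dominating part of the rate bounds the averaged squared gradient norms. -/
theorem avgGradNormSq_le {Lf cx cy cβ c₀ c₁ ν σ : ℝ} {b K d₁ d₂ T b₀ : ℕ}
    {W : Matrix (Fin K) (Fin K) ℝ} {Ξ : Type*} [MeasurableSpace Ξ] {Q : Problem K d₁ d₂ Ξ}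
    {Ω : Type*} [MeasurableSpace Ω] {Pr : Measure Ω} [IsProbabilityMeasure Pr]
    {ξ : ℕ → ℕ → Fin K → Ω → Ξ} {x₀ dx₀ : Vec d₁} {y₀ dy₀ : Vec d₂}
    (hcx : 0 < cx) (hcy : 0 < cy) (hcβ : 0 < cβ) (hc₀ : 0 < c₀) (hb : 1 ≤ b)
    (hν : 0 < ν) (hνL : ν ≤ Lf) (hK : 1 ≤ K) (hT : 1 ≤ T)
    (hW : IsCombination W) (hP : W.PosSemidef) (hR : Q.Regular) (hPL : Q.PLCondition ν)
    (hS : Q.ExpectedSmooth Lf) (hN : Q.GradientNoise σ) (hξ : Q.IsSampling Pr ξ)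
    (hb₀ : InitBatch c₀ c₁ K T b₀)
    (hA : Admissible (1 / 1024) Lf ν (mixing W) K (stormHyper cx cy cβ (Lf / ν) K T b₀ b))
    {z : ℕ → Ω → State K d₁ d₂}
    (hz : z = traj Q W (stormHyper cx cy cβ (Lf / ν) K T b₀ b) x₀ dx₀ y₀ dy₀ ξ) :
    (∀ i, Integrable (fun ω => gradNormSq Q (z i ω)) Pr) ∧
    avgGradNormSq Q Pr T z ≤ rateConst cx cy cβ c₀ b *
      ((Lf / ν) ^ 2 * ((Q.primal x₀ - Q.primalInf) + (Q.primal x₀ - Q.cost x₀ y₀) + σ ^ 2)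
          / ((K : ℝ) * T) ^ (2 / 3 : ℝ)
        + (Lf / ν) ^ 2 * initDiscrepancy Pr (Design.ED W) z / (T * (1 - mixing W) ^ 2)) := by
  have hL : 0 < Lf := hν.trans_le hνL
  have hK0 : (0 : ℝ) < K := by positivity
  have hT0 : (0 : ℝ) < T := by positivity
  have hb0 : (0 : ℝ) < b := by positivity
  set a := (K : ℝ) ^ (1 / 3 : ℝ) with ha
  set t := (T : ℝ) ^ (1 / 3 : ℝ) with ht
  have ha0 : 0 < a := by positivity
  have ht0 : 0 < t := by positivity
  have a3 : a ^ 3 = K := rpow_third_pow_three hK0.le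
  have t3 : t ^ 3 = T := rpow_third_pow_three hT0.le
  have a2 : (K : ℝ) ^ (2 / 3 : ℝ) = a ^ 2 := rpow_two_thirds hK0.le
  have t2 : (T : ℝ) ^ (2 / 3 : ℝ) = t ^ 2 := rpow_two_thirds hT0.le
  set h := stormHyper cx cy cβ (Lf / ν) K T b₀ b with hh
  have hb₀' : c₀ * (t / a ^ 2) ≤ b₀ := by
    have := hb₀.1
    rwa [a2] at this
  have hb₀0 : (0 : ℝ) < b₀ := lt_of_lt_of_le (by positivity) hb₀'
  have ex : h.μx = cx * a ^ 2 / (t * (Lf / ν) ^ 2) := by rw [hh, stormHyper, a2]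
  have ey : h.μy = cy * a ^ 2 / t := by rw [hh, stormHyper, a2]
  have eβ : h.β = cβ * a / t ^ 2 := by rw [hh, stormHyper, t2]
  have hμx : 0 < h.μx := by rw [ex]; positivity
  have hμy : 0 < h.μy := by rw [ey]; positivity
  have hβ : 0 < h.β := by rw [eβ]; positivity
  have hr : IsRun Q W h Lf ν σ Pr ξ :=
    { K_pos := hK, ν_pos := hν, ν_le := hνL, comb := hW, psd := hP, reg := hR, pl := hPL
      smooth := hS, noise := hN, sampling := hξ, b_pos := hb
      b₀_pos := by exact_mod_cast hb₀0, β_nonneg := hβ.le, β_le := hA.β_le_one }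
  refine ⟨traj_integrable_gradNormSq hr hz, ?_⟩
  have hsum := traj_sum_le hr hz hA hμx hμy hβ T
  have hl : 0 < (1 - mixing W) ^ 2 := pow_pos (by linarith [hW.mixing_lt_one]) 2
  rw [avgGradNormSq, Real.mul_rpow hK0.le hT0.le, a2, t2]
  rw [← a3, ← t3] at hsum
  rw [← t3]
  exact rate_of_sum_le hcx hcy hcβ hc₀ hb0 (div_pos hL hν) ha0 ht0 hl
    (add_nonneg (sub_nonneg.2 (hPL.primalInf_le x₀)) (sub_nonneg.2 (hR.cost_le_primal x₀ y₀)))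
    (sq_nonneg σ) (initDiscrepancy_nonneg _) ex ey eβ hb₀' hsum

/-! ### Admissible hyperparameters -/

theorem tendsto_natCast_rpow {y : ℝ} (hy : 0 < y) :
    Filter.Tendsto (fun T : ℕ => (T : ℝ) ^ y) Filter.atTop Filter.atTop :=
  (tendsto_rpow_atTop hy).comp tendsto_natCast_atTop_atTop

set_option maxHeartbeats 1000000 in
/-- The step sizes decay like `T^{-1/3}`, the right-hand sides of the conditions are constant or
decay more slowly, or at the same rate with the assumed comparison of constants. -/
theorem eventually_admissible {δ Lf cx cy cβ c₀ c₁ ν lam : ℝ} {b K : ℕ} (hδ : 0 < δ) (hδ1 : δ ≤ 1)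
    (hcx : 0 < cx) (hcy : 0 < cy) (hcβ : 0 < cβ) (hc₀ : 0 < c₀) (hc : c₀ < c₁) (hb : 1 ≤ b)
    (hxy : cx ≤ δ * cy) (hyb : cy ≤ δ * (√(b * cβ) / Lf))
    (hν : 0 < ν) (hνL : ν ≤ Lf) (hl1 : lam < 1) (hK : 1 ≤ K) :
    ∃ T₀ : ℕ, ∀ T : ℕ, T₀ ≤ T → (∃ b₀ : ℕ, InitBatch c₀ c₁ K T b₀) ∧
      ∀ b₀ : ℕ, Admissible δ Lf ν lam K (stormHyper cx cy cβ (Lf / ν) K T b₀ b) := by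
  have hL : 0 < Lf := hν.trans_le hνL
  have hκ : 1 ≤ Lf / ν := (one_le_div hν).2 hνL
  have hK0 : (0 : ℝ) < K := by positivity
  have hb0 : (0 : ℝ) < b := by positivity
  have hs : √lam < 1 := by rw [Real.sqrt_lt' one_pos]; simpa using hl1
  set κ := Lf / ν with hκd
  have hκ0 : 0 < κ := by linarith
  set a := (K : ℝ) ^ (1 / 3 : ℝ) with ha
  have ha0 : 0 < a := by positivity
  have a3 : a ^ 3 = K := rpow_third_pow_three hK0.le
  have a2 : (K : ℝ) ^ (2 / 3 : ℝ) = a ^ 2 := rpow_two_thirds hK0.le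
  set s := (1 - √lam) * √(1 - lam) with hsd
  have hs0 : 0 < s := mul_pos (by linarith) (Real.sqrt_pos.2 (by linarith))
  set p := (1 - √lam) ^ (2 / 3 : ℝ) * (1 - lam) ^ (1 / 3 : ℝ) with hp
  have hp0 : 0 < p :=
    mul_pos (Real.rpow_pos_of_pos (by linarith) _) (Real.rpow_pos_of_pos (by linarith) _)
  set q := (a ^ 4 * b * cβ) ^ (1 / 3 : ℝ) with hq
  have hq0 : 0 < q := by positivity
  -- `u = T^{1/9}` makes all conditions polynomial
  have hu := tendsto_natCast_rpow (y := 1 / 9) (by norm_num)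
  have hv := tendsto_natCast_rpow (y := 1 / 3) (by norm_num)
  obtain ⟨T₀, hT₀⟩ := Filter.eventually_atTop.1 <|
    (hu.eventually_ge_atTop (Lf * κ ^ (1 / 3 : ℝ) * lam ^ (2 / 3 : ℝ) * (cy * a ^ 2)
      / (δ * (p * q)))).and <|
    (hv.eventually_ge_atTop 1).and <|
    (hv.eventually_ge_atTop (Lf * (1 + κ / 2) * (cx * a ^ 2 / κ ^ 2) / δ)).and <|
    (hv.eventually_ge_atTop (Lf * (cy * a ^ 2) / δ)).and <|
    (hv.eventually_ge_atTop (Lf * lam * (cy * a ^ 2) / (δ * s))).and <|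
    (hv.eventually_ge_atTop (Lf * lam * (cy * a ^ 2) / (δ * (s * √(b / (cβ * a)))))).and <|
    (hv.eventually_ge_atTop (2 * cβ / (ν * cy * a))).and <|
    (hv.eventually_ge_atTop (b * cβ * a ^ 4)).and <|
    (hv.eventually_ge_atTop (cβ * a)).and <|
    (hv.eventually_ge_atTop (a ^ 2 / (c₁ - c₀)))
  refine ⟨T₀ + 1, fun T hT => ?_⟩
  obtain ⟨h0, h1, h2, h3, h4, h5, h6, h7, h8, h9⟩ := hT₀ T (by omega)
  have hT0 : (0 : ℝ) < T := by
    have : 0 < T := by omega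
    exact_mod_cast this
  set t := (T : ℝ) ^ (1 / 3 : ℝ) with ht
  set u := (T : ℝ) ^ (1 / 9 : ℝ) with hud
  have ht0 : 0 < t := by positivity
  have hu0 : 0 < u := by positivity
  have t2 : (T : ℝ) ^ (2 / 3 : ℝ) = t ^ 2 := rpow_two_thirds hT0.le
  have u3 : u ^ 3 = t := by
    rw [hud, ht, ← Real.rpow_natCast, ← Real.rpow_mul hT0.le]; norm_num
  have tt : t ≤ t ^ 2 := by nlinarith
  refine ⟨⟨⌈c₀ * (t / a ^ 2)⌉₊, ?_⟩, fun b₀ => ?_⟩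
  · rw [InitBatch, a2]
    refine ⟨Nat.le_ceil _, (Nat.ceil_lt_add_one (by positivity)).le.trans ?_⟩
    rw [div_le_iff₀ (by linarith)] at h9
    have : 1 ≤ (c₁ - c₀) * (t / a ^ 2) := by
      rw [mul_div_assoc', one_le_div (by positivity)]; linarith
    linarith
  have ex : cx * a ^ 2 / (t * κ ^ 2) = cx * a ^ 2 / κ ^ 2 / t := by field_simp
  have eβ : cβ * (K : ℝ) ^ (1 / 3 : ℝ) / (T : ℝ) ^ (2 / 3 : ℝ) = cβ * a / t ^ 2 := by rw [t2]
  have eR : K * b * (cβ * a / t ^ 2) = (a ^ 2 / t) ^ 2 * (b * cβ) := by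
    rw [← a3]; field_simp
  have eS : √(K * b * (cβ * a / t ^ 2)) = a ^ 2 / t * √(b * cβ) := by
    rw [eR, Real.sqrt_mul (by positivity), Real.sqrt_sq (by positivity)]
  have hyb' : Lf * cy ≤ δ * √(b * cβ) := by
    have := mul_le_mul_of_nonneg_left hyb hL.le
    have e : Lf * (δ * (√(b * cβ) / Lf)) = δ * √(b * cβ) := by field_simp
    linarith
  have hR0 := Real.sqrt_nonneg (b * cβ)
  refine { μx_smooth := ?_, μx_ratio := ?_, μx_batch := ?_, μy_pl := ?_, μy_smooth := ?_,
           μy_batch := ?_, μy_network := ?_, μy_network_batch := ?_, μy_cubic := ?_,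
           β_pl := ?_, β_batch := ?_, β_le_one := ?_ }
  all_goals simp only [stormHyper, eβ, eS, a2, ← hκd, ← ht, ← hsd, ← hp, ex]
  · rw [div_le_iff₀ hδ] at h2
    rw [mul_div_assoc', div_le_iff₀ ht0]; linarith
  · have e : κ ^ 2 * (cx * a ^ 2 / κ ^ 2 / t) = cx * (a ^ 2 / t) := by field_simp
    rw [e, show δ * (cy * a ^ 2 / t) = δ * cy * (a ^ 2 / t) by ring]
    gcongr
  · have e : κ * Lf * (cx * a ^ 2 / κ ^ 2 / t) = Lf * cx / κ * (a ^ 2 / t) := by field_simp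
    rw [e, show δ * (a ^ 2 / t * √(b * cβ)) = δ * √(b * cβ) * (a ^ 2 / t) by ring]
    refine mul_le_mul_of_nonneg_right ?_ (by positivity)
    refine (div_le_self (by positivity) hκ).trans (le_trans ?_ hyb')
    refine mul_le_mul_of_nonneg_left (hxy.trans (mul_le_of_le_one_left hcy.le hδ1)) hL.le
  · rw [div_le_iff₀ hδ] at h3
    rw [mul_div_assoc', div_le_iff₀ ht0]
    have : ν * (cy * a ^ 2) ≤ Lf * (cy * a ^ 2) := by gcongr
    linarith
  · rw [div_le_iff₀ hδ] at h3
    rw [mul_div_assoc', div_le_iff₀ ht0]; linarith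
  · rw [show Lf * (cy * a ^ 2 / t) = Lf * cy * (a ^ 2 / t) by ring,
      show δ * (a ^ 2 / t * √(b * cβ)) = δ * √(b * cβ) * (a ^ 2 / t) by ring]
    gcongr
  · rw [div_le_iff₀ (by positivity)] at h4
    rw [mul_div_assoc', div_le_iff₀ ht0]; linarith
  · have e : √(b / (cβ * a / t ^ 2)) = t * √(b / (cβ * a)) := by
      rw [show b / (cβ * a / t ^ 2) = t ^ 2 * (b / (cβ * a)) by field_simp,
        Real.sqrt_mul (by positivity), Real.sqrt_sq ht0.le]
    have hw : 0 < √(b / (cβ * a)) := Real.sqrt_pos.2 (by positivity)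
    rw [div_le_iff₀ (by positivity)] at h5
    rw [e, mul_div_assoc', div_le_iff₀ ht0]
    calc _ ≤ t * (δ * (s * √(b / (cβ * a)))) := h5
      _ ≤ t ^ 2 * (δ * (s * √(b / (cβ * a)))) := by gcongr
      _ = _ := by ring
  · have e : (K * b * (cβ * a / t ^ 2)) ^ (1 / 3 : ℝ) = q / u ^ 2 := by
      have e1 : K * b * (cβ * a / t ^ 2) = a ^ 4 * b * cβ / (u ^ 2) ^ 3 := by
        rw [← a3, ← u3]; field_simp
      rw [e1, Real.div_rpow (by positivity) (by positivity), hq,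
        ← Real.rpow_natCast (u ^ 2) 3, ← Real.rpow_mul (by positivity)]
      norm_num
    rw [div_le_iff₀ (by positivity)] at h0
    rw [e, ← u3, mul_div_assoc', div_le_iff₀ (by positivity)]
    calc _ ≤ u * (δ * (p * q)) := h0
      _ = _ := by field_simp
  · rw [div_le_iff₀ (by positivity)] at h6
    rw [div_le_div_iff₀ (by positivity) two_pos]
    have : ν * (cy * a ^ 2 / t) * t ^ 2 = t * (ν * cy * a) * a := by field_simp
    rw [this]
    linarith [mul_le_mul_of_nonneg_right h6 ha0.le]
  · rw [mul_div_assoc', div_le_div_iff₀ (by positivity) hK0, ← a3]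
    linarith
  · rw [div_le_one (by positivity)]; linarith

/-! ### The transient time -/

theorem div_le_iff_rpow_div_le {x y T p : ℝ} (hx : 0 ≤ x) (hy : 0 < y) (hT : 0 ≤ T) (hp : 0 < p) :
    x / y ≤ T ↔ x ^ p ≤ T ^ p * y ^ p := by
  rw [← Real.rpow_le_rpow_iff (by positivity) hT hp, Real.div_rpow hx hy.le,
    div_le_iff₀ (by positivity)]

/-- Each network-dependent term is compared with the linear-speedup term separately; both sides of
the comparison are powers of the corresponding bound on `T`. -/
theorem linearSpeedup_iff {κ lam : ℝ} {K T : ℕ} (hκ : 0 < κ) (hl0 : 0 ≤ lam) (hl1 : lam < 1)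
    (hK : 1 ≤ K) (hT : 1 ≤ T) : LinearSpeedup κ lam K T ↔ transientTime lam K ≤ T := by
  have hK0 : (0 : ℝ) < K := by positivity
  have hT0 : (0 : ℝ) < T := by positivity
  obtain ⟨s, hs, hs0⟩ : ∃ s, 1 - lam = s ∧ 0 < s := ⟨_, rfl, by linarith⟩
  set k := (K : ℝ) ^ (1 / 3 : ℝ) with hk
  set t := (T : ℝ) ^ (1 / 3 : ℝ) with ht
  have hk0 : 0 < k := by positivity
  have ht0 : 0 < t := by positivity
  have powK : ∀ n : ℕ, (K : ℝ) ^ ((n : ℝ) / 3) = k ^ n := fun n => by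
    rw [hk, ← Real.rpow_natCast, ← Real.rpow_mul hK0.le]; congr 1; ring
  have powT : ∀ n : ℕ, (T : ℝ) ^ ((n : ℝ) / 3) = t ^ n := fun n => by
    rw [ht, ← Real.rpow_natCast, ← Real.rpow_mul hT0.le]; congr 1; ring
  have k3 : (K : ℝ) = k ^ 3 := (rpow_third_pow_three hK0.le).symm
  have t3 : (T : ℝ) = t ^ 3 := (rpow_third_pow_three hT0.le).symm
  have K2 := powK 2
  have K4 := powK 4
  have K5 := powK 5
  have K7 := powK 7
  have T1 := powT 1
  have T2 := powT 2
  have T4 := powT 4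
  have T5 := powT 5
  have T7 := powT 7
  push_cast at K2 K4 K5 K7 T1 T2 T4 T5 T7
  have i1 : (K : ℝ) ^ 2 / s ^ 6 ≤ T ↔ k ^ 2 ≤ t * s ^ 2 := by
    rw [div_le_iff_rpow_div_le (by positivity) (by positivity) hT0.le (p := 1 / 3) (by norm_num),
      ← ht, ← Real.rpow_natCast, ← Real.rpow_mul hK0.le, ← Real.rpow_natCast s 6,
      ← Real.rpow_mul hs0.le]
    norm_num [K2]
  have i2 : lam ^ 3 * (K : ℝ) ^ 2 / s ^ (9 / 2 : ℝ) ≤ T ↔ lam ^ 2 * k ^ 4 ≤ t ^ 2 * s ^ 3 := by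
    rw [div_le_iff_rpow_div_le (by positivity) (by positivity) hT0.le (p := 2 / 3) (by norm_num),
      Real.mul_rpow (by positivity) (by positivity), ← Real.rpow_natCast lam 3,
      ← Real.rpow_mul hl0, ← Real.rpow_natCast (K : ℝ) 2, ← Real.rpow_mul hK0.le,
      ← Real.rpow_mul hs0.le, T2]
    norm_num [K4]
  have i3 : lam ^ (3 / 2 : ℝ) * (K : ℝ) ^ (5 / 4 : ℝ) / s ^ (9 / 4 : ℝ) ≤ T
      ↔ lam ^ 2 * k ^ 5 ≤ t ^ 4 * s ^ 3 := by
    rw [div_le_iff_rpow_div_le (by positivity) (by positivity) hT0.le (p := 4 / 3) (by norm_num),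
      Real.mul_rpow (by positivity) (by positivity), ← Real.rpow_mul hl0, ← Real.rpow_mul hK0.le,
      ← Real.rpow_mul hs0.le, T4]
    norm_num [K5]
  have i4 : lam ^ (6 / 5 : ℝ) * (K : ℝ) ^ (7 / 5 : ℝ) / s ^ (12 / 5 : ℝ) ≤ T
      ↔ lam ^ 2 * k ^ 7 ≤ t ^ 5 * s ^ 4 := by
    rw [div_le_iff_rpow_div_le (by positivity) (by positivity) hT0.le (p := 5 / 3) (by norm_num),
      Real.mul_rpow (by positivity) (by positivity), ← Real.rpow_mul hl0, ← Real.rpow_mul hK0.le,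
      ← Real.rpow_mul hs0.le, T5]
    norm_num [K7]
  have e : (K * T : ℝ) ^ (2 / 3 : ℝ) = k ^ 2 * t ^ 2 := by
    rw [Real.mul_rpow hK0.le hT0.le, K2, T2]
  have hκ2 : 0 < κ ^ 2 := by positivity
  -- clearing denominators in one comparison
  have cmp : ∀ {x y v w : ℝ}, 0 < y → (∃ c : ℝ, 0 < c ∧ κ ^ 2 * y = w * c ∧
      x * (k ^ 2 * t ^ 2) = v * c) → (x / y ≤ κ ^ 2 / (k ^ 2 * t ^ 2) ↔ v ≤ w) := by
    rintro x y v w hy ⟨c, hc, e1, e2⟩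
    rw [div_le_div_iff₀ hy (by positivity), e1, e2, mul_le_mul_iff_left₀ hc]
  rw [LinearSpeedup, transientTime, max_le_iff, max_le_iff, max_le_iff, hs, i1, i2, i3, i4, e, K2,
    K5, T4, T7,
    cmp (v := k ^ 2) (w := t * s ^ 2) (by positivity)
      ⟨κ ^ 2 * t ^ 2, by positivity, by rw [t3]; ring, by ring⟩,
    cmp (v := lam ^ 2 * k ^ 4) (w := t ^ 2 * s ^ 3) (by positivity)
      ⟨κ ^ 2 * t ^ 2, by positivity, by ring, by ring⟩,
    cmp (v := lam ^ 2 * k ^ 5) (w := t ^ 4 * s ^ 3) (by positivity)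
      ⟨κ ^ 2 * t ^ 2, by positivity, by rw [t3]; ring, by rw [k3]; ring⟩,
    cmp (v := lam ^ 2 * k ^ 7) (w := t ^ 5 * s ^ 4) (by positivity)
      ⟨κ ^ 2 * t ^ 2, by positivity, by ring, by ring⟩]
  tauto

/-- The first four terms are part of the rate. -/
theorem le_rate {κ lam K T G Δ V Z : ℝ} (hl1 : lam < 1) (hK : 0 ≤ K) (hT : 0 ≤ T)
    (hV : 0 ≤ V) (hZ : 0 ≤ Z) :
    κ ^ 2 * (G + Δ + V) / (K * T) ^ (2 / 3 : ℝ) + κ ^ 2 * Z / (T * (1 - lam) ^ 2)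
      ≤ rate κ lam K T G Δ V Z := by
  have : 0 ≤ 1 - lam := by linarith
  rw [rate, mul_add, mul_add, add_div, add_div]
  refine le_add_of_le_of_nonneg (le_add_of_le_of_nonneg (le_add_of_nonneg_right ?_) ?_) ?_ <;>
    positivity

/-! ### Sample complexity -/

theorem le_complexity {κ lam K ε : ℝ} (hκ : 0 ≤ κ) (hl0 : 0 ≤ lam) (hl1 : lam < 1) (hK : 0 ≤ K)
    (hε : 0 ≤ ε) : κ ^ 3 * ε⁻¹ ^ 3 / K + κ ^ 2 * ε⁻¹ ^ 2 / (1 - lam) ^ 2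
      ≤ complexity κ lam K ε := by
  have : 0 ≤ 1 - lam := by linarith
  rw [complexity]
  exact le_add_of_nonneg_right (by positivity)

/-- The constant of the sample complexity; its power `2 / 3`, in which it enters the leading term of
the rate, is at least `2 * C * D`. -/
noncomputable def complexityConst (C D : ℝ) : ℝ := (1 + 2 * C * D) ^ 3

theorem le_sq_of_complexity_le {C D κ lam ε A Z : ℝ} {K T : ℕ} (hC : 0 < C) (hD : 0 < D)
    (hκ : 0 < κ) (hl0 : 0 ≤ lam) (hl1 : lam < 1) (hK : 1 ≤ K) (hε : 0 < ε)
    (hT : complexityConst C D * complexity κ lam K ε ≤ T) (hA : A ≤ D) (hZ : Z ≤ D) :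
    C * (κ ^ 2 * A / ((K : ℝ) * T) ^ (2 / 3 : ℝ) + κ ^ 2 * Z / (T * (1 - lam) ^ 2)) ≤ ε ^ 2 := by
  have hK0 : (0 : ℝ) < K := by positivity
  have hs0 : 0 < 1 - lam := by linarith
  set B := 1 + 2 * C * D with hB
  have hCD : 0 < C * D := by positivity
  have hB1 : 1 ≤ B := by linarith
  have hcc : complexityConst C D = B ^ 3 := rfl
  have hlow := (mul_le_mul_of_nonneg_left
    (le_complexity hκ.le hl0 hl1 hK0.le hε.le) (by rw [hcc]; positivity)).trans hT
  rw [mul_add, hcc] at hlow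
  have n1 : 0 ≤ B ^ 3 * (κ ^ 3 * ε⁻¹ ^ 3 / K) := by positivity
  have n2 : 0 < B ^ 3 * (κ ^ 2 * ε⁻¹ ^ 2 / (1 - lam) ^ 2) := by positivity
  have hT0 : (0 : ℝ) < T := by linarith
  have h1 : (B * κ * ε⁻¹) ^ 3 ≤ K * T := by
    have : B ^ 3 * (κ ^ 3 * ε⁻¹ ^ 3 / K) ≤ T := by linarith
    rw [mul_div_assoc', div_le_iff₀ hK0] at this
    linarith [show (B * κ * ε⁻¹) ^ 3 = B ^ 3 * (κ ^ 3 * ε⁻¹ ^ 3) by ring]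
  have h2 : (B * κ * ε⁻¹) ^ 2 ≤ ((K : ℝ) * T) ^ (2 / 3 : ℝ) := by
    refine le_trans (le_of_eq ?_) (Real.rpow_le_rpow (by positivity) h1 (by norm_num))
    rw [← Real.rpow_natCast _ 3, ← Real.rpow_mul (by positivity), ← Real.rpow_natCast _ 2]
    norm_num
  have h3 : B ^ 3 * (κ ^ 2 * ε⁻¹ ^ 2) ≤ T * (1 - lam) ^ 2 := by
    have : B ^ 3 * (κ ^ 2 * ε⁻¹ ^ 2 / (1 - lam) ^ 2) ≤ T := by linarith
    rwa [mul_div_assoc', div_le_iff₀ (by positivity)] at this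
  have b2 : 2 * C * D ≤ B ^ 2 := by nlinarith
  have b3 : 2 * C * D ≤ B ^ 3 := b2.trans (pow_le_pow_right₀ hB1 (by norm_num))
  have eε : ε ^ 2 * ε⁻¹ ^ 2 = 1 := by rw [← mul_pow, mul_inv_cancel₀ hε.ne', one_pow]
  have t1 : C * (κ ^ 2 * A / ((K : ℝ) * T) ^ (2 / 3 : ℝ)) ≤ ε ^ 2 / 2 := by
    rw [mul_div_assoc', div_le_iff₀ (by positivity)]
    calc C * (κ ^ 2 * A) ≤ C * (κ ^ 2 * D) := by gcongr
      _ = (2 * C * D) * κ ^ 2 / 2 * (ε ^ 2 * ε⁻¹ ^ 2) := by rw [eε]; ring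
      _ ≤ B ^ 2 * κ ^ 2 / 2 * (ε ^ 2 * ε⁻¹ ^ 2) := by gcongr
      _ = ε ^ 2 / 2 * (B * κ * ε⁻¹) ^ 2 := by ring
      _ ≤ _ := by gcongr
  have t2 : C * (κ ^ 2 * Z / (T * (1 - lam) ^ 2)) ≤ ε ^ 2 / 2 := by
    rw [mul_div_assoc', div_le_iff₀ (by positivity)]
    calc C * (κ ^ 2 * Z) ≤ C * (κ ^ 2 * D) := by gcongr
      _ = (2 * C * D) * κ ^ 2 / 2 * (ε ^ 2 * ε⁻¹ ^ 2) := by rw [eε]; ring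
      _ ≤ B ^ 3 * κ ^ 2 / 2 * (ε ^ 2 * ε⁻¹ ^ 2) := by gcongr
      _ = ε ^ 2 / 2 * (B ^ 3 * (κ ^ 2 * ε⁻¹ ^ 2)) := by ring
      _ ≤ _ := by gcongr
  rw [mul_add]
  linarith

/-- For small `ε` the prescribed number of iterations is large. -/
theorem le_complexity_of_le {κ lam ε N : ℝ} {K : ℕ} (hκ : 1 ≤ κ) (hl0 : 0 ≤ lam) (hl1 : lam < 1)
    (hK : 1 ≤ K) (hN : 1 ≤ N) (hε : 0 < ε) (hεN : ε ≤ 1 / (K * N)) :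
    N ≤ complexity κ lam K ε := by
  have hK1 : (1 : ℝ) ≤ K := by exact_mod_cast hK
  have hK0 : (0 : ℝ) < K := by linarith
  have hs0 : 0 < 1 - lam := by linarith
  refine le_trans ?_ (le_complexity (by linarith) hl0 hl1 hK0.le hε.le)
  have h1 : K * N ≤ ε⁻¹ := by
    rw [le_inv_comm₀ (by positivity) hε]; simpa using hεN
  have h2 : 1 ≤ K * N := by nlinarith
  have h3 : ε⁻¹ ≤ κ ^ 3 * ε⁻¹ ^ 3 := by
    have i1 : 1 ≤ κ ^ 3 := one_le_pow₀ hκ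
    have i2 : ε⁻¹ ≤ ε⁻¹ ^ 3 := le_self_pow₀ (by linarith) (by norm_num)
    calc ε⁻¹ ≤ ε⁻¹ ^ 3 := i2
      _ ≤ _ := le_mul_of_one_le_left (by positivity) i1
  have h4 : N ≤ κ ^ 3 * ε⁻¹ ^ 3 / K := by rw [le_div_iff₀ hK0]; linarith
  exact le_add_of_le_of_nonneg h4 (by positivity)

theorem sampleCount_le {c₁ S : ℝ} {b b₀ K T : ℕ} (hc : 0 ≤ c₁) (hK : 1 ≤ K) (hT : 1 ≤ T)
    (hTS : (T : ℝ) ≤ 2 * S) (hb₀ : (b₀ : ℝ) ≤ c₁ * ((T : ℝ) ^ (1 / 3 : ℝ) / (K : ℝ) ^ (2 / 3 : ℝ))) :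
    ((b₀ + b * T : ℕ) : ℝ) ≤ (c₁ + b) * (2 * S) := by
  have hK1 : (1 : ℝ) ≤ K := by exact_mod_cast hK
  have hT1 : (1 : ℝ) ≤ T := by exact_mod_cast hT
  have h1 : (T : ℝ) ^ (1 / 3 : ℝ) / (K : ℝ) ^ (2 / 3 : ℝ) ≤ T :=
    (div_le_self (by positivity) (Real.one_le_rpow hK1 (by norm_num))).trans
      ((Real.rpow_le_rpow_of_exponent_le hT1 (by norm_num)).trans (Real.rpow_one _).le)
  push_cast
  calc (b₀ : ℝ) + b * T ≤ c₁ * T + b * T := by gcongr; exact hb₀.trans (by gcongr)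
    _ = (c₁ + b) * T := by ring
    _ ≤ _ := by gcongr

end DAMA

theorem mainTheorem2 :
    -- a numerical constant for the hyperparameter conditions
    ∃ δ : ℝ, 0 < δ ∧ δ ≤ 1 ∧
    ∀ (Lf cx cy cβ c₀ c₁ : ℝ) (b : ℕ),
      0 < Lf → 0 < cx → 0 < cy → 0 < cβ → 0 < c₀ → c₀ < c₁ → 1 ≤ b →
      cx ≤ δ * cy → cy ≤ δ * (√(b * cβ) / Lf) →
    -- the hyperparameter conditions hold for sufficiently large `T`
    (∀ (ν lam : ℝ) (K : ℕ), 0 < ν → ν ≤ Lf → 0 ≤ lam → lam < 1 → 1 ≤ K →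
      ∃ T₀ : ℕ, ∀ T : ℕ, T₀ ≤ T →
        (∃ b₀ : ℕ, DAMA.InitBatch c₀ c₁ K T b₀) ∧
        ∀ b₀ : ℕ, DAMA.Admissible δ Lf ν lam K
          (DAMA.stormHyper cx cy cβ (Lf / ν) K T b₀ b)) ∧
    -- the transient time
    (∀ (κ lam : ℝ) (K T : ℕ), 0 < κ → 0 ≤ lam → lam < 1 → 1 ≤ K → 1 ≤ T →
      (DAMA.LinearSpeedup κ lam K T ↔ DAMA.transientTime lam K ≤ T)) ∧
    -- the performance guarantees
    ∃ (C : ℝ) (Csc : ℝ → ℝ), 0 < C ∧ (∀ D, 0 < D → 0 < Csc D) ∧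
      (∀ (ν σ : ℝ) (K d₁ d₂ T b₀ : ℕ) (W : Matrix (Fin K) (Fin K) ℝ)
        (Ξ : Type*) [MeasurableSpace Ξ] (Q : DAMA.Problem K d₁ d₂ Ξ)
        (Ω : Type*) [MeasurableSpace Ω] (Pr : MeasureTheory.Measure Ω)
        [MeasureTheory.IsProbabilityMeasure Pr] (ξ : ℕ → ℕ → Fin K → Ω → Ξ)
        (x₀ dx₀ : DAMA.Vec d₁) (y₀ dy₀ : DAMA.Vec d₂),
        0 < ν → ν ≤ Lf → 0 ≤ σ → 1 ≤ K → 1 ≤ T →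
        DAMA.IsCombination W → W.PosSemidef →
        Q.Regular → Q.PLCondition ν → Q.ExpectedSmooth Lf → Q.GradientNoise σ →
        Q.IsSampling Pr ξ →
        DAMA.InitBatch c₀ c₁ K T b₀ →
        DAMA.Admissible δ Lf ν (DAMA.mixing W) K
          (DAMA.stormHyper cx cy cβ (Lf / ν) K T b₀ b) →
        ∀ (κ lam G Δ Z : ℝ) (S : DAMA.Design K) (z : ℕ → Ω → DAMA.State K d₁ d₂),
        κ = Lf / ν → lam = DAMA.mixing W → S = DAMA.Design.ED W →
        z = (fun i ω => DAMA.iterate Q S (DAMA.stormHyper cx cy cβ κ K T b₀ b) x₀ dx₀ y₀ dy₀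
          (fun i j k => ξ i j k ω) i) →
        G = Q.primal x₀ - Q.primalInf → Δ = Q.primal x₀ - Q.cost x₀ y₀ →
        Z = DAMA.initDiscrepancy Pr S z →
        (∀ i < T, MeasureTheory.Integrable (fun ω => DAMA.gradNormSq Q (z i ω)) Pr) ∧
        -- the rate
        DAMA.avgGradNormSq Q Pr T z ≤ C * DAMA.rate κ lam K T G Δ (σ ^ 2) Z ∧
        -- its dominating part
        DAMA.avgGradNormSq Q Pr T z ≤
          C * (κ ^ 2 * (G + Δ + σ ^ 2) / ((K : ℝ) * T) ^ (2 / 3 : ℝ)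
            + κ ^ 2 * Z / (T * (1 - lam) ^ 2)) ∧
        -- linear speedup after the transient time
        (DAMA.transientTime lam K ≤ T →
          DAMA.avgGradNormSq Q Pr T z ≤
            C * (κ ^ 2 * (G + Δ + σ ^ 2 + Z) / ((K : ℝ) * T) ^ (2 / 3 : ℝ))) ∧
        -- accuracy `ε` is reached within the stated number of iterations
        (∀ D ε : ℝ, 0 < D → 0 < ε → G + Δ + σ ^ 2 + Z ≤ D →
          Csc D * DAMA.complexity κ lam K ε ≤ T →
          DAMA.avgGradNormSq Q Pr T z ≤ ε ^ 2)) ∧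
      -- the sample complexity: the number of samples per agent in that many iterations
      (∀ D : ℝ, 0 < D → ∃ M : ℝ, 0 < M ∧
        ∀ (ν lam : ℝ) (K : ℕ), 0 < ν → ν ≤ Lf → 0 ≤ lam → lam < 1 → 1 ≤ K →
        ∃ ε₀ : ℝ, 0 < ε₀ ∧ ∀ ε : ℝ, 0 < ε → ε ≤ ε₀ → ∀ T : ℕ,
          T = ⌈Csc D * DAMA.complexity (Lf / ν) lam K ε⌉₊ →
          1 ≤ T ∧
          (∃ b₀ : ℕ, DAMA.InitBatch c₀ c₁ K T b₀) ∧
          ∀ b₀ : ℕ, DAMA.InitBatch c₀ c₁ K T b₀ →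
            DAMA.Admissible δ Lf ν lam K (DAMA.stormHyper cx cy cβ (Lf / ν) K T b₀ b) ∧
            ((b₀ + b * T : ℕ) : ℝ) ≤ M * DAMA.complexity (Lf / ν) lam K ε) := by
  -- `1 / 1024` is small enough for `SmoothPL.sum_descent` and `ErrorRecursion.sum_grad_le`
  refine ⟨1 / 1024, by norm_num, by norm_num, ?_⟩
  intro Lf cx cy cβ c₀ c₁ b hL hcx hcy hcβ hc₀ hc hb hxy hyb
  have hb0 : (0 : ℝ) < b := by positivity
  have hadm : ∀ (ν lam : ℝ) (K : ℕ), 0 < ν → ν ≤ Lf → 0 ≤ lam → lam < 1 → 1 ≤ K →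
      ∃ T₀ : ℕ, ∀ T : ℕ, T₀ ≤ T → (∃ b₀ : ℕ, DAMA.InitBatch c₀ c₁ K T b₀) ∧
        ∀ b₀ : ℕ, DAMA.Admissible (1 / 1024) Lf ν lam K
          (DAMA.stormHyper cx cy cβ (Lf / ν) K T b₀ b) := fun ν lam K hν hνL _ hl1 hK =>
    DAMA.eventually_admissible (by norm_num) (by norm_num) hcx hcy hcβ hc₀ hc hb hxy hyb hν hνL
      hl1 hK
  refine ⟨hadm, fun κ lam K T => DAMA.linearSpeedup_iff, ?_⟩
  have hC := DAMA.rateConst_pos hcx hcy hcβ hc₀ hb0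
  set C := DAMA.rateConst cx cy cβ c₀ b
  have hcc : ∀ D, 0 < D → 1 ≤ DAMA.complexityConst C D := fun D hD =>
    one_le_pow₀ (by nlinarith [mul_pos hC hD])
  refine ⟨C, DAMA.complexityConst C, hC, fun D hD => one_pos.trans_le (hcc D hD), ?_, ?_⟩
  · intro ν σ K d₁ d₂ T b₀ W Ξ _ Q Ω _ Pr _ ξ x₀ dx₀ y₀ dy₀ hν hνL _ hK hT hW hP hR hPL hS hN hξ
      hb₀ hA κ lam G Δ Z S z hκ hlam hSd hz hG hΔ hZ
    subst hκ hlam hSd hG hΔ hZ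
    obtain ⟨hint, hmain⟩ := DAMA.avgGradNormSq_le (dx₀ := dx₀) (dy₀ := dy₀) hcx hcy hcβ hc₀ hb hν
      hνL hK hT hW hP hR hPL hS hN hξ hb₀ hA hz
    have hκ0 : 0 < Lf / ν := div_pos hL hν
    have hl0 := DAMA.mixing_nonneg hP
    have hl1 := hW.mixing_lt_one
    have hs0 : 0 < 1 - DAMA.mixing W := by linarith
    have hG0 : 0 ≤ Q.primal x₀ - Q.primalInf := sub_nonneg.2 (hPL.primalInf_le x₀)
    have hΔ0 : 0 ≤ Q.primal x₀ - Q.cost x₀ y₀ := sub_nonneg.2 (hR.cost_le_primal x₀ y₀)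
    have hZ0 : 0 ≤ DAMA.initDiscrepancy Pr (DAMA.Design.ED W) z := DAMA.initDiscrepancy_nonneg _
    have hV0 := sq_nonneg σ
    refine ⟨fun i _ => hint i, hmain.trans (mul_le_mul_of_nonneg_left ?_ hC.le), hmain,
      fun htr => hmain.trans (mul_le_mul_of_nonneg_left ?_ hC.le), ?_⟩
    · exact DAMA.le_rate hl1 (Nat.cast_nonneg K) (Nat.cast_nonneg T) hV0 hZ0
    · -- only the first comparison of the linear-speedup property is needed
      have h1 := ((DAMA.linearSpeedup_iff hκ0 hl0 hl1 hK hT).2 htr).1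
      have h2 := mul_le_mul_of_nonneg_right h1 hZ0
      rw [mul_add _ _ (DAMA.initDiscrepancy Pr _ z), add_div]
      refine add_le_add le_rfl ?_
      rwa [div_mul_eq_mul_div, div_mul_eq_mul_div] at h2
    · intro D ε hD hε hsum hTc
      exact hmain.trans (DAMA.le_sq_of_complexity_le hC hD hκ0 hl0 hl1 hK hε hTc (by linarith)
        (by linarith))
  · intro D hD
    have hc1 : 0 < c₁ := hc₀.trans hc
    have hcD := hcc D hD
    refine ⟨(c₁ + b) * (2 * DAMA.complexityConst C D), by positivity, ?_⟩
    intro ν lam K hν hνL hl0 hl1 hK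
    have hK0 : (0 : ℝ) < K := by positivity
    obtain ⟨T₀, hT₀⟩ := hadm ν lam K hν hνL hl0 hl1 hK
    have hN : (1 : ℝ) ≤ max 1 (T₀ : ℝ) := le_max_left _ _
    refine ⟨1 / (K * max 1 (T₀ : ℝ)), by positivity, ?_⟩
    intro ε hε hεN T hT
    have hS := DAMA.le_complexity_of_le ((one_le_div hν).2 hνL) hl0 hl1 hK hN hε hεN
    set S := DAMA.complexity (Lf / ν) lam K ε
    have hcS : max 1 (T₀ : ℝ) ≤ DAMA.complexityConst C D * S :=
      hS.trans (le_mul_of_one_le_left (by linarith) hcD)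
    have hTl : DAMA.complexityConst C D * S ≤ T := hT ▸ Nat.le_ceil _
    have hTu : (T : ℝ) ≤ 2 * (DAMA.complexityConst C D * S) := by
      have := Nat.ceil_lt_add_one (a := DAMA.complexityConst C D * S) (by linarith)
      rw [← hT] at this
      linarith
    have hT1 : 1 ≤ T := by exact_mod_cast hN.trans (hcS.trans hTl)
    have hTT : T₀ ≤ T := by exact_mod_cast (le_max_right _ _).trans (hcS.trans hTl)
    refine ⟨hT1, (hT₀ T hTT).1, fun b₀ hb₀ => ⟨(hT₀ T hTT).2 b₀, ?_⟩⟩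
    refine (DAMA.sampleCount_le hc1.le hK hT1 hTu hb₀.2).trans (le_of_eq ?_)
    ring
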